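/- Theorem 7.11. Let $R$ be a commutative ring in which $2$ is not a zero divisor (i.e. $2r=0$ implies $r=0$; for an integral domain this says that its characteristic is different from $2$), and let $F,F'$ be commutative one-dimensional formal group laws over $R$. Notation. Let $\Lambda$ be the weight lattice of a root system with Weyl group $W$ and fundamental weights $\omega_1,\dots,\omega_n$. The formal group algebra $R[[\Lambda]]_F$ is the quotient of the completion of $R[x_\lambda : \lambda\in\Lambda]$ at the kernel of $x_\lambda\mapsto 0$ by the closure of the ideal generated by $x_0$ and all $x_{\lambda+\mu}-F(x_\lambda,x_\mu)$. Let $\mathcal I_F$ be the kernel of $R[[\Lambda]]_F\to R$, $x_\lambda\mapsto 0$, let $\mathcal I_F^W$ be the ideal generated by the $W$-invariant elements of $\mathcal I_F$, and put $(\mathcal I_F^W)^{(d)}=(\mathcal I_F^W\cap\mathcal I_F^d)/(\mathcal I_F^W\cap\mathcal I_F^{d+1})\subseteq\mathcal I_F^d/\mathcal I_F^{d+1}$. The deformation map $\Phi^{F\to F'}\colon R[[\Lambda]]_F\to R[[\Lambda]]_{F'}$ is the continuous $R$-algebra homomorphism with $x_{\omega_i}\mapsto x_{\omega_i}$, i.e.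 $x_\lambda\mapsto (a_1\cdot_F x_{\omega_1})+_F\cdots+_F(a_n\cdot_F x_{\omega_n})$ for $\lambda=\sum a_i\omega_i$; let $\Phi_d^{F\to F'}\colon\mathcal I_F^d/\mathcal I_F^{d+1}\to\mathcal I_{F'}^d/\mathcal I_{F'}^{d+1}$ be the induced map. The $d$-th exponent $\tau_d^{F\to F'}$ is the smallest positive integer $N$, coprime to the characteristic of $R$ if that characteristic is not $0$, such that $$N\cdot(\mathcal I_{F'}^W)^{(d)}\subseteq\Phi_d^{F\to F'}\big((\mathcal I_F^W)^{(d)}\big).$$ The torsion index $t$ of the root system is the index of the image of the characteristic map $S^N(\Lambda)\to H^{2N}(G/B;\mathbb Z)=\mathbb Z$, where $G$ is the simply connected group and $N$ is the number of positive roots; equivalently, it is the smallest positive integer $c$ such that $\sum_{w\in W}\det(w)\,w(f)=c\prod_{\beta>0}\beta$ for some $f\in S^N(\Lambda)$. Claim. In each of the following cases the exponent $\tau_d^{F\to F'}$ exists, and: 1. for type $B_n$ with $n\ge 3$ and every $d\ge 1$, $\tau_d^{F\to F'}\mid 2^d$; 2. for type $D_n$ with $n\ge 4$ and $1\le d<n$,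 $\tau_d^{F\to F'}\mid 2^d$; 3. for type $G_2$ and every even $d\ge 2$, $\tau_d^{F\to F'}\mid 2^{\zeta_d}$, where $\zeta_d=\frac{3k(k+1)}{2}+\frac r2$ with $d=6k+r$, $0\le r<6$; 4. for type $A_n$ ($n\ge 1$), $B_n$ ($n\ge 3$), $C_n$ ($n\ge 2$), $D_n$ ($n\ge 4$) or $G_2$, if the torsion index $t$ is invertible in $R$, then $\tau_d^{F\to F'}=1$ for every $d\ge 1$. -/

import Mathlib

noncomputable section

namespace FGExp

section Inverse

variable {R : Type*} [CommRing R] (F : FormalGroup R)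

open MvPowerSeries in
lemma dvd_subst_sub {v v' : PowerSeries R} (hv : PowerSeries.constantCoeff v = 0)
    (hv' : PowerSeries.constantCoeff v' = 0) {k : ℕ} (h : PowerSeries.X ^ k ∣ v - v') :
    PowerSeries.X ^ (k + 1) ∣
      (F.toPowerSeries.subst ![PowerSeries.X, v] : PowerSeries R) -
        F.toPowerSeries.subst ![PowerSeries.X, v'] - (v - v') := by
  have hs (w : PowerSeries R) (hw : PowerSeries.constantCoeff w = 0) :
      HasSubst ![(PowerSeries.X : PowerSeries R), w] :=
    hasSubst_of_constantCoeff_zero fun s => by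
      fin_cases s
      · exact PowerSeries.constantCoeff_X
      · exact hw
  have key (d : Fin 2 →₀ ℕ) (hd : d ≠ Finsupp.single 1 1) :
      PowerSeries.X ^ (k + 1) ∣ coeff d F.toPowerSeries •
        ((PowerSeries.X : PowerSeries R) ^ d 0 * v ^ d 1 - PowerSeries.X ^ d 0 * v' ^ d 1) := by
    rw [← mul_sub]
    apply dvd_smul_of_dvd
    by_cases h0 : d 0 = 0
    · obtain h1 | h1 | h1 : d 1 = 0 ∨ d 1 = 1 ∨ 2 ≤ d 1 := by omega
      · simp [h1]
      · exfalso
        apply hd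
        ext i
        fin_cases i <;> simp [h0, h1]
      · rw [h0, pow_zero, one_mul, ← (Commute.all v v').mul_geom_sum₂, pow_succ]
        refine mul_dvd_mul h (Finset.dvd_sum fun i hi => ?_)
        have hi := Finset.mem_range.1 hi
        have hX : PowerSeries.X ∣ v := PowerSeries.X_dvd_iff.2 hv
        have hX' : PowerSeries.X ∣ v' := PowerSeries.X_dvd_iff.2 hv'
        by_cases hi0 : i = 0
        · exact (dvd_pow hX' (by omega)).mul_left _
        · exact (dvd_pow hX hi0).mul_right _
    · rw [pow_succ, mul_comm (PowerSeries.X ^ d 0)]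
      exact mul_dvd_mul (h.trans (sub_dvd_pow_sub_pow _ _ _)) (dvd_pow_self _ h0)
  rw [PowerSeries.X_pow_dvd_iff]
  intro m hm
  have e (w : PowerSeries R) (hw : PowerSeries.constantCoeff w = 0) :
      (PowerSeries.coeff m) (F.toPowerSeries.subst ![PowerSeries.X, w] : PowerSeries R) =
        ∑ᶠ d : Fin 2 →₀ ℕ, coeff d F.toPowerSeries •
          PowerSeries.coeff m ((PowerSeries.X : PowerSeries R) ^ d 0 * w ^ d 1) := by
    rw [PowerSeries.coeff, coeff_subst (hs w hw)]
    simp [Finsupp.prod_fintype]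
  have f (w : PowerSeries R) (hw : PowerSeries.constantCoeff w = 0) :
      Function.HasFiniteSupport fun d : Fin 2 →₀ ℕ => coeff d F.toPowerSeries •
          PowerSeries.coeff m ((PowerSeries.X : PowerSeries R) ^ d 0 * w ^ d 1) := by
    have := coeff_subst_finite (hs w hw) F.toPowerSeries (Finsupp.single () m)
    simpa [Finsupp.prod_fintype, PowerSeries.coeff] using this
  rw [map_sub, map_sub, e v hv, e v' hv', ← finsum_sub_distrib (f v hv) (f v' hv'),
    finsum_eq_single _ (Finsupp.single 1 1)]
  · simp [F.lin_coeff_Y]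
  · intro d hd
    have := PowerSeries.X_pow_dvd_iff.1 (key d hd) m hm
    simpa [smul_sub, mul_sub] using this

/-- Every one-dimensional formal group law has a formal inverse. -/
theorem exists_formalInverse : ∃ g : PowerSeries R, PowerSeries.constantCoeff g = 0 ∧
    (F.toPowerSeries.subst ![PowerSeries.X, g] : PowerSeries R) = 0 := by
  let S : PowerSeries R → PowerSeries R := fun w =>
    F.toPowerSeries.subst ![PowerSeries.X, w]
  let v : ℕ → PowerSeries R := fun n => Nat.rec 0 (fun _ w => w - S w) n
  have v0 : v 0 = 0 := rfl
  have vs (k) : v (k + 1) = v k - S (v k) := rfl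
  have hX (w : PowerSeries R) : PowerSeries.constantCoeff w = 0 ↔ PowerSeries.X ∣ w :=
    PowerSeries.X_dvd_iff.symm
  have h (k) : PowerSeries.constantCoeff (v k) = 0 ∧ PowerSeries.X ^ (k + 1) ∣ S (v k) := by
    induction k with
    | zero =>
      refine ⟨by simp [v0], ?_⟩
      have : S (v 0) = PowerSeries.X := F.Xzero_eq_X
      rw [this]; simp
    | succ k ih =>
      have hc : PowerSeries.constantCoeff (v (k + 1)) = 0 := by
        rw [hX, vs]
        exact dvd_sub ((hX _).1 ih.1) ((dvd_pow_self _ (by omega)).trans ih.2)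
      refine ⟨hc, ?_⟩
      have := dvd_subst_sub F hc ih.1 (k := k + 1) (by rw [vs]; simpa using ih.2)
      rw [vs] at this ⊢
      have e : S (v k - S (v k)) - S (v k) - (v k - S (v k) - v k) = S (v k - S (v k)) := by ring
      change _ ∣ S (v k - S (v k)) - S (v k) - (v k - S (v k) - v k) at this
      rwa [e] at this
  let g : PowerSeries R := PowerSeries.mk fun n => PowerSeries.coeff n (v n)
  have stab (k j) : PowerSeries.X ^ (k + 1) ∣ v (k + j) - v k := by
    induction j with
    | zero => simp
    | succ j ih =>
      have : v (k + (j + 1)) - v k = (v (k + j) - v k) - S (v (k + j)) := by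
        rw [← add_assoc, vs]; ring
      rw [this]
      exact dvd_sub ih ((pow_dvd_pow _ (by omega)).trans (h (k + j)).2)
  have hg (k) : PowerSeries.X ^ k ∣ g - v k := by
    rw [PowerSeries.X_pow_dvd_iff]
    intro m hm
    obtain ⟨j, rfl⟩ := Nat.exists_eq_add_of_le hm.le
    have := PowerSeries.X_pow_dvd_iff.1 (stab m j) m (by omega)
    rw [map_sub, sub_eq_zero] at this
    simp [g, this]
  have hg0 : PowerSeries.constantCoeff g = 0 := by
    simp [g, v0]
  refine ⟨g, hg0, ?_⟩
  ext m
  have h1 := (PowerSeries.X_pow_dvd_iff.1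
    (dvd_subst_sub F hg0 (h (m + 1)).1 (hg (m + 1)))) m (by omega)
  have h2 := PowerSeries.X_pow_dvd_iff.1 (h (m + 1)).2 m (by omega)
  have h3 := PowerSeries.X_pow_dvd_iff.1 (hg (m + 1)) m (by omega)
  change _ = 0 at h2
  rw [map_sub, h3, sub_zero, map_sub] at h1
  change _ - PowerSeries.coeff m (S (v (m + 1))) = 0 at h1
  rw [h2, sub_zero] at h1
  simpa using h1

/-- The formal inverse `ι_F`, the power series with `F(u, ι_F(u)) = 0`. -/
def formalInverse : PowerSeries R := (exists_formalInverse F).choose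

end Inverse

section Points

variable {R : Type*} [CommRing R]

/-- Power series over `R` in the variables `t_i`, `i ∈ ι`, without constant term. They form an
abelian group under `f +_F g = F(f, g)`. -/
def Point (_ : FormalGroup R) (ι : Type*) : Type _ :=
  {f : MvPowerSeries ι R // MvPowerSeries.constantCoeff f = 0}

variable (F : FormalGroup R) {ι : Type*}

lemma hasSubst_pair {f g : MvPowerSeries ι R} (hf : MvPowerSeries.constantCoeff f = 0)
    (hg : MvPowerSeries.constantCoeff g = 0) : MvPowerSeries.HasSubst ![f, g] :=
  MvPowerSeries.hasSubst_of_constantCoeff_zero fun s => by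
    fin_cases s
    · exact hf
    · exact hg

lemma hasSubst_of_constantCoeff {f : MvPowerSeries ι R}
    (hf : MvPowerSeries.constantCoeff f = 0) : PowerSeries.HasSubst f := by
  simp [PowerSeries.HasSubst, hf]

lemma constantCoeff_formalInverse_subst {f : MvPowerSeries ι R}
    (hf : MvPowerSeries.constantCoeff f = 0) :
    MvPowerSeries.constantCoeff ((formalInverse F).subst f) = 0 :=
  MvPowerSeries.constantCoeff_subst_eq_zero (hasSubst_of_constantCoeff hf).const (fun _ => hf)
    (exists_formalInverse F).choose_spec.1

lemma subst_formalInverse {f : MvPowerSeries ι R} (hf : MvPowerSeries.constantCoeff f = 0) :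
    F.toPowerSeries.subst ![f, (formalInverse F).subst f] = (0 : MvPowerSeries ι R) := by
  have hf' := hasSubst_of_constantCoeff hf
  have h := congrArg (PowerSeries.subst f) (exists_formalInverse F).choose_spec.2
  rw [← PowerSeries.coe_substAlgHom hf', map_zero, PowerSeries.coe_substAlgHom hf',
    PowerSeries.subst, MvPowerSeries.subst_comp_subst_apply _ hf'.const] at h
  · rw [← h]
    congr! 2 with s
    fin_cases s
    · exact (PowerSeries.subst_X hf').symm
    · rfl
  · exact hasSubst_pair PowerSeries.constantCoeff_X (exists_formalInverse F).choose_spec.1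

instance : Zero (Point F ι) := ⟨⟨0, map_zero _⟩⟩

instance : Add (Point F ι) := ⟨fun f g => ⟨F.toPowerSeries.subst ![f.1, g.1],
  MvPowerSeries.constantCoeff_subst_eq_zero (hasSubst_pair f.2 g.2)
    (fun s => by fin_cases s; exacts [f.2, g.2]) F.zero_constantCoeff⟩⟩

instance : Neg (Point F ι) :=
  ⟨fun f => ⟨(formalInverse F).subst f.1, constantCoeff_formalInverse_subst F f.2⟩⟩

instance [F.IsComm] : AddCommGroup (Point F ι) where
  add_assoc f g h := Subtype.ext <| F.assoc' (hasSubst_of_constantCoeff f.2)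
    (hasSubst_of_constantCoeff g.2) (hasSubst_of_constantCoeff h.2)
  zero_add f := Subtype.ext <| F.zero_add (hasSubst_of_constantCoeff f.2)
  add_zero f := Subtype.ext <| F.add_zero (hasSubst_of_constantCoeff f.2)
  nsmul := nsmulRec
  zsmul := zsmulRec
  neg_add_cancel f := Subtype.ext <|
    (F.comm' (hasSubst_of_constantCoeff (constantCoeff_formalInverse_subst F f.2))
      (hasSubst_of_constantCoeff f.2)).trans (subst_formalInverse F f.2)
  add_comm f g := Subtype.ext <| F.comm' (hasSubst_of_constantCoeff f.2)
    (hasSubst_of_constantCoeff g.2)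

lemma Point.val_add [F.IsComm] (f g : Point F ι) :
    (f + g).1 = F.toPowerSeries.subst ![f.1, g.1] := rfl

/-- The variable `t_i`. -/
def Point.X (i : ι) : Point F ι := ⟨MvPowerSeries.X i, MvPowerSeries.constantCoeff_X i⟩

end Points

section FormalGroupAlgebra

variable (R : Type*) [CommRing R] (Λ : Type*)

/-- The augmentation `R[x_Λ] → R`, `x_λ ↦ 0`. -/
def aug : MvPolynomial Λ R →ₐ[R] R := MvPolynomial.aeval fun _ => 0

lemma aug_surjective : Function.Surjective (aug R Λ) := fun r => ⟨MvPolynomial.C r, by simp [aug]⟩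

/-- The kernel of the augmentation of `R[x_Λ]`. -/
abbrev augKer : Ideal (MvPolynomial Λ R) := RingHom.ker (aug R Λ)

/-- `R[[x_Λ]]`: the completion of `R[x_Λ]` with respect to the kernel of the augmentation. -/
abbrev CPoly : Type _ := AdicCompletion (augKer R Λ) (MvPolynomial Λ R)

variable {R Λ}

lemma X_mem (l : Λ) : MvPolynomial.X l ∈ augKer R Λ := by simp [aug, RingHom.mem_ker]

lemma aeval_mem_pow {σ : Type*} {v : σ → MvPolynomial Λ R} (hv : ∀ i, v i ∈ augKer R Λ) {n : ℕ}
    {p : MvPolynomial σ R} (hp : ∀ m : σ →₀ ℕ, m.degree < n → p.coeff m = 0) :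
    MvPolynomial.aeval v p ∈ augKer R Λ ^ n := by
  rw [MvPolynomial.aeval_def, MvPolynomial.eval₂_eq]
  refine Ideal.sum_mem _ fun m hm => Ideal.mul_mem_left _ _ ?_
  have hn : n ≤ m.degree := by
    by_contra h
    exact (MvPolynomial.mem_support_iff.1 hm) (hp m (not_le.1 h))
  refine Ideal.pow_le_pow_right hn ?_
  rw [show m.degree = ∑ i ∈ m.support, m i from rfl, ← Finset.prod_pow_eq_pow_sum]
  exact Ideal.prod_mem_prod fun i _ => Ideal.pow_mem_pow (hv i) _

lemma aeval_truncTotal_sub_mem {σ : Type*} [Finite σ] {v : σ → MvPolynomial Λ R}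
    (hv : ∀ i, v i ∈ augKer R Λ) (f : MvPowerSeries σ R) {m n : ℕ} (h : m ≤ n) :
    MvPolynomial.aeval v (MvPowerSeries.truncTotal m f) -
      MvPolynomial.aeval v (MvPowerSeries.truncTotal n f) ∈ augKer R Λ ^ m := by
  rw [← map_sub]
  refine aeval_mem_pow hv fun d hd => ?_
  rw [MvPolynomial.coeff_sub, MvPowerSeries.coeff_truncTotal _ hd,
    MvPowerSeries.coeff_truncTotal _ (hd.trans_le h), sub_self]

/-- The value `f(v) ∈ R[[x_Λ]]` of a power series `f` at a finite family of polynomials `v_i`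
without constant term: modulo the `n`-th power of the augmentation ideal it is the value of the
part of `f` of total degree less than `n`. -/
def evalAt {σ : Type*} [Finite σ] (f : MvPowerSeries σ R) (v : σ → MvPolynomial Λ R)
    (hv : ∀ i, v i ∈ augKer R Λ) : CPoly R Λ :=
  AdicCompletion.mk _ _ <| AdicCompletion.AdicCauchySequence.mk _ _
    (fun n => MvPolynomial.aeval v (MvPowerSeries.truncTotal n f)) fun n => by
      rw [SModEq.sub_mem, smul_eq_mul, Ideal.mul_top]
      exact aeval_truncTotal_sub_mem hv f n.le_succ

lemma eval_evalAt {σ : Type*} [Finite σ] (f : MvPowerSeries σ R) (v : σ → MvPolynomial Λ R)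
    (hv : ∀ i, v i ∈ augKer R Λ) (n : ℕ) :
    AdicCompletion.evalₐ _ n (evalAt f v hv) =
      Ideal.Quotient.mk _ (MvPolynomial.aeval v (MvPowerSeries.truncTotal n f)) := by
  rw [evalAt, AdicCompletion.evalₐ_mk]
  rfl

lemma pair_mem (l m : Λ) (i : Fin 2) :
    (![MvPolynomial.X l, MvPolynomial.X m] : Fin 2 → MvPolynomial Λ R) i ∈ augKer R Λ := by
  fin_cases i <;> exact X_mem _

variable [AddCommGroup Λ]

variable (Λ) in
/-- The ideal of `R[[x_Λ]]` generated by `x_0` and the elements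
`x_{λ+μ} - F(x_λ, x_μ)`. -/
def relIdeal (F : FormalGroup R) : Ideal (CPoly R Λ) :=
  Ideal.span ({AdicCompletion.of _ _ (MvPolynomial.X 0)} ∪ Set.range fun p : Λ × Λ =>
    AdicCompletion.of _ _ (MvPolynomial.X (p.1 + p.2)) -
      evalAt F.toPowerSeries ![MvPolynomial.X p.1, MvPolynomial.X p.2] (pair_mem p.1 p.2))

/-- The closure of an ideal of `R[[x_Λ]]`: the kernels of the projections
`R[[x_Λ]] → R[x_Λ]/I^n` form a basis of neighbourhoods of zero, so an element is in the closure
if and only if for every `n` its image lies in the image of the ideal. -/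
def closure (J : Ideal (CPoly R Λ)) : Ideal (CPoly R Λ) :=
  ⨅ n : ℕ, (J.map (AdicCompletion.evalₐ (augKer R Λ) n)).comap
    (AdicCompletion.evalₐ (augKer R Λ) n)

variable (Λ) in
/-- The formal group algebra `R[[Λ]]_F`. -/
abbrev FGA (F : FormalGroup R) : Type _ := CPoly R Λ ⧸ closure (relIdeal Λ F)

/-- The class of `x_λ` in `R[[Λ]]_F`. -/
def x (F : FormalGroup R) (l : Λ) : FGA Λ F :=
  Ideal.Quotient.mk _ (AdicCompletion.of _ _ (MvPolynomial.X l))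


end FormalGroupAlgebra

/-- A substitution `x_λ ↦ y_λ` in `R[[x_Λ]]`, where `y_λ` is an element without constant term,
given by polynomials `y n λ` congruent to `y_λ` modulo the `n`-th power of the augmentation
ideal. -/
structure SubstData (R : Type*) [CommRing R] (Λ : Type*) where
  /-- The approximations. -/
  y : ℕ → Λ → MvPolynomial Λ R
  mem : ∀ n l, y n l ∈ augKer R Λ
  compat : ∀ {m n : ℕ}, m ≤ n → ∀ l, y n l - y m l ∈ augKer R Λ ^ m

namespace SubstData

variable {R : Type*} [CommRing R] {Λ : Type*} (s : SubstData R Λ)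

lemma le_comap (n : ℕ) : augKer R Λ ^ n ≤ (augKer R Λ ^ n).comap (MvPolynomial.aeval (s.y n)) := by
  rw [← Ideal.map_le_iff_le_comap, Ideal.map_pow]
  refine Ideal.pow_right_mono (Ideal.map_le_iff_le_comap.2 fun p hp => ?_) n
  have : (aug R Λ).comp (MvPolynomial.aeval (s.y n)) = aug R Λ := by
    ext l
    have := (RingHom.mem_ker).1 (s.mem n l)
    simpa [aug] using this
  rw [Ideal.mem_comap, RingHom.mem_ker, ← AlgHom.comp_apply, this]
  exact hp

/-- The substitution modulo the `n`-th power of the augmentation ideal. -/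
def level (n : ℕ) : (MvPolynomial Λ R ⧸ augKer R Λ ^ n) →ₐ[R] MvPolynomial Λ R ⧸ augKer R Λ ^ n :=
  Ideal.quotientMapₐ _ (MvPolynomial.aeval (s.y n)) (s.le_comap n)

lemma level_mk (n : ℕ) (p : MvPolynomial Λ R) :
    s.level n (Ideal.Quotient.mk _ p) = Ideal.Quotient.mk _ (MvPolynomial.aeval (s.y n) p) := rfl

lemma factor_level {m n : ℕ} (h : m ≤ n) (z : MvPolynomial Λ R ⧸ augKer R Λ ^ n) :
    Ideal.Quotient.factorₐ R (Ideal.pow_le_pow_right h) (s.level n z) =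
      s.level m (Ideal.Quotient.factorₐ R (Ideal.pow_le_pow_right h) z) := by
  obtain ⟨p, rfl⟩ := Ideal.Quotient.mk_surjective z
  have : (Ideal.Quotient.mkₐ R (augKer R Λ ^ m)).comp (MvPolynomial.aeval (s.y n)) =
      (Ideal.Quotient.mkₐ R (augKer R Λ ^ m)).comp (MvPolynomial.aeval (s.y m)) := by
    ext l
    simpa using Ideal.Quotient.eq.2 (s.compat h l)
  exact congrArg (fun f => f p) this

lemma level_compat {m n : ℕ} (h : m ≤ n) :
    (Ideal.Quotient.factorₐ R (Ideal.pow_le_pow_right h)).comp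
      ((s.level n).comp ((AdicCompletion.evalₐ (augKer R Λ) n).restrictScalars R)) =
    (s.level m).comp ((AdicCompletion.evalₐ (augKer R Λ) m).restrictScalars R) := by
  refine AlgHom.ext fun z => ?_
  simp only [AlgHom.comp_apply, AlgHom.restrictScalars_apply]
  rw [factor_level s h]
  congr 1
  obtain ⟨a, rfl⟩ := AdicCompletion.mk_surjective _ _ z
  rw [AdicCompletion.evalₐ_mk, AdicCompletion.evalₐ_mk]
  exact AdicCompletion.Ideal.mk_eq_mk (I := augKer R Λ) h a

/-- The `R`-algebra endomorphism of `R[[x_Λ]]` given by a substitution. -/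
def hom : CPoly R Λ →ₐ[R] CPoly R Λ :=
  AdicCompletion.liftAlgHom (augKer R Λ)
    (fun n => (s.level n).comp ((AdicCompletion.evalₐ (augKer R Λ) n).restrictScalars R))
    s.level_compat

lemma eval_hom (n : ℕ) (z : CPoly R Λ) :
    AdicCompletion.evalₐ _ n (s.hom z) = s.level n (AdicCompletion.evalₐ _ n z) :=
  AdicCompletion.evalₐ_liftAlgHom (augKer R Λ) _ s.level_compat n z

variable [AddCommGroup Λ]

/-- A substitution that is compatible with the defining relations, up to the closure of an ideal,
maps the closure of the ideal of relations into the closure of that ideal. -/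
lemma closure_le_comap (F : FormalGroup R) (J : Ideal (CPoly R Λ))
    (h0 : ∀ n, Ideal.Quotient.mk _ (s.y n 0) ∈ J.map (AdicCompletion.evalₐ (augKer R Λ) n))
    (hadd : ∀ n l m, Ideal.Quotient.mk _ (s.y n (l + m) -
      MvPolynomial.aeval ![s.y n l, s.y n m] (MvPowerSeries.truncTotal n F.toPowerSeries)) ∈
        J.map (AdicCompletion.evalₐ (augKer R Λ) n)) :
    closure (relIdeal Λ F) ≤ (closure J).comap s.hom := by
  intro z hz
  simp only [closure, Ideal.mem_comap, Ideal.mem_iInf] at hz ⊢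
  intro n
  rw [eval_hom]
  suffices H : (relIdeal Λ F).map (AdicCompletion.evalₐ (augKer R Λ) n) ≤
      (J.map (AdicCompletion.evalₐ (augKer R Λ) n)).comap (s.level n) from H (hz n)
  rw [Ideal.map_le_iff_le_comap, relIdeal, Ideal.span_le]
  rintro _ (rfl | ⟨⟨l, m⟩, rfl⟩)
  · simp only [SetLike.mem_coe, Ideal.mem_comap, AdicCompletion.evalₐ_of, level_mk,
      MvPolynomial.aeval_X]
    exact h0 n
  · simp only [SetLike.mem_coe, Ideal.mem_comap]
    rw [map_sub, AdicCompletion.evalₐ_of, eval_evalAt, ← map_sub, level_mk, map_sub,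
      MvPolynomial.aeval_X, ← AlgHom.comp_apply, MvPolynomial.comp_aeval]
    have e : (fun i => MvPolynomial.aeval (s.y n)
        ((![MvPolynomial.X l, MvPolynomial.X m] : Fin 2 → MvPolynomial Λ R) i)) =
        ![s.y n l, s.y n m] := by
      funext i
      fin_cases i <;> simp
    rw [e]
    exact hadd n l m

end SubstData

/-! ### The augmentation, the action of automorphisms, and the deformation map -/

section Maps

variable {R : Type*} [CommRing R] {Λ : Type*} [AddCommGroup Λ]

/-- The augmentation `ε_F : R[[Λ]]_F → R`, `x_λ ↦ 0`. -/
def augF (F : FormalGroup R) : FGA Λ F →ₐ[R] R :=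
  Ideal.Quotient.liftₐ _ (AdicCompletion.kerProj (aug_surjective R Λ)) (by
    intro z hz
    have h1 := (Ideal.mem_iInf.1 hz) 1
    have h2 : (relIdeal Λ F).map (AdicCompletion.evalₐ (augKer R Λ) 1) ≤ ⊥ := by
      rw [Ideal.map_le_iff_le_comap, relIdeal, Ideal.span_le]
      rintro _ (rfl | ⟨⟨l, m⟩, rfl⟩)
      · simp only [SetLike.mem_coe, Ideal.mem_comap, AdicCompletion.evalₐ_of, Ideal.mem_bot]
        rw [Ideal.Quotient.eq_zero_iff_mem, pow_one]
        exact X_mem _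
      · simp only [SetLike.mem_coe, Ideal.mem_comap, Ideal.mem_bot]
        rw [map_sub, AdicCompletion.evalₐ_of, eval_evalAt, ← map_sub,
          Ideal.Quotient.eq_zero_iff_mem, pow_one]
        refine sub_mem (X_mem _) ?_
        rw [← pow_one (augKer R Λ)]
        refine aeval_mem_pow (pair_mem l m) fun d hd => ?_
        obtain rfl : d = 0 := (Finsupp.degree_eq_zero_iff d).1 (by simpa using hd)
        rw [MvPowerSeries.coeff_truncTotal _ (by simp)]
        simpa using F.zero_constantCoeff
    have h3 : AdicCompletion.evalOneₐ (augKer R Λ) z = 0 := by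
      have := h2 h1
      rw [Ideal.mem_bot] at this
      simp [AdicCompletion.evalOneₐ, this]
    change Ideal.quotientKerAlgEquivOfSurjective (aug_surjective R Λ)
      (AdicCompletion.evalOneₐ (augKer R Λ) z) = 0
    rw [h3, map_zero])

lemma augF_x (F : FormalGroup R) (l : Λ) : augF F (x F l) = 0 := by
  change AdicCompletion.kerProj (aug_surjective R Λ) (.of _ _ (MvPolynomial.X l)) = 0
  rw [AdicCompletion.kerProj_of]
  simp [aug]

/-- The augmentation ideal of `R[[Λ]]_F`. -/
def augIdeal (F : FormalGroup R) : Ideal (FGA Λ F) := RingHom.ker (augF F)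

/-- The substitution `x_λ ↦ x_{w(λ)}`. -/
def actData (R : Type*) [CommRing R] (w : Λ →+ Λ) : SubstData R Λ where
  y _ l := MvPolynomial.X (w l)
  mem _ l := X_mem _
  compat _ l := by simp

/-- The action of an endomorphism `w` of `Λ` on `R[[Λ]]_F`, `x_λ ↦ x_{w(λ)}`. -/
def act (F : FormalGroup R) (w : Λ →+ Λ) : FGA Λ F →ₐ[R] FGA Λ F :=
  Ideal.quotientMapₐ _ (actData R w).hom <| SubstData.closure_le_comap _ F _
    (fun n => by
      rw [show (actData R w).y n 0 = MvPolynomial.X 0 by simp [actData], ← AdicCompletion.evalₐ_of]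
      exact Ideal.mem_map_of_mem _ (Ideal.subset_span (Or.inl rfl)))
    (fun n l m => by
      have : AdicCompletion.of _ _ (MvPolynomial.X (w l + w m)) - evalAt F.toPowerSeries
          ![MvPolynomial.X (w l), MvPolynomial.X (w m)] (pair_mem _ _) ∈ relIdeal Λ F :=
        Ideal.subset_span (Or.inr ⟨(w l, w m), rfl⟩)
      have := Ideal.mem_map_of_mem (AdicCompletion.evalₐ (augKer R Λ) n) this
      rw [map_sub, AdicCompletion.evalₐ_of, eval_evalAt, ← map_sub] at this
      simpa [actData] using this)

lemma act_x (F : FormalGroup R) (w : Λ →+ Λ) (l : Λ) : act F w (x F l) = x F (w l) := by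
  refine congrArg (Ideal.Quotient.mk _) (AdicCompletion.ext_evalₐ fun n => ?_)
  change AdicCompletion.evalₐ _ n ((actData R w).hom _) = _
  rw [SubstData.eval_hom, AdicCompletion.evalₐ_of, AdicCompletion.evalₐ_of, SubstData.level_mk]
  simp [actData]

section Deformation

variable {ι : Type*} (b : Module.Basis ι ℤ Λ) (F : FormalGroup R) [F.IsComm]

/-- For `λ = ∑ a_i ω_i` the series `(a_1 ·_F t_1) +_F ⋯ +_F (a_n ·_F t_n)`, where `ω_i` is the
given basis of `Λ`. -/
def fsum (l : Λ) : Point F ι :=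
  b.constr ℤ (Point.X F) l

lemma fsum_eq [Fintype ι] (l : Λ) : fsum b F l = ∑ i, b.repr l i • Point.X F i := by
  rw [fsum, Module.Basis.constr_apply_fintype]
  rfl

variable [Finite ι]

/-- The substitution `x_λ ↦ (a_1 ·_F x_{ω_1}) +_F ⋯ +_F (a_n ·_F x_{ω_n})` for
`λ = ∑ a_i ω_i`. -/
def deformData : SubstData R Λ where
  y n l := MvPolynomial.aeval (fun i => MvPolynomial.X (b i))
    (MvPowerSeries.truncTotal n (fsum b F l).1)
  mem n l := by
    rw [← pow_one (augKer R Λ)]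
    refine aeval_mem_pow (fun _ => X_mem _) fun d hd => ?_
    obtain rfl : d = 0 := (Finsupp.degree_eq_zero_iff d).1 (by simpa using hd)
    rw [MvPowerSeries.coeff_truncTotal_eq_ite]
    split_ifs
    · exact (fsum b F l).2
    · rfl
  compat h l := by
    rw [← neg_mem_iff, neg_sub]
    exact aeval_truncTotal_sub_mem (fun _ => X_mem _) _ h

lemma deformData_add (n : ℕ) (l m : Λ) : (deformData b F).y n (l + m) -
    MvPolynomial.aeval ![(deformData b F).y n l, (deformData b F).y n m]
      (MvPowerSeries.truncTotal n F.toPowerSeries) ∈ augKer R Λ ^ n := by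
  have h : (fsum b F (l + m)).1 =
      F.toPowerSeries.subst ![(fsum b F l).1, (fsum b F m).1] :=
    congrArg Subtype.val (map_add (b.constr ℤ (Point.X F)) l m)
  set v : ι → MvPolynomial Λ R := fun i => MvPolynomial.X (b i)
  set p := MvPolynomial.aeval ![MvPowerSeries.truncTotal n (fsum b F l).1,
    MvPowerSeries.truncTotal n (fsum b F m).1] (MvPowerSeries.truncTotal n F.toPowerSeries)
  have e1 : MvPolynomial.aeval ![(deformData b F).y n l, (deformData b F).y n m]
      (MvPowerSeries.truncTotal n F.toPowerSeries) = MvPolynomial.aeval v p := by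
    rw [← AlgHom.comp_apply, MvPolynomial.comp_aeval]
    congr 2
    funext i
    fin_cases i <;> rfl
  have e2 : MvPowerSeries.truncTotal n (fsum b F (l + m)).1 =
      MvPowerSeries.truncTotal n (p : MvPowerSeries ι R) := by
    rw [h, MvPowerSeries.truncTotal_subst (fun i => by
      fin_cases i
      exacts [(fsum b F l).2, (fsum b F m).2])]
    congr 1
    rw [MvPowerSeries.subst_coe]
    have := MvPolynomial.comp_aeval (R := R) ![MvPowerSeries.truncTotal n (fsum b F l).1,
      MvPowerSeries.truncTotal n (fsum b F m).1] (MvPolynomial.coeToMvPowerSeries.algHom R)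
    have := congrArg (fun f => f (MvPowerSeries.truncTotal n F.toPowerSeries)) this
    refine Eq.trans ?_ this.symm
    congr 2
    funext i
    fin_cases i <;> rfl
  rw [e1]
  change MvPolynomial.aeval v (MvPowerSeries.truncTotal n (fsum b F (l + m)).1) - _ ∈ _
  rw [e2, ← map_sub]
  refine aeval_mem_pow (fun _ => X_mem _) fun d hd => ?_
  rw [MvPolynomial.coeff_sub, MvPowerSeries.coeff_truncTotal _ hd, MvPolynomial.coeff_coe, sub_self]

/-- The deformation map `Φ^{F → F'} : R[[Λ]]_F → R[[Λ]]_{F'}` with respect to the basis `ω_i` of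
`Λ`: the continuous homomorphism of `R`-algebras with
`x_λ ↦ (a_1 ·_F x_{ω_1}) +_F ⋯ +_F (a_n ·_F x_{ω_n})` for `λ = ∑ a_i ω_i`. -/
def deform (F' : FormalGroup R) : FGA Λ F →ₐ[R] FGA Λ F' :=
  Ideal.quotientMapₐ _ (deformData b F).hom <| SubstData.closure_le_comap _ F _
    (fun n => by
      have : (deformData b F).y n 0 = 0 := by
        have h : (fsum b F 0).1 = 0 := congrArg Subtype.val (map_zero (b.constr ℤ (Point.X F)))
        simp [deformData, h]
      rw [this, map_zero]
      exact zero_mem _)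
    (fun n l m => by
      rw [Ideal.Quotient.eq_zero_iff_mem.2 (deformData_add b F n l m)]
      exact zero_mem _)

lemma deform_x (F' : FormalGroup R) (i : ι) : deform b F F' (x F (b i)) = x F' (b i) := by
  refine congrArg (Ideal.Quotient.mk _) (AdicCompletion.ext_evalₐ fun n => ?_)
  change AdicCompletion.evalₐ _ n ((deformData b F).hom _) = _
  rw [SubstData.eval_hom, AdicCompletion.evalₐ_of, SubstData.level_mk,
    MvPolynomial.aeval_X]
  have h : (fsum b F (b i)).1 = MvPowerSeries.X i :=
    congrArg Subtype.val (b.constr_basis ℤ (Point.X F) i)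
  rw [Ideal.Quotient.eq, deformData]
  simp only [h]
  have := aeval_mem_pow (v := fun i => (MvPolynomial.X (b i) : MvPolynomial Λ R))
    (fun _ => X_mem _) (n := n)
    (p := MvPowerSeries.truncTotal n (MvPowerSeries.X i) - MvPolynomial.X i) (fun d hd => by
      rw [MvPolynomial.coeff_sub, MvPowerSeries.coeff_truncTotal _ hd, ← MvPolynomial.coe_X,
        MvPolynomial.coeff_coe, sub_self])
  simpa using this

end Deformation

end Maps

/-! ### Exponents -/

section Exponent

variable {R : Type*} [CommRing R] {Λ : Type*} [AddCommGroup Λ] {ι : Type*} [Finite ι]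
  (b : Module.Basis ι ℤ Λ) (W : Subgroup (Λ ≃ₗ[ℤ] Λ))

/-- The subring of invariants `R[[Λ]]_F^W`. -/
def invariants (F : FormalGroup R) : Subalgebra R (FGA Λ F) where
  carrier := {z | ∀ w ∈ W, act F w.toLinearMap.toAddMonoidHom z = z}
  mul_mem' h h' w hw := by rw [map_mul, h w hw, h' w hw]
  add_mem' h h' w hw := by rw [map_add, h w hw, h' w hw]
  algebraMap_mem' r w _ := AlgHom.commutes _ r

/-- The ideal `I_F^W` of `R[[Λ]]_F` generated by the invariant elements of the augmentation
ideal. -/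
def invIdeal (F : FormalGroup R) : Ideal (FGA Λ F) :=
  Ideal.span {z | z ∈ invariants W F ∧ z ∈ augIdeal F}

/-- `N · (I_{F'}^W)^{(d)} ⊆ Φ_d((I_F^W)^{(d)})` inside `I_{F'}^d / I_{F'}^{d+1}`, where
`(I_F^W)^{(d)}` is the image of `I_F^W ∩ I_F^d` in `I_F^d / I_F^{d+1}` and
`Φ_d : I_F^d / I_F^{d+1} → I_{F'}^d / I_{F'}^{d+1}` is the map induced by the deformation map. -/
def IsExponentMultiple (F F' : FormalGroup R) [F.IsComm] (d N : ℕ) : Prop :=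
  ∀ z' ∈ invIdeal W F' ⊓ augIdeal F' ^ d, ∃ z ∈ invIdeal W F ⊓ augIdeal F ^ d,
    N • z' - deform b F F' z ∈ augIdeal F' ^ (d + 1)

/-- The positive integers `N`, coprime to the characteristic of `R` if that is not zero, such that
`N · (I_{F'}^W)^{(d)} ⊆ Φ_d((I_F^W)^{(d)})`. -/
def exponentSet (F F' : FormalGroup R) [F.IsComm] (d : ℕ) : Set ℕ :=
  {N | 0 < N ∧ (ringChar R ≠ 0 → N.Coprime (ringChar R)) ∧ IsExponentMultiple b W F F' d N}

/-- The action of `W` on `Λ` has a finite exponent from `F` to `F'` in degree `d`. -/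
def HasFiniteExponent (F F' : FormalGroup R) [F.IsComm] (d : ℕ) : Prop :=
  (exponentSet b W F F' d).Nonempty

/-- The `d`-th exponent `τ_d^{F → F'}` of the action of `W` on `Λ`, the smallest element of
`exponentSet` (it is meaningful if the action has a finite exponent, and `0` otherwise). -/
def exponent (F F' : FormalGroup R) [F.IsComm] (d : ℕ) : ℕ :=
  sInf (exponentSet b W F F' d)

end Exponent

/-! ### Root systems given by Cartan matrices

The weight lattice of a root system of rank `n` is `Fin n → ℤ`, where the standard basis is the
basis of fundamental weights. If `A i j = ⟨α_i, α_j^∨⟩` is the Cartan matrix, then the simple root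
`α_i` is the row `A i`, and the simple reflection is `s_i(v) = v - ⟨v, α_i^∨⟩ α_i = v - v_i α_i`. -/

section RootSystem

variable {n : ℕ} (A : Matrix (Fin n) (Fin n) ℤ)

/-- The Weyl group acting on the weight lattice, generated by the simple reflections. -/
def weylGroup : Subgroup ((Fin n → ℤ) ≃ₗ[ℤ] (Fin n → ℤ)) :=
  Subgroup.closure {s | ∃ i, ∀ v, s v = v - v i • A i}

/-- The positive roots: the elements of the orbits of the simple roots under the Weyl group that
are sums of simple roots. -/
def posRoots : Set (Fin n → ℤ) :=
  {β | (∃ w ∈ weylGroup A, ∃ i, w (A i) = β) ∧ ∃ c : Fin n → ℕ, β = ∑ i, c i • A i}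

/-- A weight as a linear form in the symmetric algebra of the weight lattice, which is the
polynomial ring over `ℤ` in the fundamental weights. -/
def linForm (v : Fin n → ℤ) : MvPolynomial (Fin n) ℤ :=
  ∑ j, MvPolynomial.C (v j) * MvPolynomial.X j

/-- The action of an automorphism of the weight lattice on its symmetric algebra. -/
def symAct (w : (Fin n → ℤ) ≃ₗ[ℤ] (Fin n → ℤ)) :
    MvPolynomial (Fin n) ℤ →ₐ[ℤ] MvPolynomial (Fin n) ℤ :=
  MvPolynomial.aeval fun j => linForm (w (Pi.single j 1))

/-- The torsion index of the root system: the index of the image of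
`S^N(Λ) → H^{2N}(G/B; ℤ) = ℤ`, where `G` is simply connected, `Λ` is its weight lattice and `N` is
the number of positive roots. This map sends `f` to the integer `c` with
`∑_w det(w) w(f) = c ∏_{β > 0} β`. -/
def torsionIndex : ℕ :=
  sInf {c : ℕ | 0 < c ∧ ∃ f : MvPolynomial (Fin n) ℤ, f.IsHomogeneous (posRoots A).ncard ∧
    ∑ᶠ w : weylGroup A, (LinearMap.det (w : (Fin n → ℤ) ≃ₗ[ℤ] (Fin n → ℤ)).toLinearMap) •
        symAct w.1 f = c • ∏ᶠ β ∈ posRoots A, linForm β}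

/-- The `d`-th exponent `τ_d^{F → F'}` of the action of the Weyl group on the weight lattice. -/
def rootExponent {R : Type*} [CommRing R] (F F' : FormalGroup R) [F.IsComm] (d : ℕ) : ℕ :=
  exponent (Pi.basisFun ℤ (Fin n)) (weylGroup A) F F' d

/-- The action of the Weyl group on the weight lattice has a finite exponent from `F` to `F'` in
degree `d`. -/
def HasRootExponent {R : Type*} [CommRing R] (F F' : FormalGroup R) [F.IsComm] (d : ℕ) : Prop :=
  HasFiniteExponent (Pi.basisFun ℤ (Fin n)) (weylGroup A) F F' d

end RootSystem

/-- The Cartan matrices of the types `A_n` (`n ≥ 1`), `B_n` (`n ≥ 3`), `C_n` (`n ≥ 2`),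
`D_n` (`n ≥ 4`) and `G_2`. -/
inductive IsTypeABCDG : ∀ {n : ℕ}, Matrix (Fin n) (Fin n) ℤ → Prop
  | A (n : ℕ) (hn : 1 ≤ n) : IsTypeABCDG (CartanMatrix.A n)
  | B (n : ℕ) (hn : 3 ≤ n) : IsTypeABCDG (CartanMatrix.B n)
  | C (n : ℕ) (hn : 2 ≤ n) : IsTypeABCDG (CartanMatrix.C n)
  | D (n : ℕ) (hn : 4 ≤ n) : IsTypeABCDG (CartanMatrix.D n)
  | G₂ : IsTypeABCDG CartanMatrix.G₂

/-- For even `d = 6 k + r` with `0 ≤ r < 6`, this is `ζ_d = 3 k (k + 1) / 2 + r / 2` (both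
divisions are exact). -/
def zeta (d : ℕ) : ℕ := 3 * (d / 6) * (d / 6 + 1) / 2 + d % 6 / 2

end FGExp

end

/-!
All invariants are compared through their leading forms. The elements `x_{ω_i}` are coordinates of
`R[[Λ]]_F` along the augmentation ideal `I` (`isCoordinates`): `I ^ d / I ^ (d + 1)` consists of the
forms of degree `d` in the fundamental weights, independently of `F`. The deformation map is the
identity on leading forms (`IsLead.deform`), and an endomorphism `w` of `Λ` acts on them by linear
substitution (`IsLead.act`). To bound the exponent one therefore has to compare the leading forms of
elements of the ideals of invariants for `F` and `F'`.

Suppose that forms `p_1, …, p_K` in the polynomial ring `P` over `R`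

* form a regular sequence,
* are leading forms of invariants `f_k` for `F` and `f'_k` for `F'`, and
* generate, up to powers of an element `a`, the invariant forms in `P` of degree at most `d`.

An invariant element of `I` is then approximated step by step by polynomials in the `f'_k`, up to
powers of `a` and modulo `I ^ (d + 1)`. By regularity, the leading form of an element of the ideal of
the `f'_k` lies in the ideal of the `p_k` (`mem_span_of_isLead`), hence is the leading form of an
element of the ideal of the `f_k`. If `N` removes the powers of `a` modulo `(p_1, …, p_K)` in degree
`d`, then `N` is a multiple of the exponent. This is applied not on `Λ` but on a lattice `ℤ^n` where
the Weyl group acts by signed permutations (for `A_n` and `G₂`: of `n + 1` vectors with sum zero).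
Passing from `Λ` to `ℤ^n` and back multiplies forms of degree `d` by `c ^ d`, with `c = 2` for `B_n`
and `D_n` and `c = 1` for `A_n`, `C_n` and `G₂`. So `N * c ^ d` is a multiple of the exponent
(`Realization.isExponentMultiple`).

The invariants are explicit, as the `x_{±e_i}` are permuted by the Weyl group:

* for `B_n` and `C_n`, and for `D_n` in degrees `d < n`, the elementary symmetric functions of the
  `x_{e_i} x_{-e_i}`, with leading forms those of the `-X_i ^ 2`;
* for `D_n` with `2` invertible, the last of these is replaced by `2 ^ (-n) ∏ (x_{e_i} - x_{-e_i})`,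
  with leading form `∏ X_i`;
* for `A_n`, the elementary symmetric functions of degree at least `2` of the `-x_{e_i}`, where
  `i ≤ n + 1` and `∑ e_i = 0`;
* for `G₂`, the elementary symmetric functions of degrees `1` and `3` of the `x_{e_i} x_{-e_i}` for the
  three vectors of type `A₂`. Their leading forms are `2 σ_2` and `-σ_3 ^ 2`, so `a = N = 2`.

The regularity of these sequences reduces to that of the elementary symmetric polynomials in powers
of the variables (`mem_span_esymm_of_mul_mem`). The invariant theory uses only that `2` is a
nonzerodivisor (`mem_adjoin_extEsymm` for type `A`).

This gives the multiples `1` for `A_n` and `C_n`, `2 ^ d` for `B_n` and `D_n`, and `2` for `G₂`. As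
multiples of the exponent are closed under greatest common divisors, the exponent divides them, and it
is `1` if they are invertible. For the last statement it remains to see that the torsion index of
`B_n`, `D_n` and `G₂` is even (`even_torsionIndex`). Modulo `2`, specialize the weights to a domain
such that no root vanishes and an involution `κ` of the Weyl group acts trivially. In
`∑ det(w) w(f) = c ∏ β` the terms of `w` and `κ w` then cancel, and so `c` vanishes modulo `2`. One
takes `κ = -1` for `B_n` and `G₂`, and for `D_n` the change of the signs of `e_1, …, e_{n-1}` (and
of `e_n` if `n` is even).
-/

noncomputable section

namespace FGExp

/-! ### Power series as combinations of the variables -/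

section Series

open MvPowerSeries

variable {R : Type*} [CommRing R] {σ : Type*}

/-- A power series without constant term is a combination of the variables; if its linear
coefficients vanish as well, the coefficients have no constant term either. -/
lemma exists_eq_sum_X_mul [Fintype σ] (f : MvPowerSeries σ R) (hf : constantCoeff f = 0) :
    ∃ g : σ → MvPowerSeries σ R, f = ∑ i, X i * g i ∧
      ∀ i, constantCoeff (g i) = coeff (Finsupp.single i 1) f := by
  classical
  -- every nonzero exponent is assigned to one of the variables that occur in it
  have hc (d : σ →₀ ℕ) (hd : d ≠ 0) : ∃ i, d i ≠ 0 := by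
    by_contra! h
    exact hd (Finsupp.ext h)
  cases isEmpty_or_nonempty σ
  · refine ⟨0, ?_, fun i => isEmptyElim i⟩
    ext d
    rw [Subsingleton.elim d 0]
    simpa using hf
  choose! c hc using hc
  let g : σ → MvPowerSeries σ R := fun i d =>
    if c (d + Finsupp.single i 1) = i then coeff (d + Finsupp.single i 1) f else 0
  have hg (i : σ) (d : σ →₀ ℕ) : coeff d (g i) =
      if c (d + Finsupp.single i 1) = i then coeff (d + Finsupp.single i 1) f else 0 := rfl
  refine ⟨g, ?_, fun i => ?_⟩
  · ext d
    rw [map_sum]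
    simp only [X, coeff_monomial_mul, one_mul, hg]
    by_cases hd : d = 0
    · subst hd
      rw [Finset.sum_eq_zero]
      · simpa using hf
      · intro i _
        simp
    · rw [Finset.sum_eq_single (c d)]
      · have h : Finsupp.single (c d) 1 ≤ d := by
          rw [Finsupp.single_le_iff]
          exact Nat.one_le_iff_ne_zero.2 (hc d hd)
        rw [if_pos h, tsub_add_cancel_of_le h, if_pos rfl]
      · intro i _ hi
        split_ifs with h1 h2
        · rw [tsub_add_cancel_of_le h1] at h2
          exact (hi h2.symm).elim
        · rfl
        · rfl
      · simp
  · rw [← coeff_zero_eq_constantCoeff_apply, hg, zero_add, if_pos]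
    have h := hc (Finsupp.single i 1) (by simp)
    by_contra hne
    exact h (Finsupp.single_eq_of_ne hne)

end Series

/-! ### Evaluation of power series in the completion -/

section EvalAt

variable {R : Type*} [CommRing R] {Λ : Type*} {σ : Type*}

lemma mk_aeval_eq_of_coeff {v : σ → MvPolynomial Λ R} (hv : ∀ i, v i ∈ augKer R Λ) {n : ℕ}
    {p q : MvPolynomial σ R} (h : ∀ d : σ →₀ ℕ, d.degree < n → p.coeff d = q.coeff d) :
    Ideal.Quotient.mk (augKer R Λ ^ n) (MvPolynomial.aeval v p) =
      Ideal.Quotient.mk _ (MvPolynomial.aeval v q) := by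
  rw [Ideal.Quotient.eq, ← map_sub]
  exact aeval_mem_pow hv fun d hd => by rw [MvPolynomial.coeff_sub, h d hd, sub_self]

variable [Finite σ]

lemma evalAt_add (f g : MvPowerSeries σ R) (v : σ → MvPolynomial Λ R)
    (hv : ∀ i, v i ∈ augKer R Λ) : evalAt (f + g) v hv = evalAt f v hv + evalAt g v hv := by
  refine AdicCompletion.ext_evalₐ fun n => ?_
  simp [eval_evalAt]

lemma evalAt_mul (f g : MvPowerSeries σ R) (v : σ → MvPolynomial Λ R)
    (hv : ∀ i, v i ∈ augKer R Λ) : evalAt (f * g) v hv = evalAt f v hv * evalAt g v hv := by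
  refine AdicCompletion.ext_evalₐ fun n => ?_
  rw [map_mul, eval_evalAt, eval_evalAt, eval_evalAt, ← map_mul, ← map_mul]
  refine mk_aeval_eq_of_coeff hv fun d hd => ?_
  rw [MvPowerSeries.coeff_truncTotal _ hd,
    MvPowerSeries.coeff_truncTotal_mul_truncTotal_eq_coeff_mul _ _ hd]

lemma evalAt_X (i : σ) (v : σ → MvPolynomial Λ R) (hv : ∀ i, v i ∈ augKer R Λ) :
    evalAt (MvPowerSeries.X i) v hv = AdicCompletion.of _ _ (v i) := by
  refine AdicCompletion.ext_evalₐ fun n => ?_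
  rw [eval_evalAt, AdicCompletion.evalₐ_of, ← MvPolynomial.aeval_X (R := R) v i]
  refine mk_aeval_eq_of_coeff hv fun d hd => ?_
  rw [MvPowerSeries.coeff_truncTotal _ hd, ← MvPolynomial.coe_X, MvPolynomial.coeff_coe]

lemma evalAt_sum {κ : Type*} (s : Finset κ) (f : κ → MvPowerSeries σ R)
    (v : σ → MvPolynomial Λ R) (hv : ∀ i, v i ∈ augKer R Λ) :
    evalAt (∑ k ∈ s, f k) v hv = ∑ k ∈ s, evalAt (f k) v hv := by
  classical
  induction s using Finset.induction_on with
  | empty =>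
    refine AdicCompletion.ext_evalₐ fun n => ?_
    simp [eval_evalAt]
  | insert a s ha ih => rw [Finset.sum_insert ha, Finset.sum_insert ha, evalAt_add, ih]

end EvalAt

/-! ### Elements of the formal group algebra as power series in the fundamental weights -/

section Relations

variable {R : Type*} [CommRing R]

/-- A polynomial in two nilpotent elements, without the monomial `Y`, moves by a nilpotent multiple
of `b - b'` if the second element moves from `b` to `b'`. -/
lemma exists_aeval_sub_eq {Q : Type*} [CommRing Q] [Algebra R Q] {a b b' : Q} (ha : IsNilpotent a)
    (hb : IsNilpotent b) (hb' : IsNilpotent b') (p : MvPolynomial (Fin 2) R)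
    (hp : p.coeff (Finsupp.single 1 1) = 0) : ∃ w : Q, IsNilpotent w ∧
      MvPolynomial.aeval ![a, b] p - MvPolynomial.aeval ![a, b'] p = (b - b') * w := by
  have key (d : Fin 2 →₀ ℕ) (hd : d ∈ p.support) : ∃ w ∈ nilradical Q,
      algebraMap R Q (p.coeff d) * (a ^ d 0 * b ^ d 1) -
        algebraMap R Q (p.coeff d) * (a ^ d 0 * b' ^ d 1) = (b - b') * w := by
    refine ⟨algebraMap R Q (p.coeff d) * (a ^ d 0 *
      ∑ i ∈ Finset.range (d 1), b ^ i * b' ^ (d 1 - 1 - i)), ?_, ?_⟩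
    · refine Ideal.mul_mem_left _ _ ?_
      by_cases h0 : d 0 = 0
      · refine Ideal.mul_mem_left _ _ (Ideal.sum_mem _ fun i hi => ?_)
        have hi := Finset.mem_range.1 hi
        have h1 : d 1 ≠ 1 := by
          intro h1
          refine MvPolynomial.mem_support_iff.1 hd ?_
          rw [show d = Finsupp.single 1 1 by ext i; fin_cases i <;> simp [h0, h1], hp]
        by_cases hi0 : i = 0
        · exact Ideal.mul_mem_left _ _
            (Ideal.pow_mem_of_mem _ (mem_nilradical.2 hb') _ (by omega))
        · exact Ideal.mul_mem_right _ _
            (Ideal.pow_mem_of_mem _ (mem_nilradical.2 hb) _ (by omega))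
      · exact Ideal.mul_mem_right _ _
          (Ideal.pow_mem_of_mem _ (mem_nilradical.2 ha) _ (by omega))
    · have := (Commute.all b b').mul_geom_sum₂ (d 1)
      rw [← mul_sub, ← mul_sub, ← this]
      ring
  choose! w hw hw' using key
  refine ⟨∑ d ∈ p.support, w d, mem_nilradical.1 (Ideal.sum_mem _ hw), ?_⟩
  rw [MvPolynomial.aeval_def, MvPolynomial.aeval_def, MvPolynomial.eval₂_eq',
    MvPolynomial.eval₂_eq', ← Finset.sum_sub_distrib, Finset.mul_sum]
  refine Finset.sum_congr rfl fun d hd => ?_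
  simpa using hw' d hd

/-- Cancellation for a truncated formal group law at nilpotent elements. -/
lemma eq_of_aeval_truncTotal_eq (F : FormalGroup R) {Q : Type*} [CommRing Q] [Algebra R Q]
    {a b b' : Q} (ha : IsNilpotent a) (hb : IsNilpotent b) (hb' : IsNilpotent b') {n : ℕ}
    (hn : 1 < n)
    (h : MvPolynomial.aeval ![a, b] (MvPowerSeries.truncTotal n F.toPowerSeries) =
      MvPolynomial.aeval ![a, b'] (MvPowerSeries.truncTotal n F.toPowerSeries)) : b = b' := by
  obtain ⟨w, hw, e⟩ := exists_aeval_sub_eq (R := R) ha hb hb'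
    (MvPowerSeries.truncTotal n F.toPowerSeries - MvPolynomial.X 1) (by
      rw [MvPolynomial.coeff_sub, MvPowerSeries.coeff_truncTotal _ (by simpa using hn),
        F.lin_coeff_Y, MvPolynomial.coeff_X, if_pos rfl, sub_self])
  have hu : IsUnit (1 + w) := hw.isUnit_one_add
  have : (b - b') * (1 + w) = 0 := by
    simp only [map_sub, MvPolynomial.aeval_X, h, Matrix.cons_val_one, Matrix.cons_val_fin_one] at e
    linear_combination -e
  rw [← sub_eq_zero]
  exact (hu.mul_left_eq_zero).1 this

variable {Λ : Type*} [AddCommGroup Λ] {ι : Type*} [Finite ι] (b : Module.Basis ι ℤ Λ)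
  (F : FormalGroup R) [F.IsComm]

/-- The relations of the formal group algebra determine all `x_λ` from those of a basis. -/
lemma mk_X_sub_deformData_mem (n : ℕ) (l : Λ) :
    Ideal.Quotient.mk (augKer R Λ ^ n) (MvPolynomial.X l - (deformData b F).y n l) ∈
      (relIdeal Λ F).map (AdicCompletion.evalₐ (augKer R Λ) n) := by
  obtain hn | hn := Nat.lt_or_ge 1 n
  swap
  · have : MvPolynomial.X l - (deformData b F).y n l ∈ augKer R Λ ^ n :=
      Ideal.pow_le_pow_right hn (by
        rw [pow_one]; exact sub_mem (X_mem l) ((deformData b F).mem n l))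
    rw [Ideal.Quotient.eq_zero_iff_mem.2 this]
    exact zero_mem _
  set J := (relIdeal Λ F).map (AdicCompletion.evalₐ (augKer R Λ) n) with hJ
  let π : MvPolynomial Λ R →ₐ[R] (MvPolynomial Λ R ⧸ augKer R Λ ^ n) ⧸ J :=
    (Ideal.Quotient.mkₐ R J).comp (Ideal.Quotient.mkₐ R (augKer R Λ ^ n))
  have hπ (p : MvPolynomial Λ R) : Ideal.Quotient.mk (augKer R Λ ^ n) p ∈ J ↔ π p = 0 :=
    (Ideal.Quotient.eq_zero_iff_mem (I := J)).symm
  have nil (p : MvPolynomial Λ R) (hp : p ∈ augKer R Λ) : IsNilpotent (π p) := by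
    refine ⟨n, ?_⟩
    rw [← map_pow, ← hπ, Ideal.Quotient.eq_zero_iff_mem.2 (Ideal.pow_mem_pow hp n)]
    exact zero_mem _
  have hY0 : π ((deformData b F).y n 0) = 0 := by
    have h : (fsum b F 0).1 = 0 := congrArg Subtype.val (map_zero (b.constr ℤ (Point.X F)))
    simp [deformData, h]
  have hX0 : π (MvPolynomial.X 0) = 0 := by
    rw [← hπ, ← AdicCompletion.evalₐ_of]
    exact Ideal.mem_map_of_mem _ (Ideal.subset_span (Or.inl rfl))
  have hXadd (l m : Λ) : π (MvPolynomial.X (l + m)) =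
      MvPolynomial.aeval ![π (MvPolynomial.X l), π (MvPolynomial.X m)]
        (MvPowerSeries.truncTotal n F.toPowerSeries) := by
    have h1 : AdicCompletion.of _ _ (MvPolynomial.X (l + m)) - evalAt F.toPowerSeries
          ![MvPolynomial.X l, MvPolynomial.X m] (pair_mem l m) ∈ relIdeal Λ F :=
      Ideal.subset_span (Or.inr ⟨(l, m), rfl⟩)
    have h2 := Ideal.mem_map_of_mem (AdicCompletion.evalₐ (augKer R Λ) n) h1
    rw [map_sub, AdicCompletion.evalₐ_of, eval_evalAt, ← map_sub, ← hJ, hπ, map_sub, sub_eq_zero,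
      ← AlgHom.comp_apply, MvPolynomial.comp_aeval] at h2
    rw [h2]
    congr 2
    funext i
    fin_cases i <;> rfl
  have hYadd (l m : Λ) : π ((deformData b F).y n (l + m)) =
      MvPolynomial.aeval ![π ((deformData b F).y n l), π ((deformData b F).y n m)]
        (MvPowerSeries.truncTotal n F.toPowerSeries) := by
    have h2 : π ((deformData b F).y n (l + m) -
        MvPolynomial.aeval ![(deformData b F).y n l, (deformData b F).y n m]
        (MvPowerSeries.truncTotal n F.toPowerSeries)) = 0 := by
      rw [← hπ, Ideal.Quotient.eq_zero_iff_mem.2 (deformData_add b F n l m)]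
      exact zero_mem _
    rw [map_sub, sub_eq_zero, ← AlgHom.comp_apply, MvPolynomial.comp_aeval] at h2
    rw [h2]
    congr 2
    funext i
    fin_cases i <;> rfl
  let G : AddSubgroup Λ :=
    { carrier := {l | π (MvPolynomial.X l) = π ((deformData b F).y n l)}
      zero_mem' := hX0.trans hY0.symm
      add_mem' := fun {l m} hl hm => by
        simp only [Set.mem_ofPred_eq] at hl hm ⊢
        rw [hXadd, hYadd, hl, hm]
      neg_mem' := fun {l} hl => by
        simp only [Set.mem_ofPred_eq] at hl ⊢
        refine eq_of_aeval_truncTotal_eq F (nil _ (X_mem l)) (nil _ (X_mem (-l)))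
          (nil _ ((deformData b F).mem n (-l))) hn ?_
        rw [← hXadd]
        rw [hl, ← hYadd, add_neg_cancel, hX0, hY0] }
  have hG : AddSubgroup.toIntSubmodule G = ⊤ := by
    rw [eq_top_iff, ← b.span_eq, Submodule.span_le]
    rintro _ ⟨i, rfl⟩
    change π (MvPolynomial.X (b i)) = π ((deformData b F).y n (b i))
    rw [← sub_eq_zero, ← map_sub, ← hπ]
    have h : (fsum b F (b i)).1 = MvPowerSeries.X i :=
      congrArg Subtype.val (b.constr_basis ℤ (Point.X F) i)
    have h2 : Ideal.Quotient.mk (augKer R Λ ^ n) (MvPolynomial.X (b i)) =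
        Ideal.Quotient.mk _ ((deformData b F).y n (b i)) := by
      simp only [deformData, h]
      rw [← MvPolynomial.aeval_X (R := R) (fun i => (MvPolynomial.X (b i) : MvPolynomial Λ R)) i]
      refine mk_aeval_eq_of_coeff (fun _ => X_mem _) fun d hd => ?_
      rw [MvPowerSeries.coeff_truncTotal _ hd, ← MvPolynomial.coe_X, MvPolynomial.coeff_coe]
    rw [map_sub, h2, sub_self]
    exact zero_mem _
  have hl : l ∈ AddSubgroup.toIntSubmodule G := hG ▸ Submodule.mem_top
  rw [hπ, map_sub, sub_eq_zero]
  exact hl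

lemma mk_sub_aeval_deformData_mem (n : ℕ) (p : MvPolynomial Λ R) :
    Ideal.Quotient.mk (augKer R Λ ^ n) (p - MvPolynomial.aeval ((deformData b F).y n) p) ∈
      (relIdeal Λ F).map (AdicCompletion.evalₐ (augKer R Λ) n) := by
  set J := (relIdeal Λ F).map (AdicCompletion.evalₐ (augKer R Λ) n) with hJ
  let π : MvPolynomial Λ R →ₐ[R] (MvPolynomial Λ R ⧸ augKer R Λ ^ n) ⧸ J :=
    (Ideal.Quotient.mkₐ R J).comp (Ideal.Quotient.mkₐ R (augKer R Λ ^ n))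
  have hπ (p : MvPolynomial Λ R) : Ideal.Quotient.mk (augKer R Λ ^ n) p ∈ J ↔ π p = 0 :=
    (Ideal.Quotient.eq_zero_iff_mem (I := J)).symm
  have : π = π.comp (MvPolynomial.aeval ((deformData b F).y n)) := by
    refine MvPolynomial.algHom_ext fun l => ?_
    rw [AlgHom.comp_apply π, MvPolynomial.aeval_X, ← sub_eq_zero, ← map_sub, ← hπ]
    exact mk_X_sub_deformData_mem b F n l
  rw [hπ, map_sub, sub_eq_zero]
  exact congrArg (fun f => f p) this

/-- Every element of the formal group algebra is a power series in the `x_λ` of a basis. -/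
lemma exists_eq_mk_evalAt (z : FGA Λ F) : ∃ f : MvPowerSeries ι R,
    z = Ideal.Quotient.mk _ (evalAt f (fun i => MvPolynomial.X (b i)) fun _ => X_mem _) := by
  obtain ⟨z, rfl⟩ := Ideal.Quotient.mk_surjective z
  obtain ⟨a, rfl⟩ := AdicCompletion.mk_surjective _ _ z
  let t : ℕ → Λ → MvPolynomial ι R := fun n l => MvPowerSeries.truncTotal n (fsum b F l).1
  let g : ℕ → MvPolynomial ι R := fun n => MvPolynomial.aeval (t n) (a n)
  have ht (n : ℕ) (l : Λ) : (t n l).coeff 0 = 0 := by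
    simp only [t]
    rw [MvPowerSeries.coeff_truncTotal_eq_ite]
    split_ifs
    · exact (fsum b F l).2
    · rfl
  have hpow (n m : ℕ) (p : MvPolynomial Λ R) (hp : p ∈ augKer R Λ ^ m) :
      MvPolynomial.aeval (t n) p ∈ MvPolynomial.idealOfVars ι R ^ m := by
    have : augKer R Λ ≤ (MvPolynomial.idealOfVars ι R).comap (MvPolynomial.aeval (t n)) := by
      intro q hq
      rw [Ideal.mem_comap, ← pow_one (MvPolynomial.idealOfVars ι R),
        MvPolynomial.mem_pow_idealOfVars_iff']
      intro d hd
      obtain rfl : d = 0 := (Finsupp.degree_eq_zero_iff d).1 (by simpa using hd)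
      have h := (RingHom.mem_ker).1 hq
      have e : (MvPolynomial.aeval (R := R) fun _ : ι => (0 : R)).comp (MvPolynomial.aeval (t n)) =
          aug R Λ := by
        refine MvPolynomial.algHom_ext fun l => ?_
        have := ht n l
        rw [← MvPolynomial.constantCoeff_eq] at this
        simp [aug, this]
      have h' := congrArg (fun f => f q) e
      simp only [AlgHom.comp_apply, MvPolynomial.aeval_zero', h] at h'
      exact h'
    have h2 := (Ideal.pow_right_mono this m).trans (Ideal.le_comap_pow _ m)
    exact h2 hp
  have hg {m n : ℕ} (h : m ≤ n) : g n - g m ∈ MvPolynomial.idealOfVars ι R ^ m := by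
    have h1 : a n - a m ∈ augKer R Λ ^ m := by
      have := a.2 h
      rw [SModEq.sub_mem, smul_eq_mul, Ideal.mul_top] at this
      rw [← neg_mem_iff, neg_sub]
      exact this
    have h2 : (Ideal.Quotient.mkₐ R (MvPolynomial.idealOfVars ι R ^ m)).comp
        (MvPolynomial.aeval (t n)) = (Ideal.Quotient.mkₐ R _).comp (MvPolynomial.aeval (t m)) := by
      refine MvPolynomial.algHom_ext fun l => ?_
      simp only [AlgHom.comp_apply, MvPolynomial.aeval_X, Ideal.Quotient.mkₐ_eq_mk, t]
      rw [Ideal.Quotient.eq]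
      exact MvPowerSeries.truncTotal_sub_truncTotal_mem_pow_idealOfVars h le_rfl _
    have h3 := congrArg (fun f => f (a m)) h2
    simp only [AlgHom.comp_apply, Ideal.Quotient.mkₐ_eq_mk] at h3
    rw [Ideal.Quotient.eq] at h3
    have h4 := add_mem (hpow n m _ h1) h3
    simpa [g] using h4
  let f : MvPowerSeries ι R := fun d => (g (d.degree + 1)).coeff d
  have hf (d : ι →₀ ℕ) : MvPowerSeries.coeff d f = (g (d.degree + 1)).coeff d := rfl
  refine ⟨f, ?_⟩
  rw [Ideal.Quotient.eq, closure, Ideal.mem_iInf]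
  intro n
  rw [Ideal.mem_comap, map_sub, eval_evalAt, AdicCompletion.evalₐ_mk]
  have e1 : Ideal.Quotient.mk (augKer R Λ ^ n)
      (MvPolynomial.aeval (fun i => (MvPolynomial.X (b i) : MvPolynomial Λ R))
        (MvPowerSeries.truncTotal n f)) =
      Ideal.Quotient.mk _ (MvPolynomial.aeval ((deformData b F).y n) (a n)) := by
    have e2 : MvPolynomial.aeval ((deformData b F).y n) (a n) =
        MvPolynomial.aeval (fun i => (MvPolynomial.X (b i) : MvPolynomial Λ R)) (g n) := by
      simp only [g]
      rw [← AlgHom.comp_apply, MvPolynomial.comp_aeval]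
      rfl
    rw [e2]
    refine mk_aeval_eq_of_coeff (fun _ => X_mem _) fun d hd => ?_
    rw [MvPowerSeries.coeff_truncTotal _ hd, hf]
    have := (MvPolynomial.mem_pow_idealOfVars_iff' _ _).1 (hg (m := d.degree + 1) (n := n) hd) d
      (Nat.lt_succ_self _)
    rw [MvPolynomial.coeff_sub, sub_eq_zero] at this
    exact this.symm
  rw [e1, ← map_sub]
  exact mk_sub_aeval_deformData_mem b F n (a n)

end Relations

/-! ### Leading forms and regular sequences -/

section Leading

variable {R S : Type*} [CommRing R] [CommRing S] [Algebra R S] {σ : Type*}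

/-- The images of the variables under `ev` are coordinates of `S` along the ideal `I`: they generate
`I`, every element of `S` is a scalar modulo `I`, and a nonzero homogeneous polynomial of degree `d`
does not vanish modulo `I ^ (d + 1)`. So `ev` identifies the polynomial ring with the associated
graded ring of the `I`-adic filtration. -/
structure IsCoordinates (I : Ideal S) (ev : MvPolynomial σ R →ₐ[R] S) : Prop where
  eq_span : I = Ideal.span (Set.range fun i => ev (MvPolynomial.X i))
  exists_sub_mem : ∀ s : S, ∃ r : R, s - algebraMap R S r ∈ I
  eq_zero : ∀ {d : ℕ} {p : MvPolynomial σ R}, p.IsHomogeneous d → ev p ∈ I ^ (d + 1) → p = 0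

/-- `p` is the leading form of `s` in degree `d` (it may be zero): `p` is homogeneous of degree `d`
and represents `s` modulo `I ^ (d + 1)`. -/
def IsLead (I : Ideal S) (ev : MvPolynomial σ R →ₐ[R] S) (d : ℕ) (s : S)
    (p : MvPolynomial σ R) : Prop :=
  p.IsHomogeneous d ∧ s - ev p ∈ I ^ (d + 1)

variable {I : Ideal S} {ev : MvPolynomial σ R →ₐ[R] S}

lemma map_mem_pow_of_isHomogeneous (hX : ∀ i, ev (MvPolynomial.X i) ∈ I) {d : ℕ}
    {p : MvPolynomial σ R} (hp : p.IsHomogeneous d) : ev p ∈ I ^ d := by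
  rw [MvPolynomial.as_sum p, map_sum]
  refine Ideal.sum_mem _ fun m hm => ?_
  have hd : ∑ i ∈ m.support, m i = d := by
    have := hp.degree_eq_sum_deg_support hm
    exact this.symm
  rw [MvPolynomial.monomial_eq, map_mul, Finsupp.prod, map_prod, ← hd,
    ← Finset.prod_pow_eq_pow_sum]
  refine Ideal.mul_mem_left _ _ (Ideal.prod_mem_prod fun i _ => ?_)
  rw [map_pow]
  exact Ideal.pow_mem_pow (hX i) _

namespace IsCoordinates

variable (h : IsCoordinates I ev)

include h

lemma map_X_mem (i : σ) : ev (MvPolynomial.X i) ∈ I := by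
  rw [h.eq_span]
  exact Ideal.subset_span ⟨i, rfl⟩

end IsCoordinates

namespace IsLead

variable {d e : ℕ} {s t : S} {p q : MvPolynomial σ R}

lemma mem (h : IsCoordinates I ev) (hs : IsLead I ev d s p) : s ∈ I ^ d := by
  have h1 := Ideal.pow_le_pow_right (Nat.le_succ d) hs.2
  simpa using add_mem h1 (map_mem_pow_of_isHomogeneous h.map_X_mem hs.1)

lemma of_mem (hs : s ∈ I ^ (d + 1)) : IsLead I ev d s 0 :=
  ⟨MvPolynomial.isHomogeneous_zero _ _ _, by simpa using hs⟩

lemma mem_succ (hs : IsLead I ev d s 0) : s ∈ I ^ (d + 1) := by simpa using hs.2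

lemma add (hs : IsLead I ev d s p) (ht : IsLead I ev d t q) : IsLead I ev d (s + t) (p + q) :=
  ⟨hs.1.add ht.1, by rw [map_add, add_sub_add_comm]; exact add_mem hs.2 ht.2⟩

lemma sub (hs : IsLead I ev d s p) (ht : IsLead I ev d t q) : IsLead I ev d (s - t) (p - q) :=
  ⟨hs.1.sub ht.1, by rw [map_sub, sub_sub_sub_comm]; exact sub_mem hs.2 ht.2⟩

lemma neg (hs : IsLead I ev d s p) : IsLead I ev d (-s) (-p) := by
  simpa using (of_mem (ev := ev) (zero_mem (I ^ (d + 1)))).sub hs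

lemma smul (hs : IsLead I ev d s p) (r : R) : IsLead I ev d (r • s) (r • p) :=
  ⟨by rw [MvPolynomial.smul_eq_C_mul, ← zero_add d]
      exact (MvPolynomial.isHomogeneous_C _ _).mul hs.1, by
    rw [map_smul, ← smul_sub, Algebra.smul_def]
    exact Ideal.mul_mem_left _ _ hs.2⟩

lemma sum {κ : Type*} (u : Finset κ) {s : κ → S} {p : κ → MvPolynomial σ R}
    (hs : ∀ k ∈ u, IsLead I ev d (s k) (p k)) :
    IsLead I ev d (∑ k ∈ u, s k) (∑ k ∈ u, p k) := by
  classical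
  induction u using Finset.induction_on with
  | empty => exact of_mem (zero_mem _)
  | insert a u ha ih =>
    rw [Finset.sum_insert ha, Finset.sum_insert ha]
    exact (hs a (by simp)).add (ih fun k hk => hs k (by simp [hk]))

lemma mul (h : IsCoordinates I ev) (hs : IsLead I ev d s p) (ht : IsLead I ev e t q) :
    IsLead I ev (d + e) (s * t) (p * q) := by
  refine ⟨hs.1.mul ht.1, ?_⟩
  rw [map_mul, show s * t - ev p * ev q = (s - ev p) * t + ev p * (t - ev q) by ring]
  refine add_mem ?_ ?_
  · rw [show d + e + 1 = d + 1 + e by ring, pow_add]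
    exact Ideal.mul_mem_mul hs.2 (ht.mem h)
  · rw [add_assoc, pow_add]
    exact Ideal.mul_mem_mul (map_mem_pow_of_isHomogeneous h.map_X_mem hs.1) ht.2

lemma one : IsLead I ev 0 (1 : S) 1 :=
  ⟨MvPolynomial.isHomogeneous_one _ _, by simp⟩

lemma prod (h : IsCoordinates I ev) {κ : Type*} (u : Finset κ) {s : κ → S}
    {p : κ → MvPolynomial σ R} {e : κ → ℕ} (hs : ∀ k ∈ u, IsLead I ev (e k) (s k) (p k)) :
    IsLead I ev (∑ k ∈ u, e k) (∏ k ∈ u, s k) (∏ k ∈ u, p k) := by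
  classical
  induction u using Finset.induction_on with
  | empty => exact one
  | insert a u ha ih =>
    rw [Finset.sum_insert ha, Finset.prod_insert ha, Finset.prod_insert ha]
    exact (hs a (by simp)).mul h (ih fun k hk => hs k (by simp [hk]))

lemma esymm (h : IsCoordinates I ev) {κ : Type*} [Fintype κ] {s : κ → S}
    {p : κ → MvPolynomial σ R} {e : ℕ} (hs : ∀ k, IsLead I ev e (s k) (p k)) (k : ℕ) :
    IsLead I ev (k * e) (MvPolynomial.aeval s (MvPolynomial.esymm κ R k))
      (MvPolynomial.aeval p (MvPolynomial.esymm κ R k)) := by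
  rw [MvPolynomial.esymm, map_sum, map_sum]
  refine sum _ fun u hu => ?_
  rw [map_prod, map_prod]
  simp only [MvPolynomial.aeval_X]
  have := prod h u (e := fun _ => e) fun i _ => hs i
  rwa [Finset.sum_const, (Finset.mem_powersetCard.1 hu).2, smul_eq_mul] at this

lemma unique (h : IsCoordinates I ev) (hp : IsLead I ev d s p) (hq : IsLead I ev d s q) :
    p = q := by
  rw [← sub_eq_zero]
  have := hp.sub hq
  rw [sub_self] at this
  exact h.eq_zero this.1 (by simpa using neg_mem this.2)

lemma congr (hs : IsLead I ev d s p) (hst : s - t ∈ I ^ (d + 1)) : IsLead I ev d t p := by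
  simpa using hs.sub (of_mem hst)

lemma of_isHomogeneous (hp : p.IsHomogeneous d) : IsLead I ev d (ev p) p := ⟨hp, by simp⟩

end IsLead

lemma IsCoordinates.exists_isLead (h : IsCoordinates I ev) {d : ℕ} {s : S} (hs : s ∈ I ^ d) :
    ∃ p, IsLead I ev d s p := by
  have h0 (s : S) : ∃ p, IsLead I ev 0 s p := by
    obtain ⟨r, hr⟩ := h.exists_sub_mem s
    refine ⟨MvPolynomial.C r, MvPolynomial.isHomogeneous_C _ _, ?_⟩
    rw [zero_add, pow_one, MvPolynomial.algHom_C]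
    exact hr
  have h1 (s : S) (hs : s ∈ I) : ∃ p, IsLead I ev 1 s p := by
    rw [h.eq_span] at hs
    induction hs using Submodule.span_induction with
    | mem s hs =>
      obtain ⟨i, rfl⟩ := hs
      exact ⟨_, .of_isHomogeneous (MvPolynomial.isHomogeneous_X _ _)⟩
    | zero => exact ⟨0, .of_mem (zero_mem _)⟩
    | add s t _ _ ihs iht =>
      obtain ⟨p, hp⟩ := ihs
      obtain ⟨q, hq⟩ := iht
      exact ⟨_, hp.add hq⟩
    | smul a s _ ih =>
      obtain ⟨p, hp⟩ := ih
      obtain ⟨q, hq⟩ := h0 a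
      exact ⟨q * p, by simpa using hq.mul h hp⟩
  induction d generalizing s with
  | zero => exact h0 s
  | succ d ih =>
    rw [pow_succ] at hs
    induction hs using Submodule.mul_induction_on' with
    | mem_mul_mem a ha c hc =>
      obtain ⟨p, hp⟩ := ih ha
      obtain ⟨q, hq⟩ := h1 c hc
      exact ⟨_, hp.mul h hq⟩
    | add s _ t _ ihs iht =>
      obtain ⟨p, hp⟩ := ihs
      obtain ⟨q, hq⟩ := iht
      exact ⟨_, hp.add hq⟩

lemma homogeneousComponent_mul (p q : MvPolynomial σ R) (d : ℕ) :
    MvPolynomial.homogeneousComponent d (p * q) = ∑ ij ∈ Finset.HasAntidiagonal.antidiagonal d,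
      MvPolynomial.homogeneousComponent ij.1 p * MvPolynomial.homogeneousComponent ij.2 q := by
  classical
  ext m
  rw [MvPolynomial.coeff_homogeneousComponent, MvPolynomial.coeff_mul, MvPolynomial.coeff_sum]
  simp_rw [MvPolynomial.coeff_mul, MvPolynomial.coeff_homogeneousComponent]
  rw [Finset.sum_comm]
  split_ifs with hm
  · refine Finset.sum_congr rfl fun x hx => ?_
    have hx' : x.1.degree + x.2.degree = d := by
      rw [← hm, ← Finset.HasAntidiagonal.mem_antidiagonal.1 hx, map_add]
    rw [Finset.sum_eq_single (x.1.degree, x.2.degree)]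
    · simp
    · intro ij _ hne
      by_cases h1 : x.1.degree = ij.1
      · have h2 : x.2.degree ≠ ij.2 := fun h2 => hne (Prod.ext h1.symm h2.symm)
        simp [h2]
      · simp [h1]
    · intro hn
      exact (hn (Finset.HasAntidiagonal.mem_antidiagonal.2 hx')).elim
  · refine (Finset.sum_eq_zero fun x hx => Finset.sum_eq_zero fun ij hij => ?_).symm
    by_cases h1 : x.1.degree = ij.1
    · have h2 : x.2.degree ≠ ij.2 := by
        intro h2
        refine hm ?_
        rw [← Finset.HasAntidiagonal.mem_antidiagonal.1 hx, map_add, h1, h2,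
          Finset.HasAntidiagonal.mem_antidiagonal.1 hij]
      simp [h2]
    · simp [h1]

section Sequences

variable (h : IsCoordinates I ev) {K : ℕ} {e : ℕ → ℕ} {f : ℕ → S} {p : ℕ → MvPolynomial σ R}

include h

/-- A homogeneous element of the ideal of leading forms is itself a leading form. -/
lemma exists_isLead_of_mem_span (hf : ∀ k < K, IsLead I ev (e k) (f k) (p k)) {d : ℕ}
    {q : MvPolynomial σ R} (hq : q ∈ Ideal.span (p '' Set.Iio K)) (hd : q.IsHomogeneous d) :
    ∃ s ∈ Ideal.span (f '' Set.Iio K), IsLead I ev d s q := by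
  suffices H : ∀ d, ∃ s ∈ Ideal.span (f '' Set.Iio K),
      IsLead I ev d s (MvPolynomial.homogeneousComponent d q) by
    simpa [MvPolynomial.homogeneousComponent_eq_self hd] using H d
  clear hd d
  induction hq using Submodule.span_induction with
  | mem q hq =>
    obtain ⟨k, hk, rfl⟩ := hq
    intro d
    rw [MvPolynomial.homogeneousComponent_of_mem
      ((MvPolynomial.mem_homogeneousSubmodule _ _).2 (hf k hk).1)]
    split_ifs with hd
    · subst hd
      exact ⟨f k, Ideal.subset_span ⟨k, hk, rfl⟩, hf k hk⟩
    · exact ⟨0, zero_mem _, .of_mem (zero_mem _)⟩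
  | zero => exact fun d => ⟨0, zero_mem _, by rw [map_zero]; exact .of_mem (zero_mem _)⟩
  | add q q' _ _ ih ih' =>
    intro d
    obtain ⟨s, hs, hs'⟩ := ih d
    obtain ⟨t, ht, ht'⟩ := ih' d
    exact ⟨s + t, add_mem hs ht, by rw [map_add]; exact hs'.add ht'⟩
  | smul a q _ ih =>
    intro d
    choose s hs hs' using ih
    refine ⟨∑ ij ∈ Finset.HasAntidiagonal.antidiagonal d,
        ev (MvPolynomial.homogeneousComponent ij.1 a) * s ij.2,
      Ideal.sum_mem _ fun ij _ => Ideal.mul_mem_left _ _ (hs _), ?_⟩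
    rw [smul_eq_mul, homogeneousComponent_mul]
    refine IsLead.sum _ fun ij hij => ?_
    rw [← Finset.HasAntidiagonal.mem_antidiagonal.1 hij]
    exact (IsLead.of_isHomogeneous
      (MvPolynomial.homogeneousComponent_isHomogeneous _ _)).mul h (hs' _)

/-- If the leading forms of the `f k` form a regular sequence, the leading form of an element of the
ideal generated by the `f k` lies in the ideal generated by their leading forms. -/
lemma mem_span_of_isLead
    (hreg : ∀ k < K, ∀ q, q * p k ∈ Ideal.span (p '' Set.Iio k) → q ∈ Ideal.span (p '' Set.Iio k))
    (hf : ∀ k < K, IsLead I ev (e k) (f k) (p k)) {d : ℕ} {s : S} {q : MvPolynomial σ R}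
    (hs : s ∈ Ideal.span (f '' Set.Iio K)) (hq : IsLead I ev d s q) :
    q ∈ Ideal.span (p '' Set.Iio K) := by
  induction K generalizing d s q with
  | zero =>
    have hi : Set.Iio 0 = (∅ : Set ℕ) := by ext; simp
    simp only [hi, Set.image_empty, Ideal.span_empty, Ideal.mem_bot] at hs ⊢
    subst hs
    exact hq.unique h (.of_mem (zero_mem _))
  | succ K ih =>
    have hI : Set.Iio (K + 1) = insert K (Set.Iio K) := by
      ext k; simp only [Set.mem_Iio, Set.mem_insert_iff]; omega
    have ih {d s q} := @ih (fun k hk => hreg k (by omega)) (fun k hk => hf k (by omega)) d s q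
    rw [hI, Set.image_insert_eq, Ideal.mem_span_insert] at hs
    obtain ⟨t, s', hs', rfl⟩ := hs
    rw [hI, Set.image_insert_eq]
    have hle : Ideal.span (p '' Set.Iio K) ≤ Ideal.span (insert (p K) (p '' Set.Iio K)) :=
      Ideal.span_mono (Set.subset_insert _ _)
    have hK := hf K (by omega)
    -- the coefficient `t` of `f K` is pushed to higher and higher order
    have key (j : ℕ) : ∀ m t s', d ≤ e K + m + j → t ∈ I ^ m →
        s' ∈ Ideal.span (f '' Set.Iio K) → IsLead I ev d (t * f K + s') q →
        q ∈ Ideal.span (insert (p K) (p '' Set.Iio K)) := by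
      have large (m t s') (hm : d < e K + m) (ht : t ∈ I ^ m)
          (hs' : s' ∈ Ideal.span (f '' Set.Iio K)) (hq : IsLead I ev d (t * f K + s') q) :
          q ∈ Ideal.span (insert (p K) (p '' Set.Iio K)) := by
        refine hle (ih hs' (hq.congr ?_))
        rw [add_sub_cancel_right]
        refine Ideal.pow_le_pow_right (show d + 1 ≤ m + e K by omega) ?_
        rw [pow_add]
        exact Ideal.mul_mem_mul ht (hK.mem h)
      have equal (m t s') (hm : d = e K + m) (ht : t ∈ I ^ m)
          (hs' : s' ∈ Ideal.span (f '' Set.Iio K)) (hq : IsLead I ev d (t * f K + s') q) :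
          q ∈ Ideal.span (insert (p K) (p '' Set.Iio K)) := by
        obtain ⟨a, ha⟩ := h.exists_isLead ht
        have h1 := ha.mul h hK
        rw [add_comm m, ← hm] at h1
        have h2 := hq.sub h1
        rw [add_sub_cancel_left] at h2
        have h3 := add_mem (hle (ih hs' h2)) (Ideal.mul_mem_left _ a
          (Ideal.subset_span (Set.mem_insert (p K) (p '' Set.Iio K))))
        simpa using h3
      induction j with
      | zero =>
        intro m t s' hd ht hs' hq
        obtain hd | hd : d = e K + m ∨ d < e K + m := by omega
        · exact equal m t s' hd ht hs' hq
        · exact large m t s' hd ht hs' hq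
      | succ j ihj =>
        intro m t s' hd ht hs' hq
        obtain hd' | hd' | hd' : d = e K + m ∨ d < e K + m ∨ e K + m < d := by omega
        · exact equal m t s' hd' ht hs' hq
        · exact large m t s' hd' ht hs' hq
        obtain ⟨a, ha⟩ := h.exists_isLead ht
        have h1 := (ha.mul h hK).neg
        have h2 : IsLead I ev (m + e K) s' (-(a * p K)) := by
          refine h1.congr ?_
          rw [show -(t * f K) - s' = -(t * f K + s') by ring]
          exact neg_mem (Ideal.pow_le_pow_right (by omega) (hq.mem h))
        have h3 := hreg K (by omega) a (neg_mem_iff.1 (ih hs' h2))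
        obtain ⟨t', ht', hat'⟩ := exists_isLead_of_mem_span h (fun k hk => hf k (by omega)) h3 ha.1
        have h4 : t - t' ∈ I ^ (m + 1) := (by simpa using ha.sub hat' :
          IsLead I ev m (t - t') 0).mem_succ
        refine ihj (m + 1) (t - t') (s' + t' * f K) (by omega) h4
          (add_mem hs' (Ideal.mul_mem_right _ _ ht')) ?_
        rwa [show (t - t') * f K + (s' + t' * f K) = t * f K + s' by ring]
    exact key d 0 t s' (by omega) (by simp) hs' hq

/-- Homogeneous elements of the algebra generated by leading forms lift to leading forms of elements
of the algebra. -/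
lemma exists_isLead_of_mem_adjoin (hf : ∀ k < K, IsLead I ev (e k) (f k) (p k)) {d : ℕ}
    {q : MvPolynomial σ R} (hq : q ∈ Algebra.adjoin R (p '' Set.Iio K)) (hd : q.IsHomogeneous d) :
    ∃ s ∈ Algebra.adjoin R (f '' Set.Iio K), IsLead I ev d s q := by
  suffices H : ∀ d, ∃ s ∈ Algebra.adjoin R (f '' Set.Iio K),
      IsLead I ev d s (MvPolynomial.homogeneousComponent d q) by
    simpa [MvPolynomial.homogeneousComponent_eq_self hd] using H d
  clear hd d
  induction hq using Algebra.adjoin_induction with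
  | mem q hq =>
    obtain ⟨k, hk, rfl⟩ := hq
    intro d
    rw [MvPolynomial.homogeneousComponent_of_mem
      ((MvPolynomial.mem_homogeneousSubmodule _ _).2 (hf k hk).1)]
    split_ifs with hd
    · subst hd
      exact ⟨f k, Algebra.subset_adjoin ⟨k, hk, rfl⟩, hf k hk⟩
    · exact ⟨0, zero_mem _, .of_mem (zero_mem _)⟩
  | algebraMap r =>
    intro d
    rw [MvPolynomial.algebraMap_eq, MvPolynomial.homogeneousComponent_of_mem
      ((MvPolynomial.mem_homogeneousSubmodule _ _).2 (MvPolynomial.isHomogeneous_C _ r))]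
    split_ifs with hd
    · subst hd
      refine ⟨algebraMap R S r, Subalgebra.algebraMap_mem _ _, ?_⟩
      rw [← MvPolynomial.algHom_C ev]
      exact .of_isHomogeneous (MvPolynomial.isHomogeneous_C _ r)
    · exact ⟨0, zero_mem _, .of_mem (zero_mem _)⟩
  | add q q' _ _ ih ih' =>
    intro d
    obtain ⟨s, hs, hs'⟩ := ih d
    obtain ⟨t, ht, ht'⟩ := ih' d
    exact ⟨s + t, add_mem hs ht, by rw [map_add]; exact hs'.add ht'⟩
  | mul q q' _ _ ih ih' =>
    intro d
    choose s hs hs' using ih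
    choose t ht ht' using ih'
    refine ⟨∑ ij ∈ Finset.HasAntidiagonal.antidiagonal d, s ij.1 * t ij.2,
      sum_mem fun ij _ => mul_mem (hs _) (ht _), ?_⟩
    rw [homogeneousComponent_mul]
    refine IsLead.sum _ fun ij hij => ?_
    rw [← Finset.HasAntidiagonal.mem_antidiagonal.1 hij]
    exact (hs' _).mul h (ht' _)

end Sequences

end Leading

lemma map_mem_pow {R S S' : Type*} [CommRing R] [CommRing S] [Algebra R S] [CommRing S']
    [Algebra R S'] (T : S →ₐ[R] S') {ι : Type*} {v : ι → S} {J : Ideal S'}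
    (hT : ∀ i, T (v i) ∈ J) {n : ℕ} {s : S} (hs : s ∈ Ideal.span (Set.range v) ^ n) :
    T s ∈ J ^ n := by
  have hI : Ideal.span (Set.range v) ≤ J.comap T := by
    rw [Ideal.span_le]
    rintro _ ⟨i, rfl⟩
    exact hT i
  exact ((Ideal.pow_right_mono hI n).trans (Ideal.le_comap_pow _ _)) hs

/-! ### Leading forms under homomorphisms -/

section LeadingMap

variable {R S S' : Type*} [CommRing R] [CommRing S] [Algebra R S] [CommRing S'] [Algebra R S']
  {σ : Type*} {I : Ideal S} {ev : MvPolynomial σ R →ₐ[R] S} {I' : Ideal S'}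
  {ev' : MvPolynomial σ R →ₐ[R] S'}

lemma IsLead.aeval {ι : Type*} (h : IsCoordinates I ev) {s : ι → S} {l : ι → MvPolynomial σ R}
    (hs : ∀ i, IsLead I ev 1 (s i) (l i)) {d : ℕ} {p : MvPolynomial ι R} (hp : p.IsHomogeneous d) :
    IsLead I ev d (MvPolynomial.aeval s p) (MvPolynomial.aeval l p) := by
  rw [MvPolynomial.as_sum p, map_sum, map_sum]
  refine IsLead.sum _ fun m hm => ?_
  have hd : ∑ i ∈ m.support, m i = d := (hp.degree_eq_sum_deg_support hm).symm
  rw [MvPolynomial.aeval_monomial, MvPolynomial.aeval_monomial, ← Algebra.smul_def,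
    ← Algebra.smul_def]
  refine IsLead.smul ?_ _
  have hpow (i : ι) (k : ℕ) : IsLead I ev k (s i ^ k) (l i ^ k) := by
    have := IsLead.prod h (Finset.range k) (e := fun _ => 1) fun _ _ => hs i
    simpa using this
  rw [← hd]
  exact IsLead.prod h _ fun i _ => hpow i _

/-- A homomorphism that maps the coordinates to elements with linear leading forms acts on leading
forms by the corresponding linear substitution. -/
lemma IsLead.map (h : IsCoordinates I ev) (h' : IsCoordinates I' ev') (T : S →ₐ[R] S')
    {l : σ → MvPolynomial σ R}
    (hT : ∀ i, IsLead I' ev' 1 (T (ev (MvPolynomial.X i))) (l i)) {d : ℕ} {s : S}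
    {p : MvPolynomial σ R} (hs : IsLead I ev d s p) :
    IsLead I' ev' d (T s) (MvPolynomial.aeval l p) := by
  have hI' : T (s - ev p) ∈ I' ^ (d + 1) :=
    map_mem_pow T (fun i => by simpa using (hT i).mem h') (h.eq_span ▸ hs.2)
  have e : T.comp ev = MvPolynomial.aeval fun i => T (ev (MvPolynomial.X i)) :=
    MvPolynomial.algHom_ext fun i => by simp
  have h1 := IsLead.aeval h' hT hs.1
  rw [← e] at h1
  refine h1.congr ?_
  rw [← neg_mem_iff]
  simpa using hI'

end LeadingMap

/-! ### Coordinates of the formal group algebra -/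

section Coordinates

variable {R : Type*} [CommRing R] {Λ : Type*} [AddCommGroup Λ] {ι : Type*} [Fintype ι]
  (b : Module.Basis ι ℤ Λ) (F : FormalGroup R)

/-- The polynomials in the elements `x_λ` for `λ` in a basis. -/
def coord : MvPolynomial ι R →ₐ[R] FGA Λ F := MvPolynomial.aeval fun i => x F (b i)

/-- An element of the lattice as a linear form in the variables given by a basis. -/
def linPoly (R : Type*) [CommRing R] (l : Λ) : MvPolynomial ι R :=
  ∑ i, MvPolynomial.C ((b.repr l i : ℤ) : R) * MvPolynomial.X i

variable (R) in
lemma linPoly_add (l m : Λ) : linPoly b R (l + m) = linPoly b R l + linPoly b R m := by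
  simp [linPoly, add_mul, Finset.sum_add_distrib]

lemma augF_mk_of (p : MvPolynomial Λ R) :
    augF F (Ideal.Quotient.mk _ (AdicCompletion.of _ _ p)) = aug R Λ p := by
  change AdicCompletion.kerProj (aug_surjective R Λ) (.of _ _ p) = _
  rw [AdicCompletion.kerProj_of]

lemma mk_evalAt_eq {σ : Type*} [Fintype σ] (f : MvPowerSeries σ R)
    (v : σ → MvPolynomial Λ R) (hv : ∀ i, v i ∈ augKer R Λ) :
    ∃ g : σ → FGA Λ F, (Ideal.Quotient.mk _ (evalAt f v hv) : FGA Λ F) =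
      algebraMap R _ (MvPowerSeries.constantCoeff f) +
        ∑ i, Ideal.Quotient.mk _ (AdicCompletion.of _ _ (v i)) * g i ∧
      ∀ i, augF F (g i) = MvPowerSeries.coeff (Finsupp.single i 1) f := by
  have hC (r : R) : (Ideal.Quotient.mk _ (evalAt (MvPowerSeries.C r) v hv) : FGA Λ F) =
      algebraMap R _ r := by
    refine congrArg (Ideal.Quotient.mk _) (AdicCompletion.ext_evalₐ fun n => ?_)
    rw [eval_evalAt]
    have h1 := mk_aeval_eq_of_coeff hv (n := n)
      (p := MvPowerSeries.truncTotal n (MvPowerSeries.C (σ := σ) r))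
      (q := MvPolynomial.C r) fun d hd => by
        rw [MvPowerSeries.coeff_truncTotal _ hd, ← MvPolynomial.coe_C, MvPolynomial.coeff_coe]
    rw [h1, MvPolynomial.algHom_C]
    exact (AlgHom.commutes ((AdicCompletion.evalₐ (augKer R Λ) n).restrictScalars R) r).symm
  have main (f : MvPowerSeries σ R) (hf : MvPowerSeries.constantCoeff f = 0) :
      ∃ g : σ → MvPowerSeries σ R, (∀ i, MvPowerSeries.constantCoeff (g i) =
          MvPowerSeries.coeff (Finsupp.single i 1) f) ∧
        (Ideal.Quotient.mk _ (evalAt f v hv) : FGA Λ F) =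
        ∑ i, Ideal.Quotient.mk _ (AdicCompletion.of _ _ (v i)) *
          Ideal.Quotient.mk _ (evalAt (g i) v hv) := by
    obtain ⟨g, hg, hg'⟩ := exists_eq_sum_X_mul f hf
    refine ⟨g, hg', ?_⟩
    conv_lhs => rw [hg]
    rw [evalAt_sum, map_sum]
    refine Finset.sum_congr rfl fun i _ => ?_
    rw [evalAt_mul, evalAt_X, map_mul]
  have main' (f : MvPowerSeries σ R) : ∃ g : σ → MvPowerSeries σ R,
      (∀ i, MvPowerSeries.constantCoeff (g i) = MvPowerSeries.coeff (Finsupp.single i 1) f) ∧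
        (Ideal.Quotient.mk _ (evalAt f v hv) : FGA Λ F) =
        algebraMap R _ (MvPowerSeries.constantCoeff f) +
        ∑ i, Ideal.Quotient.mk _ (AdicCompletion.of _ _ (v i)) *
          Ideal.Quotient.mk _ (evalAt (g i) v hv) := by
    obtain ⟨g, hg, hg'⟩ := main (f - MvPowerSeries.C (MvPowerSeries.constantCoeff f)) (by simp)
    refine ⟨g, fun i => ?_, ?_⟩
    · classical
      rw [hg, map_sub, MvPowerSeries.coeff_C, if_neg (by simp), sub_zero]
    · rw [← hg', ← hC, ← map_add, ← evalAt_add, add_sub_cancel]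
  have haug (f : MvPowerSeries σ R) : augF F (Ideal.Quotient.mk _ (evalAt f v hv)) =
      MvPowerSeries.constantCoeff f := by
    obtain ⟨g, hg, e⟩ := main' f
    rw [e, map_add, AlgHom.commutes, map_sum, Finset.sum_eq_zero, add_zero]
    · rfl
    · intro i _
      rw [map_mul, augF_mk_of, (RingHom.mem_ker).1 (hv i), zero_mul]
  obtain ⟨g, hg, e⟩ := main' f
  exact ⟨_, e, fun i => by rw [haug, hg]⟩

lemma x_mem (l : Λ) : x F l ∈ augIdeal F := RingHom.mem_ker.2 (augF_x F l)

lemma augIdeal_eq_span [F.IsComm] :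
    augIdeal F = Ideal.span (Set.range fun i => x F (b i)) := by
  refine le_antisymm (fun z hz => ?_) (Ideal.span_le.2 ?_)
  · obtain ⟨f, rfl⟩ := exists_eq_mk_evalAt b F z
    obtain ⟨g, e, -⟩ := mk_evalAt_eq F f (fun i => MvPolynomial.X (b i)) fun _ => X_mem _
    have hx (i : ι) : Ideal.Quotient.mk _ (AdicCompletion.of _ _ (MvPolynomial.X (b i))) =
        x F (b i) := rfl
    simp only [hx] at e
    have hz := (RingHom.mem_ker).1 hz
    rw [e, map_add, AlgHom.commutes, map_sum, Finset.sum_eq_zero, add_zero] at hz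
    · change MvPowerSeries.constantCoeff f = 0 at hz
      rw [e, hz, map_zero, zero_add]
      exact Ideal.sum_mem _ fun i _ => Ideal.mul_mem_right _ _ (Ideal.subset_span ⟨i, rfl⟩)
    · intro i _
      rw [map_mul, augF_x, zero_mul]
  · rintro _ ⟨i, rfl⟩
    exact x_mem F _

lemma sub_algebraMap_augF_mem (z : FGA Λ F) : z - algebraMap R _ (augF F z) ∈ augIdeal F := by
  rw [augIdeal, RingHom.mem_ker, map_sub, AlgHom.commutes]
  exact sub_self _

lemma x_add_sub_mem (l m : Λ) : x F (l + m) - (x F l + x F m) ∈ augIdeal F ^ 2 := by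
  have h0 : x F (l + m) = Ideal.Quotient.mk _ (evalAt F.toPowerSeries
      ![MvPolynomial.X l, MvPolynomial.X m] (pair_mem l m)) := by
    rw [x, Ideal.Quotient.eq, closure, Ideal.mem_iInf]
    exact fun n => Ideal.mem_map_of_mem _ (Ideal.subset_span (Or.inr ⟨(l, m), rfl⟩))
  obtain ⟨g, e, hg⟩ := mk_evalAt_eq F F.toPowerSeries ![MvPolynomial.X l, MvPolynomial.X m]
    (pair_mem l m)
  rw [h0, e, F.zero_constantCoeff, map_zero, zero_add, Fin.sum_univ_two]
  change x F l * g 0 + x F m * g 1 - (x F l + x F m) ∈ _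
  have h1 : g 0 - 1 ∈ augIdeal F := by
    rw [augIdeal, RingHom.mem_ker, map_sub, hg, F.lin_coeff_X, map_one, sub_self]
  have h2 : g 1 - 1 ∈ augIdeal F := by
    rw [augIdeal, RingHom.mem_ker, map_sub, hg, F.lin_coeff_Y, map_one, sub_self]
  rw [show x F l * g 0 + x F m * g 1 - (x F l + x F m) =
    x F l * (g 0 - 1) + x F m * (g 1 - 1) by ring, pow_two]
  exact add_mem (Ideal.mul_mem_mul (x_mem F l) h1) (Ideal.mul_mem_mul (x_mem F m) h2)

lemma isHomogeneous_linPoly (l : Λ) : (linPoly b R l).IsHomogeneous 1 :=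
  MvPolynomial.IsHomogeneous.sum _ _ _ fun i _ => by
    simpa using (MvPolynomial.isHomogeneous_C ι ((b.repr l i : ℤ) : R)).mul
      (MvPolynomial.isHomogeneous_X R i)

lemma isLead_x (l : Λ) : IsLead (augIdeal F) (coord b F) 1 (x F l) (linPoly b R l) := by
  refine ⟨isHomogeneous_linPoly b l, ?_⟩
  let φ : Λ →+ FGA Λ F ⧸ augIdeal F ^ 2 := AddMonoidHom.mk' (fun l => Ideal.Quotient.mk _ (x F l))
    fun l m => by
      rw [← map_add, Ideal.Quotient.eq]
      exact x_add_sub_mem F l m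
  have h : φ l = Ideal.Quotient.mk _ (coord b F (linPoly b R l)) := by
    conv_lhs => rw [← b.sum_repr l]
    rw [map_sum, linPoly, map_sum, map_sum]
    refine Finset.sum_congr rfl fun i _ => ?_
    rw [map_zsmul, map_mul, map_mul, zsmul_eq_mul]
    congr 1
    · rw [MvPolynomial.algHom_C]
      simp
    · rw [coord, MvPolynomial.aeval_X]
      rfl
  exact Ideal.Quotient.eq.1 h

lemma deform_coord [F.IsComm] (F' : FormalGroup R) (p : MvPolynomial ι R) :
    deform b F F' (coord b F p) = coord b F' p := by
  have : (deform b F F').comp (coord b F) = coord b F' :=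
    MvPolynomial.algHom_ext fun i => by
      simp only [AlgHom.comp_apply, coord, MvPolynomial.aeval_X, deform_x]
  exact congrArg (fun f => f p) this

lemma pow_augKer_le_comap_linPoly (n : ℕ) : augKer R Λ ^ n ≤
    (MvPolynomial.idealOfVars ι R ^ n).comap (MvPolynomial.aeval (R := R) (linPoly b R)) := by
  refine (Ideal.pow_right_mono ?_ _).trans (Ideal.le_comap_pow _ _)
  intro q hq
  have e : (MvPolynomial.aeval (R := R) fun _ : ι => (0 : R)).comp
      (MvPolynomial.aeval (linPoly b R)) = aug R Λ :=
    MvPolynomial.algHom_ext fun l => by simp [aug, linPoly]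
  have h' := congrArg (fun f => f q) e
  simp only [AlgHom.comp_apply, MvPolynomial.aeval_zero', (RingHom.mem_ker).1 hq] at h'
  rw [Ideal.mem_comap, ← pow_one (MvPolynomial.idealOfVars ι R),
    MvPolynomial.mem_pow_idealOfVars_iff']
  intro d hd
  obtain rfl : d = 0 := (Finsupp.degree_eq_zero_iff d).1 (by simpa using hd)
  exact h'

/-- The map from the completion of `R[x_Λ]` to the polynomial ring modulo a power of the ideal of the
variables, given by `x_λ ↦ λ`. -/
def completionToPoly (n : ℕ) : CPoly R Λ →ₐ[R]
    MvPolynomial ι R ⧸ MvPolynomial.idealOfVars ι R ^ n :=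
  AlgHom.comp (Ideal.quotientMapₐ (MvPolynomial.idealOfVars ι R ^ n)
      (MvPolynomial.aeval (linPoly b R)) (pow_augKer_le_comap_linPoly b n))
    (AlgHom.restrictScalars R (AdicCompletion.evalₐ (augKer R Λ) n))

lemma completionToPoly_eq {n : ℕ} {z : CPoly R Λ} {p : MvPolynomial Λ R}
    (h : AdicCompletion.evalₐ (augKer R Λ) n z = Ideal.Quotient.mk _ p) :
    completionToPoly b n z = Ideal.Quotient.mk _ (MvPolynomial.aeval (linPoly b R) p) := by
  rw [completionToPoly, AlgHom.comp_apply, AlgHom.restrictScalars_apply, h]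
  rfl

lemma completionToPoly_eq_zero (n : ℕ) {z : CPoly R Λ}
    (hz : z ∈ closure (relIdeal Λ (FormalGroup.𝔾ₐ (R := R)))) :
    completionToPoly b (n + 2) z = 0 := by
  have h1 := Ideal.mem_comap.1 ((Ideal.mem_iInf.1 hz) (n + 2))
  have h2 : relIdeal Λ (FormalGroup.𝔾ₐ (R := R)) ≤ RingHom.ker (completionToPoly b (n + 2)) := by
    rw [relIdeal, Ideal.span_le]
    rintro _ (rfl | ⟨⟨l, m⟩, rfl⟩)
    · rw [SetLike.mem_coe, RingHom.mem_ker, completionToPoly_eq b (AdicCompletion.evalₐ_of ..)]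
      simp [linPoly]
    · rw [SetLike.mem_coe, RingHom.mem_ker, map_sub,
        completionToPoly_eq b (AdicCompletion.evalₐ_of ..),
        completionToPoly_eq b (p := MvPolynomial.X l + MvPolynomial.X m), ← map_sub]
      · simp [linPoly_add]
      · rw [eval_evalAt, mk_aeval_eq_of_coeff (q := MvPolynomial.X 0 + MvPolynomial.X 1)
          (pair_mem l m)]
        · simp
        · intro d hd
          rw [MvPowerSeries.coeff_truncTotal _ hd, FormalGroup.𝔾ₐ_toPowerSeries,
            ← MvPolynomial.coeff_coe, MvPolynomial.coe_add, MvPolynomial.coe_X,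
            MvPolynomial.coe_X]
  rw [Ideal.mem_map_iff_of_surjective _ (AdicCompletion.surjective_evalₐ _ _)] at h1
  obtain ⟨y, hy, e⟩ := h1
  have h3 := (RingHom.mem_ker).1 (h2 hy)
  rw [completionToPoly, AlgHom.comp_apply, AlgHom.restrictScalars_apply] at h3 ⊢
  rw [← e, h3]

/-- For the additive formal group law, `x_λ ↦ λ` is a well-defined map to the polynomial ring modulo
a power of the ideal of the variables. -/
def additiveToPoly (n : ℕ) : FGA Λ (FormalGroup.𝔾ₐ (R := R)) →ₐ[R]
    MvPolynomial ι R ⧸ MvPolynomial.idealOfVars ι R ^ (n + 2) :=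
  Ideal.Quotient.liftₐ _ (completionToPoly b (n + 2)) fun _ hz => completionToPoly_eq_zero b n hz

lemma additiveToPoly_coord (n : ℕ) (p : MvPolynomial ι R) :
    additiveToPoly b n (coord b FormalGroup.𝔾ₐ p) = Ideal.Quotient.mk _ p := by
  have : (additiveToPoly b n).comp (coord b FormalGroup.𝔾ₐ) = Ideal.Quotient.mkₐ R _ := by
    refine MvPolynomial.algHom_ext fun i => ?_
    rw [AlgHom.comp_apply, coord, MvPolynomial.aeval_X]
    refine (completionToPoly_eq b (AdicCompletion.evalₐ_of ..)).trans ?_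
    rw [MvPolynomial.aeval_X, Ideal.Quotient.mkₐ_eq_mk]
    congr 1
    classical
    rw [linPoly, Finset.sum_eq_single i]
    · simp
    · intro j _ hj
      simp [Finsupp.single_eq_of_ne hj]
    · simp
  exact congrArg (fun f => f p) this

/-- The elements `x_λ`, for `λ` in a basis, are coordinates of the formal group algebra. -/
theorem isCoordinates [F.IsComm] : IsCoordinates (augIdeal F) (coord b F) where
  eq_span := by
    rw [augIdeal_eq_span b F]
    simp [coord]
  exists_sub_mem z := ⟨_, sub_algebraMap_augF_mem F z⟩
  eq_zero {d p} hp h := by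
    have h1 := map_mem_pow (deform b F FormalGroup.𝔾ₐ) (J := augIdeal _) (fun i => by
      rw [deform_x]
      exact x_mem _ _) (augIdeal_eq_span b F ▸ h)
    rw [deform_coord, augIdeal_eq_span b] at h1
    have hX (i : ι) : x (FormalGroup.𝔾ₐ (R := R)) (b i) = coord b _ (MvPolynomial.X i) := by
      rw [coord, MvPolynomial.aeval_X]
    have h3 := map_mem_pow (additiveToPoly b d)
      (J := (MvPolynomial.idealOfVars ι R).map (Ideal.Quotient.mk _)) (fun i => by
        rw [hX, additiveToPoly_coord]
        exact Ideal.mem_map_of_mem _ (Ideal.subset_span ⟨i, rfl⟩)) h1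
    rw [additiveToPoly_coord, ← Ideal.map_pow,
      Ideal.mem_map_iff_of_surjective _ Ideal.Quotient.mk_surjective] at h3
    obtain ⟨q, hq, e⟩ := h3
    rw [Ideal.Quotient.eq] at e
    have h4 := Ideal.pow_le_pow_right (Nat.le_succ _) e
    have h5 := sub_mem hq h4
    rw [sub_sub_cancel, MvPolynomial.mem_pow_idealOfVars_iff'] at h5
    ext m
    rw [MvPolynomial.coeff_zero]
    by_cases hm : m.degree = d
    · exact h5 m (by omega)
    · exact hp.coeff_eq_zero hm

/-- The linear substitution of the polynomial ring given by an endomorphism of the lattice. -/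
def linSubst (R : Type*) [CommRing R] (w : Λ →+ Λ) : MvPolynomial ι R →ₐ[R] MvPolynomial ι R :=
  MvPolynomial.aeval fun i => linPoly b R (w (b i))

variable {F} in
lemma IsLead.act [F.IsComm] (w : Λ →+ Λ) {d : ℕ} {s : FGA Λ F} {p : MvPolynomial ι R}
    (hs : IsLead (augIdeal F) (coord b F) d s p) :
    IsLead (augIdeal F) (coord b F) d (act F w s) (linSubst b R w p) :=
  hs.map (isCoordinates b F) (isCoordinates b F) (FGExp.act F w) fun i => by
    rw [coord, MvPolynomial.aeval_X, act_x]
    exact isLead_x b F _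

variable {F} in
lemma IsLead.deform [F.IsComm] (F' : FormalGroup R) [F'.IsComm] {d : ℕ} {s : FGA Λ F}
    {p : MvPolynomial ι R} (hs : IsLead (augIdeal F) (coord b F) d s p) :
    IsLead (augIdeal F') (coord b F') d (FGExp.deform b F F' s) p := by
  have := hs.map (isCoordinates b F) (isCoordinates b F') (FGExp.deform b F F')
    (l := MvPolynomial.X) fun i => by
      rw [deform_coord]
      exact .of_isHomogeneous (MvPolynomial.isHomogeneous_X _ _)
  simpa using this

lemma act_comp (v w : Λ →+ Λ) (z : FGA Λ F) : act F v (act F w z) = act F (v.comp w) z := by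
  obtain ⟨z, rfl⟩ := Ideal.Quotient.mk_surjective z
  refine congrArg (Ideal.Quotient.mk _) (AdicCompletion.ext_evalₐ fun n => ?_)
  change AdicCompletion.evalₐ _ n ((actData R v).hom ((actData R w).hom z)) =
    AdicCompletion.evalₐ _ n ((actData R (v.comp w)).hom z)
  rw [SubstData.eval_hom, SubstData.eval_hom, SubstData.eval_hom]
  obtain ⟨p, hp⟩ := Ideal.Quotient.mk_surjective (AdicCompletion.evalₐ (augKer R Λ) n z)
  rw [← hp, SubstData.level_mk, SubstData.level_mk, SubstData.level_mk, ← AlgHom.comp_apply,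
    MvPolynomial.comp_aeval]
  simp [actData]

include b in
lemma act_mem_augIdeal [F.IsComm] (w : Λ →+ Λ) {z : FGA Λ F} (hz : z ∈ augIdeal F) :
    act F w z ∈ augIdeal F := by
  rw [← pow_one (augIdeal F)] at hz ⊢
  obtain ⟨p, hp⟩ := (isCoordinates b F).exists_isLead hz
  exact (hp.act b w).mem (isCoordinates b F)

end Coordinates

/-! ### Divisibility of exponents -/

section Exponents

variable {R : Type*} [CommRing R] {Λ : Type*} [AddCommGroup Λ] {ι : Type*} [Finite ι]
  {b : Module.Basis ι ℤ Λ} {W : Subgroup (Λ ≃ₗ[ℤ] Λ)} {F F' : FormalGroup R} [F.IsComm] {d : ℕ}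

lemma coprime_two_pow_ringChar (h2 : ∀ r : R, 2 * r = 0 → r = 0) (k : ℕ)
    (h0 : ringChar R ≠ 0) : (2 ^ k).Coprime (ringChar R) := by
  refine Nat.Coprime.pow_left _ (Nat.coprime_two_left.2 (Nat.not_even_iff_odd.1 fun h => ?_))
  obtain ⟨m, hm⟩ := h
  have h1 : (m : R) = 0 := h2 _ (by rw [two_mul, ← Nat.cast_add, ← hm, ringChar.Nat.cast_ringChar])
  have h3 := Nat.le_of_dvd (by omega) ((ringChar.spec R m).1 h1)
  omega

lemma IsExponentMultiple.gcd {N N' : ℕ} (hN : IsExponentMultiple b W F F' d N)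
    (hN' : IsExponentMultiple b W F F' d N') : IsExponentMultiple b W F F' d (N.gcd N') := by
  intro z' hz'
  obtain ⟨z, hz, e⟩ := hN z' hz'
  obtain ⟨y, hy, e'⟩ := hN' z' hz'
  refine ⟨N.gcdA N' • z + N.gcdB N' • y, add_mem (zsmul_mem hz _) (zsmul_mem hy _), ?_⟩
  have h1 : N.gcd N' • z' = N.gcdA N' • (N • z') + N.gcdB N' • (N' • z') := by
    rw [← natCast_zsmul, Nat.gcd_eq_gcd_ab, add_zsmul, mul_comm, mul_comm (N' : ℤ), mul_zsmul,
      mul_zsmul, natCast_zsmul, natCast_zsmul]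
  rw [h1, map_add, map_zsmul, map_zsmul, add_sub_add_comm, ← zsmul_sub, ← zsmul_sub]
  exact add_mem (zsmul_mem e _) (zsmul_mem e' _)

/-- Multiples of the exponent are closed under greatest common divisors, so the smallest one divides
the others. -/
lemma exponent_dvd {N : ℕ} (h0 : 0 < N) (hc : ringChar R ≠ 0 → N.Coprime (ringChar R))
    (hN : IsExponentMultiple b W F F' d N) :
    HasFiniteExponent b W F F' d ∧ exponent b W F F' d ∣ N := by
  have hne : (exponentSet b W F F' d).Nonempty := ⟨N, h0, hc, hN⟩
  refine ⟨hne, ?_⟩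
  obtain ⟨h1, -, h2⟩ := Nat.sInf_mem hne
  have hmem : N.gcd (exponent b W F F' d) ∈ exponentSet b W F F' d :=
    ⟨Nat.gcd_pos_of_pos_left _ h0, fun h => (hc h).coprime_dvd_left (Nat.gcd_dvd_left _ _),
      hN.gcd h2⟩
  have h3 : exponent b W F F' d ≤ N.gcd (exponent b W F F' d) := Nat.sInf_le hmem
  have h4 := Nat.le_antisymm h3 (Nat.le_of_dvd h1 (Nat.gcd_dvd_right _ _))
  rw [h4]
  exact Nat.gcd_dvd_left _ _

lemma exponent_eq_one {N : ℕ} (hu : IsUnit (N : R)) (hN : IsExponentMultiple b W F F' d N) :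
    HasFiniteExponent b W F F' d ∧ exponent b W F F' d = 1 := by
  have h1 : IsExponentMultiple b W F F' d 1 := by
    intro z' hz'
    obtain ⟨z, hz, e⟩ := hN z' hz'
    obtain ⟨u, hu⟩ := hu
    refine ⟨(↑u⁻¹ : R) • z, ?_, ?_⟩
    · rw [Algebra.smul_def]
      exact Ideal.mul_mem_left _ _ hz
    · have h3 := Ideal.mul_mem_left _ (algebraMap R (FGA Λ F') ↑u⁻¹) e
      rw [← Algebra.smul_def, smul_sub, ← Nat.cast_smul_eq_nsmul R, ← hu, smul_smul,
        Units.inv_mul, one_smul] at h3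
      rwa [one_smul, map_smul]
  obtain ⟨h2, h3⟩ := exponent_dvd one_pos (fun _ => Nat.coprime_one_left _) h1
  exact ⟨h2, Nat.dvd_one.1 h3⟩

end Exponents

/-! ### The criterion for multiples of the exponent -/

section Transfer

variable {R : Type*} [CommRing R] {n : ℕ}

/-- The simple reflection `v ↦ v - v_i α_i` of the weight lattice. -/
def simpleReflection (A : Matrix (Fin n) (Fin n) ℤ) (hA : ∀ i, A i i = 2) (i : Fin n) :
    (Fin n → ℤ) ≃ₗ[ℤ] (Fin n → ℤ) :=
  LinearEquiv.ofInvolutive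
    { toFun := fun v => v - v i • A i
      map_add' := fun v w => by simp only [Pi.add_apply, add_smul]; abel
      map_smul' := fun c v => by simp [smul_sub, mul_smul] } fun v => by
        ext k
        simp [hA]
        ring

lemma simpleReflection_apply (A : Matrix (Fin n) (Fin n) ℤ) (hA : ∀ i, A i i = 2) (i : Fin n)
    (v : Fin n → ℤ) : simpleReflection A hA i v = v - v i • A i := rfl

lemma simpleReflection_mem (A : Matrix (Fin n) (Fin n) ℤ) (hA : ∀ i, A i i = 2) (i : Fin n) :
    simpleReflection A hA i ∈ weylGroup A :=
  Subgroup.subset_closure ⟨i, simpleReflection_apply A hA i⟩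

/-- A description of the weight lattice in coordinates in which the simple reflections become the
maps `r i` of `ℤ^n`: maps from the weight lattice to `ℤ^n` and back, compatible with the reflections,
whose composition is multiplication by `c`. -/
structure Realization (A : Matrix (Fin n) (Fin n) ℤ) (c : ℕ)
    (r : Fin n → (Fin n → ℤ) →+ (Fin n → ℤ)) where
  /-- The map from the weight lattice. -/
  toE : (Fin n → ℤ) →+ (Fin n → ℤ)
  /-- The map to the weight lattice. -/
  ofE : (Fin n → ℤ) →+ (Fin n → ℤ)
  diag : ∀ i, A i i = 2
  ofE_toE : ∀ v, ofE (toE v) = c • v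
  toE_reflection : ∀ i v, toE (v - v i • A i) = r i (toE v)
  ofE_reflection : ∀ i v, ofE v - ofE v i • A i = ofE (r i v)

/-- The polynomials `p k`, for `k < K`, are the leading forms of elements of the augmentation ideal
of the formal group algebra that are invariant under the maps `r i`. -/
def HasInvariantLifts (F : FormalGroup R) (r : Fin n → (Fin n → ℤ) →+ (Fin n → ℤ)) (K : ℕ)
    (p : ℕ → MvPolynomial (Fin n) R) : Prop :=
  ∃ (e : ℕ → ℕ) (f : ℕ → FGA (Fin n → ℤ) F), ∀ k < K, e k ≠ 0 ∧
    IsLead (augIdeal F) (coord (Pi.basisFun ℤ (Fin n)) F) (e k) (f k) (p k) ∧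
      ∀ i, act F (r i) (f k) = f k

lemma linSubst_linPoly (w : (Fin n → ℤ) →+ (Fin n → ℤ)) (l : Fin n → ℤ) :
    linSubst (Pi.basisFun ℤ (Fin n)) R w (linPoly (Pi.basisFun ℤ (Fin n)) R l) =
      linPoly (Pi.basisFun ℤ (Fin n)) R (w l) := by
  let φ : (Fin n → ℤ) →+ MvPolynomial (Fin n) R :=
    AddMonoidHom.mk' (linPoly (Pi.basisFun ℤ (Fin n)) R) (linPoly_add R _)
  change _ = φ (w l)
  conv_rhs => rw [← (Pi.basisFun ℤ (Fin n)).sum_repr l]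
  rw [map_sum, map_sum, linPoly, map_sum]
  refine Finset.sum_congr rfl fun i _ => ?_
  rw [map_zsmul, map_zsmul, map_mul, MvPolynomial.algHom_C, linSubst, MvPolynomial.aeval_X,
    zsmul_eq_mul]
  simp [φ]

lemma linSubst_linSubst_of_comp_eq (c : ℕ) {v w : (Fin n → ℤ) →+ (Fin n → ℤ)}
    (h : ∀ l, v (w l) = c • l) {d : ℕ} {p : MvPolynomial (Fin n) R} (hp : p.IsHomogeneous d) :
    linSubst (Pi.basisFun ℤ (Fin n)) R v (linSubst (Pi.basisFun ℤ (Fin n)) R w p) =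
      (c ^ d : R) • p := by
  have e : (linSubst (Pi.basisFun ℤ (Fin n)) R v).comp (linSubst (Pi.basisFun ℤ (Fin n)) R w) =
      MvPolynomial.aeval fun i => (c : R) • MvPolynomial.X i := by
    refine MvPolynomial.algHom_ext fun i => ?_
    rw [AlgHom.comp_apply, linSubst, linSubst, MvPolynomial.aeval_X, ← linSubst,
      linSubst_linPoly, h, MvPolynomial.aeval_X, linPoly, Finset.sum_eq_single i]
    · simp [MvPolynomial.smul_eq_C_mul]
    · intro j _ hj
      simp [hj]
    · simp
  rw [← AlgHom.comp_apply, e]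
  conv_lhs => rw [MvPolynomial.as_sum p, map_sum]
  conv_rhs => rw [MvPolynomial.as_sum p, Finset.smul_sum]
  refine Finset.sum_congr rfl fun m hm => ?_
  have hd : ∑ i ∈ m.support, m i = d := (hp.degree_eq_sum_deg_support hm).symm
  rw [MvPolynomial.aeval_monomial, MvPolynomial.monomial_eq, MvPolynomial.smul_eq_C_mul,
    Finsupp.prod, Finsupp.prod, ← hd, ← Finset.prod_pow_eq_pow_sum, map_prod,
    MvPolynomial.algebraMap_eq]
  simp only [MvPolynomial.smul_eq_C_mul, mul_pow, Finset.prod_mul_distrib, map_pow]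
  ring

variable {F : FormalGroup R} [F.IsComm]

/-- If the `r`-invariant forms in degrees up to `d` are polynomials in the `p k`, up to powers of
`a`, then an `r`-invariant element lies in the ideal generated by lifts of the `p k`, up to a power
of `a` and elements of order greater than `d`. -/
lemma exists_smul_sub_mem {r : Fin n → (Fin n → ℤ) →+ (Fin n → ℤ)} {K : ℕ}
    {p : ℕ → MvPolynomial (Fin n) R} {a : R} {d : ℕ} {e : ℕ → ℕ} {f : ℕ → FGA (Fin n → ℤ) F}
    (hinv : ∀ m ≠ 0, m ≤ d → ∀ q : MvPolynomial (Fin n) R, q.IsHomogeneous m →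
      (∀ i, linSubst (Pi.basisFun ℤ (Fin n)) R (r i) q = q) →
        ∃ M, a ^ M • q ∈ Algebra.adjoin R (p '' Set.Iio K))
    (hf : ∀ k < K, e k ≠ 0 ∧
      IsLead (augIdeal F) (coord (Pi.basisFun ℤ (Fin n)) F) (e k) (f k) (p k) ∧
        ∀ i, act F (r i) (f k) = f k)
    {u : FGA (Fin n → ℤ) F} (hu : u ∈ augIdeal F) (hu' : ∀ i, act F (r i) u = u) :
    ∃ M, ∃ v ∈ Ideal.span (f '' Set.Iio K), a ^ M • u - v ∈ augIdeal F ^ (d + 1) := by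
  have hc := isCoordinates (Pi.basisFun ℤ (Fin n)) F
  have hfI : ∀ k < K, f k ∈ augIdeal F := fun k hk => by
    have := Ideal.pow_le_pow_right (Nat.one_le_iff_ne_zero.2 (hf k hk).1) ((hf k hk).2.1.mem hc)
    rwa [pow_one] at this
  have hadj : ∀ v ∈ Algebra.adjoin R (f '' Set.Iio K), (∀ i, act F (r i) v = v) ∧
      v - algebraMap R _ (augF F v) ∈ Ideal.span (f '' Set.Iio K) := by
    intro v hv
    induction hv using Algebra.adjoin_induction with
    | mem v hv =>
      obtain ⟨k, hk, rfl⟩ := hv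
      refine ⟨(hf k hk).2.2, ?_⟩
      rw [(RingHom.mem_ker).1 (hfI k hk), map_zero, sub_zero]
      exact Ideal.subset_span ⟨k, hk, rfl⟩
    | algebraMap c =>
      refine ⟨fun i => AlgHom.commutes _ c, ?_⟩
      rw [AlgHom.commutes, Algebra.algebraMap_self_apply, sub_self]
      exact zero_mem _
    | add v w _ _ hv hw =>
      refine ⟨fun i => by rw [map_add, hv.1, hw.1], ?_⟩
      rw [map_add, map_add, add_sub_add_comm]
      exact add_mem hv.2 hw.2
    | mul v w _ _ hv hw =>
      refine ⟨fun i => by rw [map_mul, hv.1, hw.1], ?_⟩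
      rw [map_mul, map_mul, show v * w - algebraMap R _ (augF F v) * algebraMap R _ (augF F w) =
        (v - algebraMap R _ (augF F v)) * w +
          algebraMap R _ (augF F v) * (w - algebraMap R _ (augF F w)) by ring]
      exact add_mem (Ideal.mul_mem_right _ _ hv.2) (Ideal.mul_mem_left _ _ hw.2)
  suffices H : ∀ m ≤ d, ∃ M, ∃ v ∈ Ideal.span (f '' Set.Iio K), (∀ i, act F (r i) v = v) ∧
      a ^ M • u - v ∈ augIdeal F ^ (m + 1) by
    obtain ⟨M, v, hv, -, h⟩ := H d le_rfl
    exact ⟨M, v, hv, h⟩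
  intro m
  induction m with
  | zero =>
    refine fun _ => ⟨0, 0, zero_mem _, fun i => map_zero _, ?_⟩
    simpa using hu
  | succ m ih =>
    intro hm
    obtain ⟨M, v, hv, hv', h⟩ := ih (by omega)
    obtain ⟨q, hq⟩ := hc.exists_isLead h
    have hqi (i : Fin n) : linSubst (Pi.basisFun ℤ (Fin n)) R (r i) q = q := by
      have h1 := hq.act (Pi.basisFun ℤ (Fin n)) (r i)
      rw [map_sub, map_smul, hu', hv'] at h1
      exact h1.unique hc hq
    obtain ⟨M', hM'⟩ := hinv (m + 1) (by omega) hm q hq.1 hqi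
    obtain ⟨w, hw, hw'⟩ := exists_isLead_of_mem_adjoin hc (fun k hk => (hf k hk).2.1) hM'
      ((hq.smul (a ^ M')).1)
    obtain ⟨hw1, hw2⟩ := hadj w hw
    have hw3 : w ∈ augIdeal F := by
      have := Ideal.pow_le_pow_right (Nat.succ_pos m) (hw'.mem hc)
      rwa [pow_one] at this
    rw [(RingHom.mem_ker).1 hw3, map_zero, sub_zero] at hw2
    refine ⟨M + M', a ^ M' • v + w, ?_, fun i => by rw [map_add, map_smul, hv', hw1], ?_⟩
    · refine add_mem ?_ hw2
      rw [Algebra.smul_def]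
      exact Ideal.mul_mem_left _ _ hv
    · have h1 := (hq.smul (a ^ M')).sub hw'
      rw [sub_self] at h1
      have h2 := h1.mem_succ
      rwa [smul_sub, smul_smul, ← pow_add, add_comm M', sub_sub] at h2

/-- The main criterion. In suitable coordinates, suppose that the regular sequence of the `p k` lifts
to invariants for both formal group laws, and that it generates the invariant forms up to powers
of `a`. If multiplication by `N` removes the powers of `a` modulo the ideal of the `p k`, then
`N * c ^ d` is a multiple of the exponent. -/
theorem Realization.isExponentMultiple {A : Matrix (Fin n) (Fin n) ℤ} {c : ℕ}
    {r : Fin n → (Fin n → ℤ) →+ (Fin n → ℤ)} (ρ : Realization A c r)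
    {F' : FormalGroup R} [F'.IsComm] {K : ℕ} {p : ℕ → MvPolynomial (Fin n) R} {d : ℕ}
    (a : R) (N : ℕ)
    (hreg : ∀ k < K, ∀ q, q * p k ∈ Ideal.span (p '' Set.Iio k) → q ∈ Ideal.span (p '' Set.Iio k))
    (hF : HasInvariantLifts F r K p) (hF' : HasInvariantLifts F' r K p)
    (hinv : ∀ m ≠ 0, m ≤ d → ∀ q : MvPolynomial (Fin n) R, q.IsHomogeneous m →
      (∀ i, linSubst (Pi.basisFun ℤ (Fin n)) R (r i) q = q) →
        ∃ M, a ^ M • q ∈ Algebra.adjoin R (p '' Set.Iio K))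
    (hN : ∀ q : MvPolynomial (Fin n) R, q.IsHomogeneous d → ∀ M,
      a ^ M • q ∈ Ideal.span (p '' Set.Iio K) → (N : R) • q ∈ Ideal.span (p '' Set.Iio K)) :
    IsExponentMultiple (Pi.basisFun ℤ (Fin n)) (weylGroup A) F F' d (N * c ^ d) := by
  have hc := isCoordinates (Pi.basisFun ℤ (Fin n)) F
  have hc' := isCoordinates (Pi.basisFun ℤ (Fin n)) F'
  obtain ⟨e, f, hf⟩ := hF
  obtain ⟨e', f', hf'⟩ := hF'
  have hto (z : FGA (Fin n → ℤ) F') (hz : z ∈ invIdeal (weylGroup A) F') :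
      ∃ M, ∃ v ∈ Ideal.span (f' '' Set.Iio K), a ^ M • act F' ρ.toE z - v ∈
        augIdeal F' ^ (d + 1) := by
    induction hz using Submodule.span_induction with
    | mem u hu =>
      refine exists_smul_sub_mem hinv hf' (act_mem_augIdeal (Pi.basisFun ℤ (Fin n)) F' _ hu.2)
        fun i => ?_
      have h1 := hu.1 _ (simpleReflection_mem A ρ.diag i)
      conv_rhs => rw [← h1]
      rw [act_comp, act_comp]
      congr 2
      refine AddMonoidHom.ext fun v => ?_
      exact (ρ.toE_reflection i v).symm
    | zero => exact ⟨0, 0, zero_mem _, by simp⟩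
    | add y z _ _ hy hz =>
      obtain ⟨M, v, hv, h⟩ := hy
      obtain ⟨M', v', hv', h'⟩ := hz
      refine ⟨M + M', a ^ M' • v + a ^ M • v', ?_, ?_⟩
      · rw [Algebra.smul_def, Algebra.smul_def]
        exact add_mem (Ideal.mul_mem_left _ _ hv) (Ideal.mul_mem_left _ _ hv')
      · have h1 := add_mem (Ideal.mul_mem_left _ (algebraMap R _ (a ^ M')) h)
          (Ideal.mul_mem_left _ (algebraMap R _ (a ^ M)) h')
        rw [← Algebra.smul_def, ← Algebra.smul_def, smul_sub, smul_sub, smul_smul, smul_smul,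
          ← pow_add, ← pow_add, add_comm M' M, sub_add_sub_comm, ← smul_add, ← map_add] at h1
        exact h1
    | smul y z _ hz =>
      obtain ⟨M, v, hv, h⟩ := hz
      refine ⟨M, act F' ρ.toE y * v, Ideal.mul_mem_left _ _ hv, ?_⟩
      have h1 := Ideal.mul_mem_left _ (act F' ρ.toE y) h
      rwa [mul_sub, mul_smul_comm, ← map_mul] at h1
  have hfrom (z : FGA (Fin n → ℤ) F) (hz : z ∈ Ideal.span (f '' Set.Iio K)) :
      act F ρ.ofE z ∈ invIdeal (weylGroup A) F := by
    have hle : Ideal.span (f '' Set.Iio K) ≤ (invIdeal (weylGroup A) F).comap (act F ρ.ofE) := by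
      rw [Ideal.span_le]
      rintro _ ⟨k, hk, rfl⟩
      refine Ideal.subset_span ⟨?_, ?_⟩
      · have hgen (s : (Fin n → ℤ) ≃ₗ[ℤ] (Fin n → ℤ)) (i : Fin n) (hs : ∀ v, s v = v - v i • A i) :
            act F s.toLinearMap.toAddMonoidHom (act F ρ.ofE (f k)) = act F ρ.ofE (f k) := by
          conv_rhs => rw [← (hf k hk).2.2 i]
          rw [act_comp, act_comp]
          congr 2
          refine AddMonoidHom.ext fun v => ?_
          exact (hs _).trans (ρ.ofE_reflection i v)
        have hone (z : FGA (Fin n → ℤ) F) (s : (Fin n → ℤ) →+ (Fin n → ℤ)) (hs : ∀ v, s v = v)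
            (hz : ∃ y w, z = act F w y) : act F s z = z := by
          obtain ⟨y, w, rfl⟩ := hz
          rw [act_comp]
          congr 2
          refine AddMonoidHom.ext fun v => ?_
          exact hs _
        intro w hw
        induction hw using Subgroup.closure_induction with
        | mem s hs =>
          obtain ⟨i, hs⟩ := hs
          exact hgen s i hs
        | one => exact hone _ _ (fun _ => rfl) ⟨_, _, rfl⟩
        | mul s t _ _ hs ht =>
          have h1 := act_comp F s.toLinearMap.toAddMonoidHom t.toLinearMap.toAddMonoidHom
            (act F ρ.ofE (f k))
          rw [ht, hs] at h1
          exact h1.symm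
        | inv s _ hs =>
          conv_lhs => rw [← hs]
          rw [act_comp]
          refine hone _ _ (fun v => ?_) ⟨_, _, rfl⟩
          exact s.symm_apply_apply v
      · refine act_mem_augIdeal (Pi.basisFun ℤ (Fin n)) F _ ?_
        have := Ideal.pow_le_pow_right (Nat.one_le_iff_ne_zero.2 (hf k hk).1)
          ((hf k hk).2.1.mem hc)
        rwa [pow_one] at this
    exact hle hz
  rintro z' ⟨hz1, hz2⟩
  obtain ⟨q, hq⟩ := hc'.exists_isLead hz2
  obtain ⟨M, v, hv, hvM⟩ := hto z' hz1
  have hqE := hq.act (Pi.basisFun ℤ (Fin n)) ρ.toE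
  have h1 := mem_span_of_isLead hc' hreg (fun k hk => (hf' k hk).2.1) hv
    ((hqE.smul (a ^ M)).congr hvM)
  have h2 := hN _ hqE.1 M h1
  obtain ⟨y, hy, hy'⟩ := exists_isLead_of_mem_span hc (fun k hk => (hf k hk).2.1) h2
    (hqE.smul (N : R)).1
  have h3 := hy'.act (Pi.basisFun ℤ (Fin n)) ρ.ofE
  refine ⟨act F ρ.ofE y, ⟨hfrom y hy, h3.mem hc⟩, ?_⟩
  rw [map_smul, linSubst_linSubst_of_comp_eq c ρ.ofE_toE hq.1, smul_smul] at h3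
  have h4 := (hq.smul ((N * c ^ d : ℕ) : R)).sub (h3.deform (Pi.basisFun ℤ (Fin n)) F')
  rw [Nat.cast_mul, Nat.cast_pow, sub_self] at h4
  have h5 := h4.mem_succ
  rwa [← Nat.cast_pow, ← Nat.cast_mul, Nat.cast_smul_eq_nsmul] at h5

end Transfer

/-! ### Regularity of the elementary symmetric polynomials -/

section Regular

open Polynomial in
/-- If `a` is a nonzerodivisor modulo `J`, it is one modulo the ideal generated by `J` and a monic
polynomial in a new variable, since the quotient is free over the old one. -/
lemma mem_sup_span_monic {A : Type*} [CommRing A] {J : Ideal A} {a : A}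
    (ha : ∀ q, q * a ∈ J → q ∈ J) {g : A[X]} (hg : g.Monic) {q : A[X]}
    (hq : q * C a ∈ J.map C ⊔ Ideal.span {g}) : q ∈ J.map C ⊔ Ideal.span {g} := by
  obtain ⟨y, hy, z, hz, e⟩ := Submodule.mem_sup.1 hq
  obtain ⟨u, rfl⟩ := Ideal.mem_span_singleton'.1 hz
  set φ := mapRingHom (Ideal.Quotient.mk J)
  have hφ (p : A[X]) : φ p = 0 ↔ p ∈ J.map C := by
    rw [← RingHom.mem_ker, ker_mapRingHom, Ideal.mk_ker]
  have hg' : (φ g).Monic := hg.map _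
  have ha' (b : A ⧸ J) (hb : b * Ideal.Quotient.mk J a = 0) : b = 0 := by
    obtain ⟨b, rfl⟩ := Ideal.Quotient.mk_surjective b
    rw [← map_mul, Ideal.Quotient.eq_zero_iff_mem] at hb
    exact Ideal.Quotient.eq_zero_iff_mem.2 (ha b hb)
  have e1 : φ q * φ (C a) = φ u * φ g := by
    rw [← map_mul, ← map_mul, ← e, map_add, (hφ y).2 hy, zero_add]
  have e2 : φ q %ₘ φ g * C (Ideal.Quotient.mk J a) = φ g * (φ u - φ q /ₘ φ g * φ (C a)) := by
    have := modByMonic_add_div (φ q) (φ g)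
    rw [mul_sub, mul_comm (φ g) (φ u), ← e1]
    nth_rw 2 [← this]
    rw [show φ (C a) = C (Ideal.Quotient.mk J a) by simp [φ]]
    ring
  have hr : φ q %ₘ φ g = 0 := by
    by_contra hne
    have hnt : Nontrivial (A ⧸ J) := ⟨⟨_, _, leadingCoeff_ne_zero.2 hne⟩⟩
    have h0 : φ q %ₘ φ g * C (Ideal.Quotient.mk J a) = 0 := by
      by_contra h0
      have h1 : φ u - φ q /ₘ φ g * φ (C a) ≠ 0 := by
        intro h1
        rw [h1, mul_zero] at e2
        exact h0 e2
      have h2 := degree_modByMonic_lt (φ q) hg'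
      have h3 : (φ q %ₘ φ g * C (Ideal.Quotient.mk J a)).degree ≤ (φ q %ₘ φ g).degree := by
        exact (degree_mul_le _ _).trans (add_le_of_nonpos_right degree_C_le)
      rw [e2, mul_comm, hg'.degree_mul] at h3
      have h4 : (φ g).degree ≤ (φ u - φ q /ₘ φ g * φ (C a)).degree + (φ g).degree :=
        le_add_of_nonneg_left (zero_le_degree_iff.2 h1)
      exact absurd (h4.trans h3) (not_le.2 h2)
    refine hne (Polynomial.ext fun i => ?_)
    rw [coeff_zero]
    refine ha' _ ?_
    rw [← coeff_mul_C, h0, coeff_zero]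
  obtain ⟨w, hw⟩ : ∃ w, φ w = φ q /ₘ φ g := map_surjective _ Ideal.Quotient.mk_surjective _
  have h5 : φ (q - w * g) = 0 := by
    have := modByMonic_add_div (φ q) (φ g)
    rw [hr, zero_add] at this
    rw [map_sub, map_mul, hw, mul_comm, this, sub_self]
  rw [← sub_add_cancel q (w * g)]
  exact add_mem (Ideal.mem_sup_left ((hφ _).1 h5))
    (Ideal.mem_sup_right (Ideal.mul_mem_left _ _ (Ideal.mem_span_singleton_self g)))

section Series

variable {S : Type*} [CommRing S]

/-- The generating series `∏ (1 - z_i T)` of the elementary symmetric polynomials in the `-z_i`. -/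
def elemSeries {κ : Type*} [Fintype κ] (z : κ → S) : PowerSeries S :=
  ∏ i, (1 + PowerSeries.C (-z i) * PowerSeries.X)

/-- The generating series `∏ (1 - z_i T)⁻¹` of the complete homogeneous symmetric polynomials. -/
def complSeries {κ : Type*} [Fintype κ] (z : κ → S) : PowerSeries S :=
  ∏ i, PowerSeries.mk fun k => z i ^ k

lemma one_sub_mul_mk_pow (a : S) :
    (1 + PowerSeries.C (-a) * PowerSeries.X) * PowerSeries.mk (fun k => a ^ k) = 1 := by
  ext k
  rw [add_mul, one_mul, mul_assoc, map_add, PowerSeries.coeff_C_mul]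
  cases k with
  | zero => simp
  | succ k =>
    rw [PowerSeries.coeff_succ_X_mul]
    simp [PowerSeries.coeff_one]
    ring

lemma elemSeries_mul_complSeries {κ : Type*} [Fintype κ] (z : κ → S) :
    elemSeries z * complSeries z = 1 := by
  rw [elemSeries, complSeries, ← Finset.prod_mul_distrib]
  exact Finset.prod_eq_one fun i _ => one_sub_mul_mk_pow _

lemma coeff_elemSeries {R : Type*} [CommRing R] [Algebra R S] {κ : Type*} [Fintype κ] (z : κ → S)
    (k : ℕ) : PowerSeries.coeff k (elemSeries z) =
      MvPolynomial.aeval (fun i => -z i) (MvPolynomial.esymm κ R k) := by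
  classical
  rw [elemSeries, Finset.prod_one_add, map_sum, MvPolynomial.esymm, map_sum]
  simp_rw [Finset.prod_mul_distrib, Finset.prod_const, ← map_prod, PowerSeries.coeff_C_mul,
    PowerSeries.coeff_X_pow, map_prod, MvPolynomial.aeval_X]
  rw [Finset.powersetCard_eq_filter, Finset.sum_filter]
  simp [eq_comm]

lemma coeff_complSeries_cons {N : ℕ} (z : Fin (N + 1) → S) (k : ℕ) :
    PowerSeries.coeff (k + 1) (complSeries z) =
      PowerSeries.coeff (k + 1) (complSeries fun i => z (Fin.succ i)) +
        z 0 * PowerSeries.coeff k (complSeries z) := by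
  have h : (1 + PowerSeries.C (-z 0) * PowerSeries.X) * complSeries z =
      complSeries fun i => z (Fin.succ i) := by
    rw [complSeries, Fin.prod_univ_succ, ← mul_assoc, one_sub_mul_mk_pow, one_mul, complSeries]
  rw [← h, add_mul, one_mul, mul_assoc, map_add, PowerSeries.coeff_C_mul,
    PowerSeries.coeff_succ_X_mul]
  ring

/-- The coefficients of mutually inverse power series agree up to sign modulo the previous ones. -/
lemma coeff_add_coeff_mem {E H : PowerSeries S} (h : E * H = 1)
    (hE : PowerSeries.coeff 0 E = 1) (hH : PowerSeries.coeff 0 H = 1) (k : ℕ) :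
    PowerSeries.coeff (k + 1) E + PowerSeries.coeff (k + 1) H ∈
      Ideal.span ((fun j => PowerSeries.coeff (j + 1) H) '' Set.Iio k) := by
  have h1 := congrArg (PowerSeries.coeff (k + 1)) h
  rw [PowerSeries.coeff_mul, Finset.Nat.sum_antidiagonal_eq_sum_range_succ_mk,
    Finset.sum_range_succ, Finset.sum_range_succ', PowerSeries.coeff_one, if_neg (by omega),
    Nat.sub_self, Nat.sub_zero, hE, hH, one_mul, mul_one] at h1
  have h2 : ∑ i ∈ Finset.range k, PowerSeries.coeff (i + 1) E *
      PowerSeries.coeff (k + 1 - (i + 1)) H ∈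
        Ideal.span ((fun j => PowerSeries.coeff (j + 1) H) '' Set.Iio k) := by
    refine Ideal.sum_mem _ fun i hi => Ideal.mul_mem_left _ _ (Ideal.subset_span ?_)
    have := Finset.mem_range.1 hi
    exact ⟨k - i - 1, by simp only [Set.mem_Iio]; omega, by
      dsimp only
      congr 2
      omega⟩
  rw [← neg_mem_iff]
  convert h2 using 1
  linear_combination -h1

lemma span_coeff_eq {E H : PowerSeries S} (h : E * H = 1)
    (hE : PowerSeries.coeff 0 E = 1) (hH : PowerSeries.coeff 0 H = 1) (k : ℕ) :
    Ideal.span ((fun j => PowerSeries.coeff (j + 1) E) '' Set.Iio k) =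
      Ideal.span ((fun j => PowerSeries.coeff (j + 1) H) '' Set.Iio k) := by
  have key (k : ℕ) (E H : PowerSeries S) (h : E * H = 1)
      (hE : PowerSeries.coeff 0 E = 1) (hH : PowerSeries.coeff 0 H = 1) :
      Ideal.span ((fun j => PowerSeries.coeff (j + 1) E) '' Set.Iio k) ≤
      Ideal.span ((fun j => PowerSeries.coeff (j + 1) H) '' Set.Iio k) := by
    rw [Ideal.span_le]
    rintro _ ⟨j, hj, rfl⟩
    have h1 := Ideal.span_mono (Set.image_mono (Set.Iio_subset_Iio (le_of_lt hj)))
      (coeff_add_coeff_mem h hE hH j)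
    have h2 : PowerSeries.coeff (j + 1) H ∈
        Ideal.span ((fun j => PowerSeries.coeff (j + 1) H) '' Set.Iio k) :=
      Ideal.subset_span ⟨j, hj, rfl⟩
    simpa using sub_mem h1 h2
  exact le_antisymm (key k E H h hE hH) (key k H E (mul_comm E H ▸ h) hH hE)

/-- The complete homogeneous symmetric polynomials in the `z i`, starting from any positive degree,
form a regular sequence of as many members as there are `z i`. -/
def IsComplRegular {N : ℕ} (z : Fin N → S) : Prop :=
  ∀ m ≠ 0, ∀ k < N, ∀ q, q * PowerSeries.coeff (m + k) (complSeries z) ∈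
    Ideal.span ((fun j => PowerSeries.coeff (m + j) (complSeries z)) '' Set.Iio k) →
      q ∈ Ideal.span ((fun j => PowerSeries.coeff (m + j) (complSeries z)) '' Set.Iio k)

lemma coeff_complSeries_map {S' : Type*} [CommRing S'] (f : S →+* S') {N : ℕ} (z : Fin N → S)
    (k : ℕ) : PowerSeries.coeff k (complSeries fun i => f (z i)) =
      f (PowerSeries.coeff k (complSeries z)) := by
  have h : (complSeries fun i => f (z i)) = PowerSeries.map f (complSeries z) := by
    rw [complSeries, complSeries, map_prod]
    refine Finset.prod_congr rfl fun i _ => ?_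
    ext k
    simp
  rw [h, PowerSeries.coeff_map]

lemma coeff_zero_complSeries {κ : Type*} [Fintype κ] (z : κ → S) :
    PowerSeries.coeff 0 (complSeries z) = 1 := by
  simp [complSeries, map_prod]

lemma coeff_zero_elemSeries {κ : Type*} [Fintype κ] (z : κ → S) :
    PowerSeries.coeff 0 (elemSeries z) = 1 := by
  simp [elemSeries, map_prod]

lemma IsComplRegular.map_equiv {S' : Type*} [CommRing S'] {N : ℕ} {z : Fin N → S}
    (hz : IsComplRegular z) (f : S ≃+* S') : IsComplRegular fun i => f (z i) := by
  have h (k m : ℕ) : Ideal.span ((fun j => PowerSeries.coeff (m + j)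
      (complSeries fun i => f (z i))) '' Set.Iio k) = (Ideal.span ((fun j =>
        PowerSeries.coeff (m + j) (complSeries z)) '' Set.Iio k)).map (f : S →+* S') := by
    rw [Ideal.map_span, ← Set.image_comp]
    congr 1
    refine Set.image_congr fun j _ => ?_
    exact coeff_complSeries_map (f : S →+* S') z _
  intro m hm k hk q hq
  obtain ⟨q, rfl⟩ := f.surjective q
  have h1 := coeff_complSeries_map (f : S →+* S') z (m + k)
  rw [RingEquiv.coe_toRingHom] at h1
  rw [h, h1, ← map_mul] at hq
  rw [h]
  have h2 (y : S) (I : Ideal S) : f y ∈ I.map (f : S →+* S') ↔ y ∈ I := by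
    rw [Ideal.map_comap_of_equiv f]
    simp
  rw [h2] at hq ⊢
  exact hz m hm k hk q hq

open Polynomial in
/-- Adding a new variable: the complete homogeneous symmetric polynomials are monic in it, and modulo
the first of them the others can be replaced by those without the new variable. -/
lemma IsComplRegular.cons {N : ℕ} {z : Fin N → S} (hz : IsComplRegular z) {r : ℕ} (hr : r ≠ 0) :
    IsComplRegular (Fin.cons (X ^ r) (fun i => C (z i)) : Fin (N + 1) → S[X]) := by
  set Z : Fin (N + 1) → S[X] := Fin.cons (X ^ r) (fun i => C (z i)) with hZ
  set H : ℕ → S[X] := fun k => PowerSeries.coeff k (complSeries Z) with hH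
  set h : ℕ → S := fun k => PowerSeries.coeff k (complSeries z) with hh
  have hrec (k : ℕ) : H (k + 1) = C (h (k + 1)) + X ^ r * H k := by
    have h1 := coeff_complSeries_cons Z k
    have h2 : (fun i : Fin N => Z i.succ) = fun i => C (z i) := by
      funext i
      simp [hZ]
    rw [h2, coeff_complSeries_map C] at h1
    exact h1
  have hmonic (k : ℕ) : (H k).Monic := by
    nontriviality S
    induction k with
    | zero => rw [hH]; simp only [coeff_zero_complSeries]; exact monic_one
    | succ k ih =>
      rw [hrec, add_comm]
      have h1 : (X ^ r * H k).Monic := (monic_X_pow r).mul ih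
      refine h1.add_of_left (degree_C_le.trans_lt ?_)
      rw [ih.degree_mul, degree_X_pow]
      have h2 : (0 : WithBot ℕ) ≤ (H k).degree := zero_le_degree_iff.2 ih.ne_zero
      have h3 : (0 : WithBot ℕ) < (r : WithBot ℕ) := by exact_mod_cast Nat.pos_of_ne_zero hr
      exact add_pos_of_pos_of_nonneg h3 h2
  intro m hm k hk q hq
  change q * H (m + k) ∈ Ideal.span ((fun j => H (m + j)) '' Set.Iio k) at hq
  change q ∈ Ideal.span ((fun j => H (m + j)) '' Set.Iio k)
  cases k with
  | zero =>
    have hi : Set.Iio 0 = (∅ : Set ℕ) := by ext; simp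
    simp only [hi, Set.image_empty, Ideal.span_empty, Ideal.mem_bot] at hq ⊢
    exact (mul_right_mem_nonZeroDivisors_eq_zero_iff (hmonic _).mem_nonZeroDivisors).1 hq
  | succ k =>
    have hI : Ideal.span ((fun j => H (m + j)) '' Set.Iio (k + 1)) =
        (Ideal.span ((fun j => h (m + 1 + j)) '' Set.Iio k)).map C ⊔ Ideal.span {H m} := by
      refine le_antisymm (Ideal.span_le.2 ?_) (sup_le ?_ ?_)
      · rintro _ ⟨j, hj, rfl⟩
        simp only [SetLike.mem_coe]
        induction j with
        | zero => exact Ideal.mem_sup_right (Ideal.mem_span_singleton_self _)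
        | succ j ih =>
          rw [← add_assoc, hrec]
          refine add_mem (Ideal.mem_sup_left (Ideal.mem_map_of_mem _ (Ideal.subset_span ⟨j, ?_, ?_⟩)))
            (Ideal.mul_mem_left _ _ (ih ?_))
          · simpa using hj
          · dsimp only
            congr 1
            ring
          · exact (Nat.lt_succ_self j).trans hj
      · rw [Ideal.map_span, Ideal.span_le]
        rintro _ ⟨_, ⟨j, hj, rfl⟩, rfl⟩
        have h1 := hrec (m + j)
        rw [eq_comm, ← eq_sub_iff_add_eq] at h1
        have e : m + 1 + j = m + j + 1 := by ring
        rw [SetLike.mem_coe]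
        dsimp only
        rw [e, h1]
        refine sub_mem (Ideal.subset_span ⟨j + 1, ?_, rfl⟩)
          (Ideal.mul_mem_left _ _ (Ideal.subset_span ⟨j, ?_, rfl⟩))
        · simpa using hj
        · exact lt_trans hj (Nat.lt_succ_self k)
      · rw [Ideal.span_le, Set.singleton_subset_iff]
        exact Ideal.subset_span ⟨0, Nat.succ_pos k, rfl⟩
    have hmem : q * (X ^ r * H (m + k)) ∈ Ideal.span ((fun j => H (m + j)) '' Set.Iio (k + 1)) :=
      Ideal.mul_mem_left _ _ (Ideal.mul_mem_left _ _
        (Ideal.subset_span ⟨k, Nat.lt_succ_self k, rfl⟩))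
    have h3 := sub_mem hq hmem
    rw [← add_assoc, hrec, ← mul_sub, add_sub_cancel_right, hI] at h3
    rw [hI]
    refine mem_sup_span_monic (fun q hq => ?_) (hmonic m) h3
    have e : m + k + 1 = m + 1 + k := by ring
    rw [e] at hq
    exact hz (m + 1) (by omega) k (by omega) q hq

end Series

/-- The powers `X_i ^ r` of the variables: their complete homogeneous symmetric polynomials are
regular sequences. -/
lemma isComplRegular_X_pow (R : Type*) [CommRing R] {r : ℕ} (hr : r ≠ 0) (N : ℕ) :
    IsComplRegular fun i : Fin N => (MvPolynomial.X i ^ r : MvPolynomial (Fin N) R) := by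
  induction N with
  | zero => exact fun _ _ k hk => absurd hk (Nat.not_lt_zero k)
  | succ N ih =>
    have h1 := (ih.cons hr).map_equiv (MvPolynomial.finSuccEquiv R N).symm.toRingEquiv
    convert h1 using 2 with i
    rw [eq_comm]
    refine (MvPolynomial.finSuccEquiv R N).symm_apply_eq.2 ?_
    refine Fin.cases ?_ (fun i => ?_) i
    · simp [MvPolynomial.finSuccEquiv_X_zero]
    · simp [MvPolynomial.finSuccEquiv_X_succ]

/-- The elementary symmetric polynomials in the `-X_i ^ r` form a regular sequence. -/
theorem mem_span_esymm_of_mul_mem (R : Type*) [CommRing R] {r : ℕ} (hr : r ≠ 0) {N k : ℕ}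
    (hk : k < N) {p : ℕ → MvPolynomial (Fin N) R} (hp : ∀ j, p j =
      MvPolynomial.aeval (fun i => -MvPolynomial.X i ^ r) (MvPolynomial.esymm (Fin N) R (j + 1)))
    {q : MvPolynomial (Fin N) R} (hq : q * p k ∈ Ideal.span (p '' Set.Iio k)) :
    q ∈ Ideal.span (p '' Set.Iio k) := by
  set z : Fin N → MvPolynomial (Fin N) R := fun i => MvPolynomial.X i ^ r
  have hp' : p = fun j => PowerSeries.coeff (j + 1) (elemSeries z) := by
    funext j
    rw [hp, coeff_elemSeries (R := R)]
  have h1 := span_coeff_eq (elemSeries_mul_complSeries z) (coeff_zero_elemSeries z)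
    (coeff_zero_complSeries z) k
  have h2 := coeff_add_coeff_mem (elemSeries_mul_complSeries z) (coeff_zero_elemSeries z)
    (coeff_zero_complSeries z) k
  have h3 := isComplRegular_X_pow R hr N 1 one_ne_zero k hk q
  simp only [add_comm 1] at h3
  rw [hp', h1] at hq ⊢
  refine h3 ?_
  have h4 := sub_mem (Ideal.mul_mem_left _ q h2) hq
  rwa [mul_add, add_sub_cancel_left] at h4

end Regular

/-! ### Invariants of signed permutations -/

section Symmetric

variable {R : Type*} [CommRing R] {n : ℕ}

lemma aeval_neg_esymm {S : Type*} [CommRing S] [Algebra R S] {κ : Type*} [Fintype κ] (z : κ → S)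
    (k : ℕ) : MvPolynomial.aeval (fun i => -z i) (MvPolynomial.esymm κ R k) =
      (-1) ^ k * MvPolynomial.aeval z (MvPolynomial.esymm κ R k) := by
  rw [MvPolynomial.esymm, map_sum, map_sum, Finset.mul_sum]
  refine Finset.sum_congr rfl fun t ht => ?_
  rw [map_prod, map_prod, ← (Finset.mem_powersetCard.1 ht).2]
  simp [Finset.prod_neg]

lemma isSymmetric_of_swap {q : MvPolynomial (Fin n) R}
    (h : ∀ i j : Fin n, (i : ℕ) + 1 = j → MvPolynomial.rename (Equiv.swap i j) q = q) :
    q.IsSymmetric := by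
  cases n with
  | zero => exact fun σ => by rw [Subsingleton.elim σ 1]; exact MvPolynomial.rename_id_apply q
  | succ n =>
    intro σ
    have hσ : σ ∈ Submonoid.closure (Set.range fun i : Fin n => Equiv.swap i.castSucc i.succ) := by
      rw [Equiv.Perm.mclosure_swap_castSucc_succ]
      trivial
    induction hσ using Submonoid.closure_induction with
    | mem σ hσ =>
      obtain ⟨i, rfl⟩ := hσ
      exact h _ _ (by simp)
    | one => exact MvPolynomial.rename_id_apply q
    | mul σ τ _ _ hs ht =>
      rw [Equiv.Perm.coe_mul, ← MvPolynomial.rename_rename, ht, hs]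

/-- The fundamental theorem of symmetric polynomials. -/
lemma mem_adjoin_of_isSymmetric {q : MvPolynomial (Fin n) R} (hq : q.IsSymmetric) :
    q ∈ Algebra.adjoin R ((fun k => MvPolynomial.esymm (Fin n) R (k + 1)) '' Set.Iio n) := by
  obtain ⟨g, hg⟩ := MvPolynomial.esymmAlgHom_surjective R (σ := Fin n) (n := n) (by simp) ⟨q, hq⟩
  have h1 := congrArg Subtype.val hg
  rw [MvPolynomial.esymmAlgHom_apply] at h1
  change _ = q at h1
  rw [← h1]
  clear hg h1
  induction g using MvPolynomial.induction_on with
  | C a =>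
    rw [MvPolynomial.algHom_C]
    exact Subalgebra.algebraMap_mem _ a
  | add a b ha hb =>
    rw [map_add]
    exact add_mem ha hb
  | mul_X a i ha =>
    rw [map_mul, MvPolynomial.aeval_X]
    exact mul_mem ha (Algebra.subset_adjoin ⟨i, i.2, rfl⟩)

lemma expand_mem_adjoin {a : MvPolynomial (Fin n) R} (ha : a.IsSymmetric) :
    MvPolynomial.expand 2 a ∈ Algebra.adjoin R ((fun k => MvPolynomial.aeval
      (fun i => -MvPolynomial.X i ^ 2 : Fin n → MvPolynomial (Fin n) R)
        (MvPolynomial.esymm (Fin n) R (k + 1))) '' Set.Iio n) := by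
  have h : MvPolynomial.expand 2 a ∈ Subalgebra.map (MvPolynomial.expand 2) _ :=
    Subalgebra.mem_map.2 ⟨a, mem_adjoin_of_isSymmetric ha, rfl⟩
  rw [AlgHom.map_adjoin] at h
  refine Algebra.adjoin_le ?_ h
  rintro _ ⟨_, ⟨k, hk, rfl⟩, rfl⟩
  have e : MvPolynomial.expand 2 (MvPolynomial.esymm (Fin n) R (k + 1)) =
      (-1 : R) ^ (k + 1) • MvPolynomial.aeval
      (fun i => -MvPolynomial.X i ^ 2 : Fin n → MvPolynomial (Fin n) R)
        (MvPolynomial.esymm (Fin n) R (k + 1)) := by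
    rw [aeval_neg_esymm (R := R), MvPolynomial.smul_eq_C_mul, ← mul_assoc]
    simp only [map_pow, map_neg, map_one]
    rw [← mul_pow, neg_mul_neg, one_mul, one_pow, one_mul]
    rfl
  change MvPolynomial.expand 2 (MvPolynomial.esymm (Fin n) R (k + 1)) ∈ _
  rw [e]
  refine Subalgebra.smul_mem _ (Algebra.subset_adjoin ?_) _
  exact ⟨k, hk, rfl⟩

lemma coeff_aeval_C_mul_X (c : Fin n → R) (q : MvPolynomial (Fin n) R) (m : Fin n →₀ ℕ) :
    MvPolynomial.coeff m (MvPolynomial.aeval (fun i => MvPolynomial.C (c i) * MvPolynomial.X i) q) =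
      (∏ i, c i ^ m i) * MvPolynomial.coeff m q := by
  classical
  conv_lhs => rw [MvPolynomial.as_sum q]
  conv_rhs => rw [MvPolynomial.as_sum q]
  rw [map_sum, MvPolynomial.coeff_sum, MvPolynomial.coeff_sum, Finset.mul_sum]
  refine Finset.sum_congr rfl fun s _ => ?_
  have e : MvPolynomial.aeval (fun i => MvPolynomial.C (c i) * MvPolynomial.X i)
      (MvPolynomial.monomial s (MvPolynomial.coeff s q)) =
      MvPolynomial.monomial s ((∏ i, c i ^ s i) * MvPolynomial.coeff s q) := by
    rw [MvPolynomial.aeval_monomial, MvPolynomial.monomial_eq, Finsupp.prod_fintype _ _ (by simp),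
      Finsupp.prod_fintype _ _ (by simp), MvPolynomial.algebraMap_eq]
    simp only [mul_pow, Finset.prod_mul_distrib, map_mul, map_prod, map_pow]
    ring
  rw [e, MvPolynomial.coeff_monomial, MvPolynomial.coeff_monomial]
  split_ifs with h
  · rw [h]
  · rw [mul_zero]

lemma coeff_comp_of_isSymmetric {q : MvPolynomial (Fin n) R} (hq : q.IsSymmetric)
    (σ : Equiv.Perm (Fin n)) (m : Fin n →₀ ℕ) :
    MvPolynomial.coeff (m.mapDomain σ) q = MvPolynomial.coeff m q := by
  conv_lhs => rw [← hq σ]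
  exact MvPolynomial.coeff_rename_mapDomain σ σ.injective q m

lemma eq_zero_of_neg_one_pow_mul (h2 : ∀ r : R, 2 * r = 0 → r = 0) {k : ℕ} (hk : Odd k) {a : R}
    (h : (-1) ^ k * a = a) : a = 0 := by
  rw [hk.neg_one_pow] at h
  exact h2 a (by linear_combination -h)

lemma prod_X_eq_monomial :
    (∏ i, MvPolynomial.X i : MvPolynomial (Fin n) R) =
      MvPolynomial.monomial (Finsupp.equivFunOnFinite.symm fun _ => 1) 1 := by
  rw [MvPolynomial.monomial_eq, Finsupp.prod_fintype _ _ (by simp)]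
  simp

lemma isRegular_prod_X : IsRegular (∏ i, MvPolynomial.X i : MvPolynomial (Fin n) R) := by
  rw [isRegular_iff_mem_nonZeroDivisors]
  exact prod_mem fun i _ => isRegular_iff_mem_nonZeroDivisors.1 MvPolynomial.isRegular_X

lemma expand_add_prod_X_mul_inj (hn : n ≠ 0) {a b a' b' : MvPolynomial (Fin n) R}
    (h : MvPolynomial.expand 2 a + (∏ i, MvPolynomial.X i) * MvPolynomial.expand 2 b =
      MvPolynomial.expand 2 a' + (∏ i, MvPolynomial.X i) * MvPolynomial.expand 2 b') :
    a = a' ∧ b = b' := by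
  have h0 (m : Fin n →₀ ℕ) (b : MvPolynomial (Fin n) R) :
      MvPolynomial.coeff (2 • m) ((∏ i, MvPolynomial.X i) * MvPolynomial.expand 2 b) = 0 := by
    rw [prod_X_eq_monomial, MvPolynomial.coeff_monomial_mul']
    split_ifs with h
    · have h1 := h ⟨0, Nat.pos_of_ne_zero hn⟩
      rw [MvPolynomial.coeff_expand_of_not_dvd (i := ⟨0, Nat.pos_of_ne_zero hn⟩), mul_zero]
      simp only [Finsupp.coe_tsub, Finsupp.coe_smul, Pi.sub_apply, Pi.smul_apply, smul_eq_mul,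
        Finsupp.equivFunOnFinite_symm_apply_apply] at h1 ⊢
      omega
    · rfl
  have ha : a = a' := by
    ext m
    have h1 := congrArg (MvPolynomial.coeff (2 • m)) h
    rwa [MvPolynomial.coeff_add, MvPolynomial.coeff_add, h0, h0, add_zero, add_zero,
      MvPolynomial.coeff_expand_smul _ two_ne_zero, MvPolynomial.coeff_expand_smul _ two_ne_zero]
        at h1
  subst ha
  exact ⟨rfl, MvPolynomial.expand_injective two_pos (isRegular_prod_X.left (add_left_cancel h))⟩

lemma monomial_eq_expand {m : Fin n →₀ ℕ} (hm : ∀ i, Even (m i)) (c : R) :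
    ∃ a, MvPolynomial.monomial m c = MvPolynomial.expand 2 a := by
  choose s hs using hm
  refine ⟨MvPolynomial.monomial (Finsupp.equivFunOnFinite.symm s) c, ?_⟩
  have h : m = 2 • Finsupp.equivFunOnFinite.symm s := by
    ext i
    simp [hs, two_mul]
  rw [MvPolynomial.expand_monomial, ← h]

lemma monomial_eq_prod_X_mul_expand {m : Fin n →₀ ℕ} (hm : ∀ i, Odd (m i)) (c : R) :
    ∃ a, MvPolynomial.monomial m c = (∏ i, MvPolynomial.X i) * MvPolynomial.expand 2 a := by
  choose s hs using hm
  refine ⟨MvPolynomial.monomial (Finsupp.equivFunOnFinite.symm s) c, ?_⟩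
  have h : m = Finsupp.equivFunOnFinite.symm (fun _ => 1) + 2 • Finsupp.equivFunOnFinite.symm s := by
    ext i
    simp [hs, add_comm]
  rw [MvPolynomial.expand_monomial, prod_X_eq_monomial, MvPolynomial.monomial_mul, one_mul, ← h]

/-- A symmetric polynomial whose monomials have only even or only odd exponents is `a + (∏ X_i) b`
with symmetric polynomials `a` and `b` in the `X_i ^ 2`. -/
lemma exists_eq_expand_add (hn : n ≠ 0) {q : MvPolynomial (Fin n) R} (hq : q.IsSymmetric)
    (hm : ∀ m ∈ q.support, (∀ i, Even (m i)) ∨ ∀ i, Odd (m i)) :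
    ∃ a b, a.IsSymmetric ∧ b.IsSymmetric ∧
      q = MvPolynomial.expand 2 a + (∏ i, MvPolynomial.X i) * MvPolynomial.expand 2 b := by
  obtain ⟨a, b, e⟩ : ∃ a b, q =
      MvPolynomial.expand 2 a + (∏ i, MvPolynomial.X i) * MvPolynomial.expand 2 b := by
    rw [MvPolynomial.as_sum q]
    refine Finset.sum_induction _ (fun p => ∃ a b, p = MvPolynomial.expand 2 a +
      (∏ i, MvPolynomial.X i) * MvPolynomial.expand 2 b) ?_ ⟨0, 0, by simp⟩ fun m hm' => ?_
    · rintro _ _ ⟨a, b, rfl⟩ ⟨a', b', rfl⟩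
      exact ⟨a + a', b + b', by rw [map_add, map_add]; ring⟩
    · obtain h | h := hm m hm'
      · obtain ⟨a, ha⟩ := monomial_eq_expand h (MvPolynomial.coeff m q)
        exact ⟨a, 0, by rw [ha]; simp⟩
      · obtain ⟨a, ha⟩ := monomial_eq_prod_X_mul_expand h (MvPolynomial.coeff m q)
        exact ⟨0, a, by rw [ha]; simp⟩
  have h (σ : Equiv.Perm (Fin n)) : MvPolynomial.rename σ a = a ∧ MvPolynomial.rename σ b = b := by
    refine expand_add_prod_X_mul_inj hn ?_
    have h1 := hq σ
    rw [e, map_add, map_mul, MvPolynomial.rename_expand, MvPolynomial.rename_expand, map_prod] at h1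
    simp only [MvPolynomial.rename_X] at h1
    rwa [Equiv.prod_comp σ fun i => (MvPolynomial.X i : MvPolynomial (Fin n) R)] at h1
  exact ⟨a, b, fun σ => (h σ).1, fun σ => (h σ).2, e⟩

/-- Invariance under the change of one sign (and permutations) forces all exponents to be even. -/
lemma even_of_isSymmetric_of_neg (h2 : ∀ r : R, 2 * r = 0 → r = 0)
    {q : MvPolynomial (Fin n) R} (hq : q.IsSymmetric) (k : Fin n)
    (hk : MvPolynomial.aeval (fun i => MvPolynomial.C (if i = k then (-1 : R) else 1) *
      MvPolynomial.X i) q = q) {m : Fin n →₀ ℕ} (hm : m ∈ q.support) (i : Fin n) : Even (m i) := by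
  by_contra hi
  rw [Nat.not_even_iff_odd] at hi
  refine (MvPolynomial.mem_support_iff.1 hm) ?_
  rw [← coeff_comp_of_isSymmetric hq (Equiv.swap i k)]
  refine eq_zero_of_neg_one_pow_mul h2 hi ?_
  have h1 := congrArg (MvPolynomial.coeff (m.mapDomain (Equiv.swap i k))) hk
  rw [coeff_aeval_C_mul_X, Finset.prod_eq_single k (fun j _ hj => by simp [hj]) (by simp),
    if_pos rfl] at h1
  have h3 : m.mapDomain (Equiv.swap i k) k = m i := by
    have := Finsupp.mapDomain_apply (Equiv.swap i k).injective m i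
    rwa [Equiv.swap_apply_left] at this
  rwa [h3] at h1

lemma exists_perm {k l i j : Fin n} (hkl : k ≠ l) (hij : i ≠ j) :
    ∃ σ : Equiv.Perm (Fin n), σ i = k ∧ σ j = l := by
  refine ⟨Equiv.swap l (Equiv.swap i k j) * Equiv.swap i k, ?_, ?_⟩
  · rw [Equiv.Perm.mul_apply, Equiv.swap_apply_left, Equiv.swap_apply_of_ne_of_ne hkl]
    intro h
    refine hij ((Equiv.swap i k).injective ?_)
    rw [Equiv.swap_apply_left, ← h]
  · rw [Equiv.Perm.mul_apply, Equiv.swap_apply_right]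

/-- Invariance under the change of two signs (and permutations) forces all exponents of a monomial to
have the same parity. -/
lemma parity_of_isSymmetric_of_neg (h2 : ∀ r : R, 2 * r = 0 → r = 0)
    {q : MvPolynomial (Fin n) R} (hq : q.IsSymmetric) {k l : Fin n} (hkl : k ≠ l)
    (hk : MvPolynomial.aeval (fun i => MvPolynomial.C (if i = k ∨ i = l then (-1 : R) else 1) *
      MvPolynomial.X i) q = q) {m : Fin n →₀ ℕ} (hm : m ∈ q.support) :
    (∀ i, Even (m i)) ∨ ∀ i, Odd (m i) := by
  have key (i j : Fin n) : Even (m i + m j) := by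
    by_cases hij : i = j
    · subst hij
      exact ⟨_, rfl⟩
    by_contra hi
    rw [Nat.not_even_iff_odd] at hi
    obtain ⟨σ, hσi, hσj⟩ := exists_perm hkl hij
    refine (MvPolynomial.mem_support_iff.1 hm) ?_
    rw [← coeff_comp_of_isSymmetric hq σ]
    refine eq_zero_of_neg_one_pow_mul h2 hi ?_
    have h1 := congrArg (MvPolynomial.coeff (m.mapDomain σ)) hk
    rw [coeff_aeval_C_mul_X, Finset.prod_eq_mul k l hkl (fun j _ hj => by simp [hj.1, hj.2])
      (by simp) (by simp), if_pos (Or.inl rfl), if_pos (Or.inr rfl), ← pow_add, ← hσi, ← hσj,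
      Finsupp.mapDomain_apply σ.injective, Finsupp.mapDomain_apply σ.injective] at h1
    exact h1
  by_cases h : ∀ i, Even (m i)
  · exact Or.inl h
  · push Not at h
    obtain ⟨i, hi⟩ := h
    exact Or.inr fun j => by
      have := key i j
      rw [Nat.even_add] at this
      rw [← Nat.not_even_iff_odd]
      exact fun h => hi (this.2 h)

lemma mem_range_expand {q : MvPolynomial (Fin n) R} (hq : q.IsSymmetric)
    (hm : ∀ m ∈ q.support, ∀ i, Even (m i)) :
    ∃ a, a.IsSymmetric ∧ q = MvPolynomial.expand 2 a := by
  have : ∃ a, q = MvPolynomial.expand 2 a := by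
    rw [MvPolynomial.as_sum q]
    refine Finset.sum_induction _ (fun p => ∃ a, p = MvPolynomial.expand 2 a)
      ?_ ⟨0, by simp⟩ fun m hm' => monomial_eq_expand (hm m hm') _
    rintro _ _ ⟨a, rfl⟩ ⟨a', rfl⟩
    exact ⟨a + a', by rw [map_add]⟩
  obtain ⟨a, rfl⟩ := this
  refine ⟨a, fun σ => MvPolynomial.expand_injective two_pos ?_, rfl⟩
  rw [← MvPolynomial.rename_expand, hq σ]

end Symmetric

/-! ### Invariants of type `A` -/

section TypeA

variable (R : Type*) [CommRing R] (n : ℕ)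

/-- The variables `X_1, …, X_n` together with `X_{n+1} = -(X_1 + ⋯ + X_n)`. -/
def extVar : Fin (n + 1) → MvPolynomial (Fin n) R :=
  Fin.snoc (α := fun _ => MvPolynomial (Fin n) R) MvPolynomial.X (-∑ i, MvPolynomial.X i)

@[simp] lemma extVar_castSucc (i : Fin n) : extVar R n i.castSucc = MvPolynomial.X i := by
  simp [extVar]

@[simp] lemma extVar_last : extVar R n (Fin.last n) = -∑ i, MvPolynomial.X i := by
  simp [extVar]

lemma sum_extVar : ∑ i, extVar R n i = 0 := by
  rw [Fin.sum_univ_castSucc]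
  simp

/-- The elementary symmetric polynomials of degrees `2, …, n + 1` in the `n + 1` forms
`-extVar R n i`, whose sum is zero. -/
def extEsymm (k : ℕ) : MvPolynomial (Fin n) R :=
  MvPolynomial.aeval (fun i => -extVar R n i) (MvPolynomial.esymm (Fin (n + 1)) R (k + 2))

/-- They form a regular sequence: it is the one of all elementary symmetric polynomials in `n + 1`
variables modulo its first member. -/
lemma mem_span_extEsymm_of_mul_mem {k : ℕ} (hk : k < n) {q : MvPolynomial (Fin n) R}
    (hq : q * extEsymm R n k ∈ Ideal.span (extEsymm R n '' Set.Iio k)) :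
    q ∈ Ideal.span (extEsymm R n '' Set.Iio k) := by
  set p : ℕ → MvPolynomial (Fin (n + 1)) R := fun j => MvPolynomial.aeval
    (fun i => -MvPolynomial.X i ^ 1) (MvPolynomial.esymm (Fin (n + 1)) R (j + 1)) with hp
  set π : MvPolynomial (Fin (n + 1)) R →ₐ[R] MvPolynomial (Fin n) R :=
    MvPolynomial.aeval (extVar R n) with hπ
  set ι : MvPolynomial (Fin n) R →ₐ[R] MvPolynomial (Fin (n + 1)) R :=
    MvPolynomial.rename Fin.castSucc with hι
  have hπι (f) : π (ι f) = f := by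
    rw [hπ, hι, MvPolynomial.aeval_rename]
    have : extVar R n ∘ Fin.castSucc = MvPolynomial.X := funext fun i => extVar_castSucc R n i
    rw [this, MvPolynomial.aeval_X_left_apply]
  have hp0 : p 0 = -∑ i, MvPolynomial.X i := by simp [hp]
  have hπp (j : ℕ) : π (p (j + 1)) = extEsymm R n j := by
    rw [hp, hπ, ← AlgHom.comp_apply, MvPolynomial.comp_aeval]
    simp [extEsymm]
  have hπp0 : π (p 0) = 0 := by
    rw [hp0, map_neg, map_sum]
    simp only [hπ, MvPolynomial.aeval_X, sum_extVar, neg_zero]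
  have hιπ (f) : f - ι (π f) ∈ Ideal.span {p 0} := by
    rw [← Ideal.Quotient.eq, ← Ideal.Quotient.mkₐ_eq_mk R]
    have : (Ideal.Quotient.mkₐ R (Ideal.span {p 0})) = ((Ideal.Quotient.mkₐ R _).comp ι).comp π := by
      refine MvPolynomial.algHom_ext fun i => ?_
      rw [AlgHom.comp_apply, AlgHom.comp_apply, hπ, MvPolynomial.aeval_X]
      refine Ideal.Quotient.eq.2 ?_
      refine Fin.lastCases ?_ (fun i => ?_) i
      · rw [extVar_last, map_neg, map_sum, Ideal.mem_span_singleton]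
        refine ⟨-1, ?_⟩
        rw [hp0, Fin.sum_univ_castSucc]
        simp [hι, MvPolynomial.rename_X]
        ring
      · rw [extVar_castSucc, hι, MvPolynomial.rename_X, sub_self]
        exact zero_mem _
    exact DFunLike.congr_fun this f
  have hspan : Ideal.span (extEsymm R n '' Set.Iio k) =
      (Ideal.span ((fun j => p (j + 1)) '' Set.Iio k)).map π := by
    rw [Ideal.map_span, ← Set.image_comp]
    exact congrArg Ideal.span (Set.image_congr fun j _ => (hπp j).symm)
  have hle : Ideal.span ((fun j => p (j + 1)) '' Set.Iio k) ≤ Ideal.span (p '' Set.Iio (k + 1)) := by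
    refine Ideal.span_mono ?_
    rintro _ ⟨j, hj, rfl⟩
    exact ⟨j + 1, by simpa using hj, rfl⟩
  have hle0 : Ideal.span {p 0} ≤ Ideal.span (p '' Set.Iio (k + 1)) := by
    refine Ideal.span_mono ?_
    rw [Set.singleton_subset_iff]
    exact ⟨0, Nat.succ_pos k, rfl⟩
  have h1 : ι q * p (k + 1) ∈ Ideal.span (p '' Set.Iio (k + 1)) := by
    rw [hspan, Ideal.mem_map_iff_of_surjective _ (fun f => ⟨_, hπι f⟩)] at hq
    obtain ⟨y, hy, e⟩ := hq
    have h2 := hιπ (ι q * p (k + 1) - y)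
    rw [map_sub, map_mul, hπι, hπp, e, sub_self, map_zero, sub_zero] at h2
    simpa using add_mem (hle0 h2) (hle hy)
  have h2 := mem_span_esymm_of_mul_mem R one_ne_zero (Nat.succ_lt_succ hk) (fun _ => rfl) h1
  have h3 : Ideal.span (p '' Set.Iio (k + 1)) ≤
      (Ideal.span (extEsymm R n '' Set.Iio k)).comap π := by
    rw [Ideal.span_le]
    rintro _ ⟨j, hj, rfl⟩
    rw [SetLike.mem_coe, Ideal.mem_comap]
    cases j with
    | zero => rw [hπp0]; exact zero_mem _
    | succ j =>
      rw [hπp]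
      exact Ideal.subset_span ⟨j, by simpa using hj, rfl⟩
  have h4 := Ideal.mem_comap.1 (h3 h2)
  rwa [hπι] at h4

variable {n}

/-- A polynomial is determined by its values at enough points whose differences are
nonzerodivisors. -/
lemma eq_zero_of_eval_eq_zero {S : Type*} [CommRing S] {N : ℕ} {f : Polynomial S}
    (hf : f.degree < N) (v : Fin N → S) (hv : ∀ i j, i ≠ j → v j - v i ∈ nonZeroDivisors S)
    (h : ∀ i, f.eval (v i) = 0) : f = 0 := by
  set c : Fin N → S := fun i => f.coeff i with hc
  have h1 : (Matrix.vandermonde v).mulVec c = 0 := by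
    funext i
    have h2 := h i
    rw [Polynomial.eval_eq_sum, ← Polynomial.sum_fin _ (by simp) hf] at h2
    rw [Pi.zero_apply, ← h2]
    simp only [Matrix.mulVec, dotProduct, Matrix.vandermonde_apply, hc]
    exact Finset.sum_congr rfl fun j _ => mul_comm _ _
  have h2 : (Matrix.vandermonde v).det • c = 0 := by
    have := congrArg ((Matrix.vandermonde v).adjugate).mulVec h1
    rwa [Matrix.mulVec_mulVec, Matrix.adjugate_mul, Matrix.smul_mulVec, Matrix.one_mulVec,
      Matrix.mulVec_zero] at this
  have h3 : (Matrix.vandermonde v).det ∈ nonZeroDivisors S := by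
    rw [Matrix.det_vandermonde]
    exact prod_mem fun i _ => prod_mem fun j hj => hv i j (Finset.mem_Ioi.1 hj).ne
  ext i
  rw [Polynomial.coeff_zero]
  by_cases hi : i < N
  · have := congrFun h2 ⟨i, hi⟩
    exact (mul_left_mem_nonZeroDivisors_eq_zero_iff h3).1 this
  · refine Polynomial.coeff_eq_zero_of_degree_lt (hf.trans_le ?_)
    exact_mod_cast not_lt.1 hi

/-- A form `f` is a nonzerodivisor if replacing `X_j` by `X_j + T` changes it by `c T` with `c` a
nonzerodivisor. -/
lemma mem_nonZeroDivisors_of_shift {σ : Type*} [DecidableEq σ] {f : MvPolynomial σ R} (j : σ) {c : R}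
    (hc : c ∈ nonZeroDivisors R)
    (h : MvPolynomial.aeval (fun i => Polynomial.C (MvPolynomial.X i) +
      if i = j then Polynomial.X else 0) f =
        Polynomial.C f + Polynomial.C (MvPolynomial.C c) * Polynomial.X) :
    f ∈ nonZeroDivisors (MvPolynomial σ R) := by
  rw [mem_nonZeroDivisors_iff_right]
  intro q hq
  set φ : MvPolynomial σ R →ₐ[R] Polynomial (MvPolynomial σ R) := MvPolynomial.aeval
    fun i => Polynomial.C (MvPolynomial.X i) + if i = j then Polynomial.X else 0
  have h0 (q) : (φ q).eval 0 = q := by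
    have : ((Polynomial.aeval (R := MvPolynomial σ R) (0 : MvPolynomial σ R)).restrictScalars R).comp φ =
        AlgHom.id R _ := by
      refine MvPolynomial.algHom_ext fun i => ?_
      rw [AlgHom.comp_apply, MvPolynomial.aeval_X]
      split_ifs <;> simp
    have := congrArg (fun g => g q) this
    simpa [Polynomial.aeval_def, Polynomial.eval₂_eq_eval_map] using this
  have hreg : Polynomial.C f + Polynomial.C (MvPolynomial.C c) * Polynomial.X ∈
      nonZeroDivisors (Polynomial (MvPolynomial σ R)) := by
    rw [Polynomial.mem_nonZeroDivisors_iff]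
    intro a ha
    have h1 := congrArg (fun p => Polynomial.coeff p 1) ha
    simp [Polynomial.coeff_C] at h1
    ext m
    have h2 := congrArg (MvPolynomial.coeff m) h1
    rw [mul_comm, MvPolynomial.coeff_C_mul, MvPolynomial.coeff_zero] at h2
    rw [MvPolynomial.coeff_zero]
    exact (mul_left_mem_nonZeroDivisors_eq_zero_iff hc).1 h2
  have h1 := congrArg φ hq
  rw [map_mul, map_zero, h, mul_right_mem_nonZeroDivisors_eq_zero_iff hreg] at h1
  rw [← h0 q, h1, Polynomial.eval_zero]

/-- A permutation of the `n + 1` forms `extVar R n i`, as a substitution of the polynomial ring. -/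
def extRename (σ : Equiv.Perm (Fin (n + 1))) : MvPolynomial (Fin n) R →ₐ[R] MvPolynomial (Fin n) R :=
  MvPolynomial.aeval fun i => extVar R n (σ i.castSucc)

lemma extRename_extVar (σ : Equiv.Perm (Fin (n + 1))) (i : Fin (n + 1)) :
    extRename R σ (extVar R n i) = extVar R n (σ i) := by
  refine Fin.lastCases ?_ (fun i => ?_) i
  · have h := Equiv.sum_comp σ (extVar R n)
    rw [sum_extVar, Fin.sum_univ_castSucc, add_eq_zero_iff_eq_neg'] at h
    rw [extVar_last, map_neg, map_sum, h]
    simp [extRename]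
  · simp [extRename]

lemma extRename_mul (σ τ : Equiv.Perm (Fin (n + 1))) (q : MvPolynomial (Fin n) R) :
    extRename R (σ * τ) q = extRename R σ (extRename R τ q) := by
  rw [← AlgHom.comp_apply]
  congr 1
  refine MvPolynomial.algHom_ext fun i => ?_
  rw [AlgHom.comp_apply, ← extVar_castSucc, extRename_extVar, extRename_extVar, extRename_extVar]
  rfl

lemma extRename_extEsymm (σ : Equiv.Perm (Fin (n + 1))) (k : ℕ) :
    extRename R σ (extEsymm R n k) = extEsymm R n k := by
  rw [extEsymm, ← AlgHom.comp_apply, MvPolynomial.comp_aeval]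
  simp only [map_neg, extRename_extVar]
  conv_rhs => rw [← MvPolynomial.rename_esymm (Fin (n + 1)) R _ σ, MvPolynomial.aeval_rename]
  rfl

lemma extRename_of_swap {q : MvPolynomial (Fin n) R}
    (h : ∀ i : Fin n, extRename R (Equiv.swap i.castSucc i.succ) q = q)
    (σ : Equiv.Perm (Fin (n + 1))) : extRename R σ q = q := by
  have hσ : σ ∈ Submonoid.closure (Set.range fun i : Fin n => Equiv.swap i.castSucc i.succ) := by
    rw [Equiv.Perm.mclosure_swap_castSucc_succ]
    trivial
  induction hσ using Submonoid.closure_induction with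
  | mem σ hσ =>
    obtain ⟨i, rfl⟩ := hσ
    exact h i
  | one =>
    have : extRename R (1 : Equiv.Perm (Fin (n + 1))) = AlgHom.id R _ :=
      MvPolynomial.algHom_ext fun i => by simp [extRename]
    rw [this]
    rfl
  | mul σ τ _ _ hs ht => rw [extRename_mul, ht, hs]

lemma extVar_sub_mem_nonZeroDivisors (h2 : ∀ r : R, 2 * r = 0 → r = 0) (i j : Fin (n + 1))
    (hij : i ≠ j) : extVar R n j - extVar R n i ∈ nonZeroDivisors (MvPolynomial (Fin n) R) := by
  have hneg {f : MvPolynomial (Fin n) R} (hf : f ∈ nonZeroDivisors (MvPolynomial (Fin n) R)) :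
      -f ∈ nonZeroDivisors (MvPolynomial (Fin n) R) := by
    rw [mem_nonZeroDivisors_iff_right] at hf ⊢
    exact fun q hq => hf q (by linear_combination -hq)
  have hlast (i : Fin n) : extVar R n i.castSucc - extVar R n (Fin.last n) ∈
      nonZeroDivisors (MvPolynomial (Fin n) R) := by
    refine mem_nonZeroDivisors_of_shift R i (c := 2) ?_ ?_
    · rw [mem_nonZeroDivisors_iff_left]
      exact h2
    · simp [Finset.sum_add_distrib, map_ofNat]
      ring
  have hcast (i j : Fin n) (hij : i ≠ j) : extVar R n i.castSucc - extVar R n j.castSucc ∈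
      nonZeroDivisors (MvPolynomial (Fin n) R) := by
    refine mem_nonZeroDivisors_of_shift R i (c := 1) (one_mem _) ?_
    simp [hij.symm]
    ring
  revert hij
  refine Fin.lastCases ?_ (fun i => ?_) i <;> refine Fin.lastCases ?_ (fun j => ?_) j <;> intro hij
  · exact absurd rfl hij
  · exact hlast j
  · rw [← neg_sub]
    exact hneg (hlast i)
  · exact hcast j i fun h => hij (by rw [h])

/-- If `2` is a nonzerodivisor, then the polynomials invariant under all permutations of the `n + 1`
forms are polynomials in the elementary symmetric ones. Over the ring `T` of the latter, an invariant
is a polynomial `g` in the last form, which can be taken of degree at most `n`; as it takes the same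
value at each of the `n + 1` forms, it is constant. -/
theorem mem_adjoin_extEsymm (h2 : ∀ r : R, 2 * r = 0 → r = 0)
    {q : MvPolynomial (Fin n) R} (hq : ∀ σ, extRename R σ q = q) :
    q ∈ Algebra.adjoin R (extEsymm R n '' Set.Iio n) := by
  set T := Algebra.adjoin R (extEsymm R n '' Set.Iio n) with hT
  set l := extVar R n
  have hσT (σ : Equiv.Perm (Fin (n + 1))) (t : T) : extRename R σ t = t := by
    have : T ≤ AlgHom.equalizer (extRename R σ) (AlgHom.id R _) := by
      rw [hT, Algebra.adjoin_le_iff]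
      rintro _ ⟨k, -, rfl⟩
      exact extRename_extEsymm R σ k
    exact this t.2
  have hcT (k : ℕ) (hk : k ≤ n + 1) : PowerSeries.coeff k (elemSeries l) ∈ T := by
    obtain rfl | rfl | ⟨k, rfl⟩ : k = 0 ∨ k = 1 ∨ ∃ j, k = j + 2 := by
      obtain h | h : k < 2 ∨ 2 ≤ k := by omega
      · omega
      · exact Or.inr (Or.inr ⟨k - 2, by omega⟩)
    · rw [coeff_zero_elemSeries]
      exact one_mem _
    · rw [coeff_elemSeries (R := R), MvPolynomial.esymm_one, map_sum]
      simp only [MvPolynomial.aeval_X, Finset.sum_neg_distrib]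
      rw [sum_extVar, neg_zero]
      exact zero_mem _
    · rw [coeff_elemSeries (R := R)]
      refine Algebra.subset_adjoin ?_
      exact ⟨k, by simp only [Set.mem_Iio]; omega, rfl⟩
  -- `q` is a polynomial over `T` in the last form
  obtain ⟨g, hg⟩ : ∃ g : Polynomial T, Polynomial.aeval (l (Fin.last n)) g = q := by
    set T' := ((Polynomial.aeval (R := T) (l (Fin.last n))).range).restrictScalars R
    have hTT (t) (ht : t ∈ T) : t ∈ T' := ⟨Polynomial.C ⟨t, ht⟩, by simp⟩
    have hl : l (Fin.last n) ∈ T' := ⟨Polynomial.X, by simp⟩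
    have hE (k : ℕ) (hk : k ≤ n + 1) : PowerSeries.coeff k
        (elemSeries fun i : Fin n => (MvPolynomial.X i : MvPolynomial (Fin n) R)) ∈ T' := by
      induction k with
      | zero =>
        rw [coeff_zero_elemSeries]
        exact one_mem _
      | succ k ih =>
        have h1 : elemSeries l = elemSeries (fun i : Fin n => (MvPolynomial.X i :
            MvPolynomial (Fin n) R)) * (1 + PowerSeries.C (-l (Fin.last n)) * PowerSeries.X) := by
          rw [elemSeries, Fin.prod_univ_castSucc]
          simp only [l, extVar_castSucc]
          rfl
        have h3 := congrArg (PowerSeries.coeff (k + 1)) h1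
        rw [mul_add, mul_one, mul_left_comm, map_add, PowerSeries.coeff_C_mul,
          PowerSeries.coeff_succ_mul_X] at h3
        have h4 := sub_mem (hTT _ (hcT (k + 1) hk)) (mul_mem (neg_mem hl) (ih (by omega)))
        rwa [h3, add_sub_cancel_right] at h4
    have hsym : q.IsSymmetric := by
      refine isSymmetric_of_swap fun i j _ => ?_
      have e : extRename R (Equiv.swap i.castSucc j.castSucc) =
          MvPolynomial.rename (Equiv.swap i j) := MvPolynomial.algHom_ext fun k => by
        rw [extRename, MvPolynomial.aeval_X, MvPolynomial.rename_X,
          (Fin.castSucc_injective n).swap_apply, extVar_castSucc]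
      rw [← e, hq]
    have h1 : Algebra.adjoin R ((fun k => MvPolynomial.esymm (Fin n) R (k + 1)) '' Set.Iio n) ≤
        T' := by
      rw [Algebra.adjoin_le_iff]
      rintro _ ⟨k, hk, rfl⟩
      have h3 := hE (k + 1) (by simp only [Set.mem_Iio] at hk; omega)
      rw [coeff_elemSeries (R := R), aeval_neg_esymm] at h3
      have h4 := mul_mem (pow_mem (neg_mem (one_mem T')) (k + 1)) h3
      rw [← mul_assoc, ← mul_pow, neg_mul_neg, one_mul, one_pow, one_mul,
        MvPolynomial.aeval_X_left_apply] at h4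
      exact h4
    exact h1 (mem_adjoin_of_isSymmetric hsym)
  -- the monic polynomial with the `n + 1` forms as its roots
  obtain ⟨G, hG, hGd, hGm⟩ : ∃ G : Polynomial T, G.map T.val.toRingHom =
      ∏ i, (Polynomial.X + Polynomial.C (-l i)) ∧
        G.degree = (∏ i, (Polynomial.X + Polynomial.C (-l i))).degree ∧ G.Monic := by
    nontriviality MvPolynomial (Fin n) R
    refine Polynomial.lifts_and_degree_eq_and_monic ?_
      (Polynomial.monic_prod_of_monic _ _ fun i _ => Polynomial.monic_X_add_C _)
    have h1 := congrArg (Polynomial.map (MvPolynomial.aeval (R := R) fun i => -l i).toRingHom)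
      (MvPolynomial.prod_C_add_X_eq_sum_esymm R (Fin (n + 1)))
    rw [Polynomial.map_prod] at h1
    simp only [Polynomial.map_add, Polynomial.map_X, Polynomial.map_C, Polynomial.map_sum,
      Polynomial.map_mul, Polynomial.map_pow, AlgHom.toRingHom_eq_coe, RingHom.coe_coe,
      MvPolynomial.aeval_X] at h1
    rw [h1]
    refine sum_mem fun k hk => mul_mem ?_ (pow_mem (Polynomial.X_mem_lifts _) _)
    rw [← coeff_elemSeries]
    refine Polynomial.C_mem_lifts T.val.toRingHom ⟨_, hcT k ?_⟩
    have := Finset.mem_range.1 hk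
    simp only [Fintype.card_fin] at this
    omega
  have hroot (k) : Polynomial.aeval (l k) G = 0 := by
    rw [Polynomial.aeval_def, Polynomial.eval₂_eq_eval_map]
    change Polynomial.eval (l k) (G.map T.val.toRingHom) = 0
    rw [hG, Polynomial.eval_prod]
    exact Finset.prod_eq_zero (Finset.mem_univ k) (by simp)
  have hval (k) : Polynomial.aeval (l k) (g %ₘ G) = q := by
    have h1 : Polynomial.aeval (l k) (g %ₘ G) = Polynomial.aeval (l k) g := by
      conv_rhs => rw [← Polynomial.modByMonic_add_div g G, map_add, map_mul, hroot, zero_mul, add_zero]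
    rw [h1, ← hq (Equiv.swap (Fin.last n) k), ← hg, Polynomial.aeval_def, Polynomial.aeval_def]
    change _ = (extRename R (Equiv.swap (Fin.last n) k)).toRingHom _
    rw [Polynomial.hom_eval₂]
    have h3 : (extRename R (Equiv.swap (Fin.last n) k)).toRingHom (l (Fin.last n)) = l k := by
      refine (extRename_extVar R _ _).trans ?_
      rw [Equiv.swap_apply_left]
    rw [h3]
    congr 1
    exact RingHom.ext fun t => (hσT _ t).symm
  nontriviality MvPolynomial (Fin n) R
  have hTn : Nontrivial T := inferInstance
  have hdeg : (g %ₘ G).degree < (n + 1 : ℕ) := by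
    refine (Polynomial.degree_modByMonic_lt _ hGm).trans_le ?_
    rw [hGd, Polynomial.degree_prod_of_monic _ _ fun i _ => Polynomial.monic_X_add_C _]
    simp only [Polynomial.degree_X_add_C]
    simp
  have h0 : (g %ₘ G).map T.val.toRingHom - Polynomial.C q = 0 := by
    refine eq_zero_of_eval_eq_zero (N := n + 1) ?_ l (extVar_sub_mem_nonZeroDivisors R h2)
      fun k => ?_
    · refine (Polynomial.degree_sub_le _ _).trans_lt (max_lt ?_ ?_)
      · exact (Polynomial.degree_map_le).trans_lt hdeg
      · refine Polynomial.degree_C_le.trans_lt ?_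
        exact_mod_cast Nat.succ_pos n
    · rw [Polynomial.eval_sub, Polynomial.eval_C, sub_eq_zero, ← hval k, Polynomial.aeval_def,
        Polynomial.eval₂_eq_eval_map]
      rfl
  have h3 := congrArg (fun p => Polynomial.coeff p 0) h0
  simp only [Polynomial.coeff_sub, Polynomial.coeff_map, Polynomial.coeff_C_zero,
    Polynomial.coeff_zero, sub_eq_zero] at h3
  rw [← h3]
  exact ((g %ₘ G).coeff 0).2

end TypeA

/-! ### Invariants of type `G₂` -/

section TypeG

variable (R : Type*) [CommRing R]

lemma aeval_esymm_card {S : Type*} [CommRing S] [Algebra R S] {κ : Type*} [Fintype κ] (z : κ → S) :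
    MvPolynomial.aeval z (MvPolynomial.esymm κ R (Fintype.card κ)) = ∏ i, z i := by
  rw [MvPolynomial.esymm, ← Finset.card_univ, Finset.powersetCard_self]
  simp

lemma extEsymm_two_zero : extEsymm R 2 0 = -(MvPolynomial.X 0 ^ 2 +
    MvPolynomial.X 0 * MvPolynomial.X 1 + MvPolynomial.X 1 ^ 2) := by
  have h : (Finset.univ : Finset (Fin 3)).powersetCard 2 = {{0, 1}, {0, 2}, {1, 2}} := by decide
  have h0 : extVar R 2 0 = MvPolynomial.X 0 := extVar_castSucc R 2 0
  have h1 : extVar R 2 1 = MvPolynomial.X 1 := extVar_castSucc R 2 1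
  have h2 : extVar R 2 2 = -∑ i, MvPolynomial.X i := extVar_last R 2
  rw [extEsymm, MvPolynomial.esymm]
  change MvPolynomial.aeval _ (∑ t ∈ (Finset.univ : Finset (Fin 3)).powersetCard 2, _) = _
  rw [h, Finset.sum_insert (by decide), Finset.sum_insert (by decide), Finset.sum_singleton,
    Finset.prod_pair (by decide), Finset.prod_pair (by decide), Finset.prod_pair (by decide)]
  simp only [map_add, map_mul, MvPolynomial.aeval_X, h0, h1, h2, Fin.sum_univ_two]
  ring

lemma extEsymm_two_one : extEsymm R 2 1 =
    MvPolynomial.X 0 * MvPolynomial.X 1 * (MvPolynomial.X 0 + MvPolynomial.X 1) := by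
  have h0 : extVar R 2 0 = MvPolynomial.X 0 := extVar_castSucc R 2 0
  have h1 : extVar R 2 1 = MvPolynomial.X 1 := extVar_castSucc R 2 1
  have h2 : extVar R 2 2 = -∑ i, MvPolynomial.X i := extVar_last R 2
  have h := aeval_esymm_card R fun i => -extVar R 2 i
  rw [Fintype.card_fin] at h
  refine h.trans ?_
  rw [Fin.prod_univ_three, h0, h1, h2, Fin.sum_univ_two]
  ring

variable {R}

lemma eq_zero_of_mul_extEsymm_two_zero {q : MvPolynomial (Fin 2) R} (h : q * extEsymm R 2 0 = 0) :
    q = 0 := by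
  have hi : Set.Iio 0 = (∅ : Set ℕ) := by ext; simp
  have h1 := mem_span_extEsymm_of_mul_mem R 2 (k := 0) two_pos (q := q)
  simp only [hi, Set.image_empty, Ideal.span_empty, Ideal.mem_bot] at h1
  exact h1 h

lemma dvd_of_dvd_mul_extEsymm_two_one_sq {q : MvPolynomial (Fin 2) R}
    (h : extEsymm R 2 0 ∣ q * extEsymm R 2 1 ^ 2) : extEsymm R 2 0 ∣ q := by
  have hi : Set.Iio 1 = ({0} : Set ℕ) := by ext; simp
  have h1 (q : MvPolynomial (Fin 2) R) (h : extEsymm R 2 0 ∣ q * extEsymm R 2 1) :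
      extEsymm R 2 0 ∣ q := by
    have h1 := mem_span_extEsymm_of_mul_mem R 2 (k := 1) one_lt_two (q := q)
    simp only [hi, Set.image_singleton, Ideal.mem_span_singleton] at h1
    exact h1 h
  rw [pow_two, ← mul_assoc] at h
  exact h1 _ (h1 _ h)

lemma eq_zero_of_mul_extEsymm_two_one {q : MvPolynomial (Fin 2) R} (h : q * extEsymm R 2 1 = 0) :
    q = 0 := by
  have hreg : MvPolynomial.X 0 + MvPolynomial.X 1 ∈ nonZeroDivisors (MvPolynomial (Fin 2) R) := by
    refine mem_nonZeroDivisors_of_shift R 0 (c := 1) (one_mem _) ?_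
    simp
    ring
  rw [extEsymm_two_one, ← mul_assoc, ← mul_assoc] at h
  have hX (i : Fin 2) := (isRegular_iff_mem_nonZeroDivisors (R := MvPolynomial (Fin 2) R)).1
    (MvPolynomial.isRegular_X (n := i))
  rwa [mul_right_mem_nonZeroDivisors_eq_zero_iff hreg,
    mul_right_mem_nonZeroDivisors_eq_zero_iff (hX 1),
    mul_right_mem_nonZeroDivisors_eq_zero_iff (hX 0)] at h

/-- Reduction of coefficients modulo `2`. -/
def mapModTwo (R : Type*) [CommRing R] :
    MvPolynomial (Fin 2) R →+* MvPolynomial (Fin 2) (R ⧸ Ideal.span {(2 : R)}) :=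
  MvPolynomial.map (Ideal.Quotient.mk _)

lemma mapModTwo_eq_zero_iff {q : MvPolynomial (Fin 2) R} : mapModTwo R q = 0 ↔ 2 ∣ q := by
  rw [← RingHom.mem_ker, mapModTwo, MvPolynomial.ker_map, Ideal.mk_ker, Ideal.map_span,
    Set.image_singleton, Ideal.mem_span_singleton, map_ofNat]

lemma mapModTwo_extEsymm_zero : mapModTwo R (extEsymm R 2 0) = extEsymm _ 2 0 := by
  rw [extEsymm_two_zero, extEsymm_two_zero]
  simp [mapModTwo]

lemma mapModTwo_extEsymm_one : mapModTwo R (extEsymm R 2 1) = extEsymm _ 2 1 := by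
  rw [extEsymm_two_one, extEsymm_two_one]
  simp [mapModTwo]

lemma eq_zero_of_two_mul (h2 : ∀ r : R, 2 * r = 0 → r = 0) {q : MvPolynomial (Fin 2) R}
    (h : 2 * q = 0) : q = 0 := by
  ext m
  refine h2 _ ?_
  have := congrArg (MvPolynomial.coeff m) h
  rwa [← map_ofNat MvPolynomial.C, MvPolynomial.coeff_C_mul] at this

variable (R) in
/-- The invariants of type `G₂`: twice the form of degree `2`, and (up to sign) the square of the form
of degree `3` among the invariants of type `A₂`. -/
def gPoly (k : ℕ) : MvPolynomial (Fin 2) R :=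
  if k = 0 then 2 * extEsymm R 2 0 else -extEsymm R 2 1 ^ 2

lemma image_gPoly_Iio_two : gPoly R '' Set.Iio 2 = {2 * extEsymm R 2 0, -extEsymm R 2 1 ^ 2} := by
  ext q
  constructor
  · rintro ⟨k, hk, rfl⟩
    obtain rfl | rfl : k = 0 ∨ k = 1 := by simp only [Set.mem_Iio] at hk; omega
    · exact Or.inl rfl
    · exact Or.inr rfl
  · rintro (rfl | rfl)
    · exact ⟨0, by simp, rfl⟩
    · exact ⟨1, by simp, rfl⟩

lemma mem_span_gPoly_of_mul_mem (h2 : ∀ r : R, 2 * r = 0 → r = 0) {k : ℕ} (hk : k < 2)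
    {q : MvPolynomial (Fin 2) R} (hq : q * gPoly R k ∈ Ideal.span (gPoly R '' Set.Iio k)) :
    q ∈ Ideal.span (gPoly R '' Set.Iio k) := by
  obtain rfl | rfl : k = 0 ∨ k = 1 := by omega
  · have hi : Set.Iio 0 = (∅ : Set ℕ) := by ext; simp
    simp only [hi, Set.image_empty, Ideal.span_empty, Ideal.mem_bot] at hq ⊢
    refine eq_zero_of_mul_extEsymm_two_zero (eq_zero_of_two_mul h2 ?_)
    rw [← hq, gPoly, if_pos rfl]
    ring
  · have hi : Set.Iio 1 = ({0} : Set ℕ) := by ext; simp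
    rw [hi, Set.image_singleton, Ideal.mem_span_singleton] at hq ⊢
    simp only [gPoly, one_ne_zero, if_false, if_true] at hq ⊢
    obtain ⟨u, hu⟩ := hq
    obtain ⟨v, rfl⟩ := dvd_of_dvd_mul_extEsymm_two_one_sq (q := q)
      ⟨-(2 * u), by linear_combination -hu⟩
    have h1 : v * extEsymm R 2 1 ^ 2 + 2 * u = 0 :=
      eq_zero_of_mul_extEsymm_two_zero (by linear_combination -hu)
    have h3 : mapModTwo R (v * extEsymm R 2 1 ^ 2) = 0 :=
      mapModTwo_eq_zero_iff.2 ⟨-u, by linear_combination h1⟩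
    rw [map_mul, map_pow, mapModTwo_extEsymm_one, pow_two, ← mul_assoc] at h3
    obtain ⟨w, rfl⟩ := mapModTwo_eq_zero_iff.1
      (eq_zero_of_mul_extEsymm_two_one (eq_zero_of_mul_extEsymm_two_one h3))
    exact ⟨w, by ring⟩

/-- Division by `2` modulo the ideal generated by the form of degree `2` and the square of the form
of degree `3`. -/
lemma exists_eq_of_two_mul_eq (h2 : ∀ r : R, 2 * r = 0 → r = 0) {q a b : MvPolynomial (Fin 2) R}
    (h : 2 * q = a * extEsymm R 2 0 + b * extEsymm R 2 1 ^ 2) :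
    ∃ a b, q = a * extEsymm R 2 0 + b * extEsymm R 2 1 ^ 2 := by
  have h1 := mapModTwo_eq_zero_iff.2 ⟨q, h.symm⟩
  rw [map_add, map_mul, map_mul, map_pow, mapModTwo_extEsymm_zero, mapModTwo_extEsymm_one] at h1
  obtain ⟨c, hc⟩ := dvd_of_dvd_mul_extEsymm_two_one_sq (q := mapModTwo R b)
    ⟨-mapModTwo R a, by linear_combination h1⟩
  obtain ⟨c, rfl⟩ : ∃ c', mapModTwo R c' = c :=
    MvPolynomial.map_surjective _ Ideal.Quotient.mk_surjective c
  obtain ⟨b', hb'⟩ : 2 ∣ b - extEsymm R 2 0 * c := by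
    rw [← mapModTwo_eq_zero_iff, map_sub, map_mul, mapModTwo_extEsymm_zero, hc, sub_self]
  obtain ⟨a', ha'⟩ : 2 ∣ a + c * extEsymm R 2 1 ^ 2 := by
    rw [← mapModTwo_eq_zero_iff]
    refine eq_zero_of_mul_extEsymm_two_zero ?_
    rw [map_add, map_mul, map_pow, mapModTwo_extEsymm_one]
    linear_combination h1 - extEsymm _ 2 1 ^ 2 * hc
  refine ⟨a', b', sub_eq_zero.1 (eq_zero_of_two_mul h2 ?_)⟩
  linear_combination h + extEsymm R 2 0 * ha' + extEsymm R 2 1 ^ 2 * hb'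

lemma two_smul_mem_span_gPoly (h2 : ∀ r : R, 2 * r = 0 → r = 0) {q : MvPolynomial (Fin 2) R} {M : ℕ}
    (h : (2 : R) ^ M • q ∈ Ideal.span (gPoly R '' Set.Iio 2)) :
    ((2 : ℕ) : R) • q ∈ Ideal.span (gPoly R '' Set.Iio 2) := by
  rw [image_gPoly_Iio_two] at h ⊢
  obtain ⟨a, b, e⟩ : ∃ a b, q = a * extEsymm R 2 0 + b * extEsymm R 2 1 ^ 2 := by
    obtain ⟨a, b, e⟩ := Ideal.mem_span_pair.1 h
    have e1 : (2 : R) ^ M • q = (a * 2) * extEsymm R 2 0 + (-b) * extEsymm R 2 1 ^ 2 := by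
      rw [← e]
      ring
    clear e h
    generalize a * 2 = a at e1
    generalize -b = b at e1
    induction M generalizing a b with
    | zero => exact ⟨a, b, by simpa using e1⟩
    | succ M ih =>
      rw [pow_succ', ← smul_smul, MvPolynomial.smul_eq_C_mul, map_ofNat] at e1
      obtain ⟨a', b', e'⟩ := exists_eq_of_two_mul_eq h2 e1
      exact ih a' b' e'
  refine Ideal.mem_span_pair.2 ⟨a, -(2 * b), ?_⟩
  rw [e, MvPolynomial.smul_eq_C_mul, Nat.cast_ofNat, map_ofNat]
  ring

variable (R) in
/-- The substitution `X_i ↦ -X_i`. -/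
def negSubst (n : ℕ) : MvPolynomial (Fin n) R →ₐ[R] MvPolynomial (Fin n) R :=
  MvPolynomial.aeval fun i => -MvPolynomial.X i

/-- A polynomial invariant under the permutations of the three forms and under `-1` is, up to a power
of `2`, a polynomial in the invariants of type `G₂`. -/
lemma exists_pow_smul_mem_adjoin_gPoly (h2 : ∀ r : R, 2 * r = 0 → r = 0)
    {q : MvPolynomial (Fin 2) R} (hq : ∀ σ, extRename R σ q = q) (hn : negSubst R 2 q = q) :
    ∃ M, (2 : R) ^ M • q ∈ Algebra.adjoin R (gPoly R '' Set.Iio 2) := by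
  set B := Algebra.adjoin R {extEsymm R 2 0, extEsymm R 2 1 ^ 2} with hB
  have hA : extEsymm R 2 0 ∈ B := Algebra.subset_adjoin (Or.inl rfl)
  have hC : extEsymm R 2 1 ^ 2 ∈ B := Algebra.subset_adjoin (Or.inr rfl)
  have hnA : negSubst R 2 (extEsymm R 2 0) = extEsymm R 2 0 := by
    rw [extEsymm_two_zero]
    simp [negSubst]
  have hnC : negSubst R 2 (extEsymm R 2 1) = -extEsymm R 2 1 := by
    rw [extEsymm_two_one]
    simp [negSubst]
    ring
  have hnB : B ≤ AlgHom.equalizer (negSubst R 2) (AlgHom.id R _) := by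
    rw [hB, Algebra.adjoin_le_iff]
    rintro _ (rfl | rfl)
    · exact hnA
    · change negSubst R 2 _ = _
      rw [map_pow, hnC, neg_sq]
      rfl
  have hqB : q ∈ B := by
    have h1 := mem_adjoin_extEsymm R h2 hq
    obtain ⟨a, ha, b, hb, e⟩ : ∃ a ∈ B, ∃ b ∈ B, q = a + extEsymm R 2 1 * b := by
      clear hq hn
      induction h1 using Algebra.adjoin_induction with
      | mem q hq =>
        obtain ⟨k, hk, rfl⟩ := hq
        obtain rfl | rfl : k = 0 ∨ k = 1 := by simp only [Set.mem_Iio] at hk; omega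
        · exact ⟨_, hA, 0, zero_mem _, by simp⟩
        · exact ⟨0, zero_mem _, 1, one_mem _, by simp⟩
      | algebraMap r => exact ⟨_, B.algebraMap_mem r, 0, zero_mem _, by simp⟩
      | add p q _ _ hp hq =>
        obtain ⟨a, ha, b, hb, rfl⟩ := hp
        obtain ⟨a', ha', b', hb', rfl⟩ := hq
        exact ⟨a + a', add_mem ha ha', b + b', add_mem hb hb', by ring⟩
      | mul p q _ _ hp hq =>
        obtain ⟨a, ha, b, hb, rfl⟩ := hp
        obtain ⟨a', ha', b', hb', rfl⟩ := hq
        exact ⟨a * a' + extEsymm R 2 1 ^ 2 * (b * b'), add_mem (mul_mem ha ha')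
          (mul_mem hC (mul_mem hb hb')), a * b' + b * a',
          add_mem (mul_mem ha hb') (mul_mem hb ha'), by ring⟩
    have hna : negSubst R 2 a = a := hnB ha
    have hnb : negSubst R 2 b = b := hnB hb
    rw [e, map_add, map_mul, hna, hnb, hnC] at hn
    have h3 : extEsymm R 2 1 * b = 0 := eq_zero_of_two_mul h2 (by linear_combination -hn)
    rw [e, h3, add_zero]
    exact ha
  clear hq hn
  induction hqB using Algebra.adjoin_induction with
  | mem q hq =>
    rw [image_gPoly_Iio_two]
    obtain rfl | rfl := hq
    · refine ⟨1, Algebra.subset_adjoin (Or.inl ?_)⟩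
      rw [pow_one, MvPolynomial.smul_eq_C_mul, map_ofNat]
    · refine ⟨0, ?_⟩
      have h1 : -extEsymm R 2 1 ^ 2 ∈ Algebra.adjoin R {2 * extEsymm R 2 0, -extEsymm R 2 1 ^ 2} :=
        Algebra.subset_adjoin (Or.inr rfl)
      simpa using neg_mem h1
  | algebraMap r =>
    refine ⟨0, ?_⟩
    rw [pow_zero, one_smul]
    exact Subalgebra.algebraMap_mem _ r
  | add p q _ _ hp hq =>
    obtain ⟨M, hM⟩ := hp
    obtain ⟨N, hN⟩ := hq
    refine ⟨N + M, ?_⟩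
    rw [smul_add]
    refine add_mem ?_ ?_
    · rw [pow_add, ← smul_smul]
      exact Subalgebra.smul_mem _ hM _
    · rw [add_comm, pow_add, ← smul_smul]
      exact Subalgebra.smul_mem _ hN _
  | mul p q _ _ hp hq =>
    obtain ⟨M, hM⟩ := hp
    obtain ⟨N, hN⟩ := hq
    refine ⟨M + N, ?_⟩
    have := mul_mem hM hN
    rwa [smul_mul_smul_comm, ← pow_add] at this

end TypeG

/-! ### The reflections in orthogonal coordinates -/

section Reflections

variable {n : ℕ}

/-- The signed permutation `e_i ↦ ε_i e_{σ i}` of `ℤ^n`. -/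
def signedPerm (σ : Equiv.Perm (Fin n)) (ε : Fin n → ℤ) : (Fin n → ℤ) →+ (Fin n → ℤ) :=
  AddMonoidHom.mk' (fun v j => ε (σ.symm j) * v (σ.symm j)) fun v w => by
    funext j
    simp [mul_add]

lemma signedPerm_apply (σ : Equiv.Perm (Fin n)) (ε v : Fin n → ℤ) (j : Fin n) :
    signedPerm σ ε v j = ε (σ.symm j) * v (σ.symm j) := rfl

lemma signedPerm_single (σ : Equiv.Perm (Fin n)) (ε : Fin n → ℤ) (i : Fin n) :
    signedPerm σ ε (Pi.single i 1) = ε i • Pi.single (σ i) 1 := by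
  funext j
  rw [signedPerm_apply]
  by_cases h : j = σ i
  · subst h
    simp
  · have h' : σ.symm j ≠ i := fun h' => h (by rw [← h', Equiv.apply_symm_apply])
    simp [h, h']

/-- The vectors `e_1, …, e_n` together with `e_{n+1} = -(e_1 + ⋯ + e_n)`. -/
def extVec (n : ℕ) : Fin (n + 1) → (Fin n → ℤ) :=
  Fin.snoc (α := fun _ => Fin n → ℤ) (fun i => Pi.single i 1) (fun _ => -1)

/-- The permutation `σ` of the `n + 1` vectors `extVec n i`, as an endomorphism of `ℤ^n`. -/
def extPerm (σ : Equiv.Perm (Fin (n + 1))) : (Fin n → ℤ) →+ (Fin n → ℤ) :=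
  AddMonoidHom.mk' (fun v j => Fin.snoc (α := fun _ => ℤ) v 0 (σ.symm j.castSucc) -
    Fin.snoc (α := fun _ => ℤ) v 0 (σ.symm (Fin.last n))) fun v w => by
      have h (k : Fin (n + 1)) : Fin.snoc (α := fun _ => ℤ) (v + w) 0 k =
          Fin.snoc (α := fun _ => ℤ) v 0 k + Fin.snoc (α := fun _ => ℤ) w 0 k := by
        refine Fin.lastCases ?_ (fun k => ?_) k <;> simp
      funext j
      simp only [h, Pi.add_apply]
      ring

lemma extPerm_apply (σ : Equiv.Perm (Fin (n + 1))) (v : Fin n → ℤ) (j : Fin n) :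
    extPerm σ v j = Fin.snoc (α := fun _ => ℤ) v 0 (σ.symm j.castSucc) -
      Fin.snoc (α := fun _ => ℤ) v 0 (σ.symm (Fin.last n)) := rfl

lemma extPerm_extVec (σ : Equiv.Perm (Fin (n + 1))) (i : Fin (n + 1)) :
    extPerm σ (extVec n i) = extVec n (σ i) := by
  -- both sides are images of unit vectors of `ℤ^(n+1)` modulo `(1, …, 1)`
  have h (i : Fin (n + 1)) (k l : Fin (n + 1)) :
      Fin.snoc (α := fun _ => ℤ) (extVec n i) 0 k - Fin.snoc (α := fun _ => ℤ) (extVec n i) 0 l =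
        (Pi.single i 1 : Fin (n + 1) → ℤ) k - (Pi.single i 1 : Fin (n + 1) → ℤ) l := by
    have h1 (k : Fin (n + 1)) : Fin.snoc (α := fun _ => ℤ) (extVec n i) 0 k =
        (Pi.single i 1 : Fin (n + 1) → ℤ) k - (Pi.single i 1 : Fin (n + 1) → ℤ) (Fin.last n) := by
      refine Fin.lastCases ?_ (fun i => ?_) i <;> refine Fin.lastCases ?_ (fun k => ?_) k <;>
        simp [extVec, Pi.single_apply, Fin.castSucc_ne_last, (Fin.castSucc_ne_last _).symm]
    rw [h1, h1]
    ring
  have h0 (i : Fin (n + 1)) (j : Fin n) : extVec n i j =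
      (Pi.single i 1 : Fin (n + 1) → ℤ) j.castSucc -
        (Pi.single i 1 : Fin (n + 1) → ℤ) (Fin.last n) := by
    have := h i j.castSucc (Fin.last n)
    simpa using this
  funext j
  rw [extPerm_apply, h, h0]
  simp [Pi.single_apply, Equiv.symm_apply_eq]

variable (R : Type*) [CommRing R]

lemma linPoly_single (i : Fin n) :
    linPoly (Pi.basisFun ℤ (Fin n)) R (Pi.single i 1) = MvPolynomial.X i := by
  rw [linPoly, Finset.sum_eq_single i]
  · simp
  · intro j _ hj
    simp [hj]
  · simp

lemma linPoly_zsmul (c : ℤ) (v : Fin n → ℤ) : linPoly (Pi.basisFun ℤ (Fin n)) R (c • v) =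
    MvPolynomial.C (c : R) * linPoly (Pi.basisFun ℤ (Fin n)) R v := by
  simp [linPoly, Finset.mul_sum, mul_assoc]

lemma linPoly_neg (v : Fin n → ℤ) : linPoly (Pi.basisFun ℤ (Fin n)) R (-v) =
    -linPoly (Pi.basisFun ℤ (Fin n)) R v := by
  simp [linPoly]

lemma linPoly_extVec (i : Fin (n + 1)) :
    linPoly (Pi.basisFun ℤ (Fin n)) R (extVec n i) = extVar R n i := by
  refine Fin.lastCases ?_ (fun i => ?_) i
  · simp [linPoly, extVec]
  · rw [extVar_castSucc, ← linPoly_single]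
    simp [extVec]

lemma linSubst_signedPerm (σ : Equiv.Perm (Fin n)) (ε : Fin n → ℤ) :
    linSubst (Pi.basisFun ℤ (Fin n)) R (signedPerm σ ε) =
      MvPolynomial.aeval fun i => MvPolynomial.C (ε i : R) * MvPolynomial.X (σ i) := by
  refine MvPolynomial.algHom_ext fun i => ?_
  rw [linSubst, MvPolynomial.aeval_X, MvPolynomial.aeval_X, Pi.basisFun_apply, signedPerm_single,
    linPoly_zsmul, linPoly_single]

lemma linSubst_extPerm (σ : Equiv.Perm (Fin (n + 1))) :
    linSubst (Pi.basisFun ℤ (Fin n)) R (extPerm σ) = extRename R σ := by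
  refine MvPolynomial.algHom_ext fun i => ?_
  rw [linSubst, MvPolynomial.aeval_X, extRename, MvPolynomial.aeval_X, Pi.basisFun_apply]
  have : (Pi.single i 1 : Fin n → ℤ) = extVec n i.castSucc := by simp [extVec]
  rw [this, extPerm_extVec, linPoly_extVec]

/-- The simple reflections of types `B_n` and `C_n` in orthogonal coordinates. -/
def reflBC (i : Fin n) : (Fin n → ℤ) →+ (Fin n → ℤ) :=
  if h : (i : ℕ) + 1 < n then signedPerm (Equiv.swap i ⟨i + 1, h⟩) 1
  else signedPerm 1 fun j => if j = i then -1 else 1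

/-- The simple reflections of type `D_n` in orthogonal coordinates. -/
def reflD (i : Fin n) : (Fin n → ℤ) →+ (Fin n → ℤ) :=
  if h : (i : ℕ) + 1 < n then signedPerm (Equiv.swap i ⟨i + 1, h⟩) 1
  else signedPerm (Equiv.swap ⟨i - 1, by omega⟩ i) fun j =>
    if j = ⟨i - 1, by omega⟩ ∨ j = i then -1 else 1

/-- The simple reflections of type `A_n`, as adjacent transpositions of the vectors `extVec n i`. -/
def reflA (i : Fin n) : (Fin n → ℤ) →+ (Fin n → ℤ) :=
  extPerm (Equiv.swap i.castSucc i.succ)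

/-- The simple reflections of type `G₂`: a transposition and the negative of a transposition of the
three vectors `extVec 2 i`. -/
def reflG : Fin 2 → (Fin 2 → ℤ) →+ (Fin 2 → ℤ) :=
  ![extPerm (Equiv.swap 1 2), -extPerm (Equiv.swap 0 1)]

end Reflections

/-! ### Invariants in the formal group algebra -/

section Lifts

variable {R : Type*} [CommRing R] {n : ℕ} {F : FormalGroup R}

lemma map_aeval_esymm {S : Type*} [CommRing S] [Algebra R S] {κ : Type*} [Fintype κ] {y : κ → S}
    {T : S →ₐ[R] S} (σ : Equiv.Perm κ) (h : ∀ k, T (y k) = y (σ k)) (j : ℕ) :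
    T (MvPolynomial.aeval y (MvPolynomial.esymm κ R j)) =
      MvPolynomial.aeval y (MvPolynomial.esymm κ R j) := by
  rw [← AlgHom.comp_apply, MvPolynomial.comp_aeval]
  simp only [h]
  conv_rhs => rw [← MvPolynomial.rename_esymm κ R _ σ, MvPolynomial.aeval_rename]
  rfl

variable [F.IsComm]

/-- For vectors `u k` permuted up to signs, the elementary symmetric functions of the products
`x_{u k} x_{-u k}` are invariants with leading forms the elementary symmetric functions of the
`-(u k) ^ 2`. -/
lemma hasInvariantLifts_sq {r : Fin n → (Fin n → ℤ) →+ (Fin n → ℤ)} {κ : Type*} [Fintype κ]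
    (u : κ → (Fin n → ℤ)) (hu : ∀ i, ∃ σ : Equiv.Perm κ, ∀ k, r i (u k) = u (σ k) ∨
      r i (u k) = -u (σ k)) (K : ℕ) (g : ℕ → ℕ) (hg : ∀ k, g k ≠ 0) :
    HasInvariantLifts F r K fun k => MvPolynomial.aeval
      (fun i => -linPoly (Pi.basisFun ℤ (Fin n)) R (u i) ^ 2) (MvPolynomial.esymm κ R (g k)) := by
  have hc := isCoordinates (Pi.basisFun ℤ (Fin n)) F
  refine ⟨fun k => g k * (1 + 1), fun k => MvPolynomial.aeval (fun i => x F (u i) * x F (-u i))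
    (MvPolynomial.esymm κ R (g k)), fun k _ => ⟨?_, IsLead.esymm hc (fun i => ?_) _, fun i => ?_⟩⟩
  · simpa using hg k
  · have h := (isLead_x (Pi.basisFun ℤ (Fin n)) F (u i)).mul hc
      (isLead_x (Pi.basisFun ℤ (Fin n)) F (-u i))
    rwa [linPoly_neg, mul_neg, ← pow_two] at h
  · obtain ⟨σ, hσ⟩ := hu i
    refine map_aeval_esymm σ (fun k => ?_) _
    rw [map_mul, act_x, act_x, map_neg]
    obtain h | h := hσ k
    · rw [h]
    · rw [h, neg_neg, mul_comm]

lemma hasInvariantLifts_reflA (F : FormalGroup R) [F.IsComm] :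
    HasInvariantLifts F (reflA (n := n)) n (extEsymm R n) := by
  have hc := isCoordinates (Pi.basisFun ℤ (Fin n)) F
  refine ⟨fun k => (k + 2) * 1, fun k => MvPolynomial.aeval (fun i => -x F (extVec n i))
    (MvPolynomial.esymm (Fin (n + 1)) R (k + 2)), fun k _ => ⟨by simp,
      IsLead.esymm hc (fun i => ?_) _, fun i => ?_⟩⟩
  · rw [← linPoly_extVec]
    exact (isLead_x (Pi.basisFun ℤ (Fin n)) F _).neg
  · refine map_aeval_esymm (Equiv.swap i.castSucc i.succ) (fun k => ?_) _
    rw [map_neg, act_x, reflA, extPerm_extVec]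

/-- The elementary symmetric polynomials in the `-X_i ^ 2`. -/
def sqEsymm (R : Type*) [CommRing R] (n k : ℕ) : MvPolynomial (Fin n) R :=
  MvPolynomial.aeval (fun i => -MvPolynomial.X i ^ 2) (MvPolynomial.esymm (Fin n) R (k + 1))

lemma signedPerm_single_eq_or (σ : Equiv.Perm (Fin n)) (ε : Fin n → ℤ) (i : Fin n)
    (hε : ε i = 1 ∨ ε i = -1) :
    signedPerm σ ε (Pi.single i 1) = Pi.single (σ i) 1 ∨
      signedPerm σ ε (Pi.single i 1) = -Pi.single (σ i) 1 := by
  rw [signedPerm_single]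
  obtain h | h := hε
  · left; rw [h, one_smul]
  · right; rw [h, neg_one_smul]

lemma hasInvariantLifts_of_signedPerm {r : Fin n → (Fin n → ℤ) →+ (Fin n → ℤ)}
    (h : ∀ i, ∃ σ ε, r i = signedPerm σ ε ∧ ∀ j, ε j = 1 ∨ ε j = -1) (K : ℕ) :
    HasInvariantLifts F r K (sqEsymm R n) := by
  have h1 := hasInvariantLifts_sq (F := F) (r := r) (fun i : Fin n => Pi.single i 1) (fun i => by
    obtain ⟨σ, ε, h, hε⟩ := h i
    refine ⟨σ, fun k => ?_⟩
    rw [h]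
    exact signedPerm_single_eq_or σ ε k (hε k)) K (fun k => k + 1) (fun k => k.succ_ne_zero)
  simp only [linPoly_single] at h1
  exact h1

lemma reflBC_eq_signedPerm (i : Fin n) :
    ∃ σ ε, reflBC i = signedPerm σ ε ∧ ∀ j, ε j = 1 ∨ ε j = -1 := by
  rw [reflBC]
  split_ifs with h
  · exact ⟨_, _, rfl, fun j => Or.inl rfl⟩
  · exact ⟨_, _, rfl, fun j => by split_ifs <;> simp⟩

lemma reflD_eq_signedPerm (hn : 2 ≤ n) (i : Fin n) :
    ∃ σ ε, reflD i = signedPerm σ ε ∧ (∀ j, ε j = 1 ∨ ε j = -1) ∧ ∏ j, ε j = 1 := by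
  rw [reflD]
  split_ifs with h
  · exact ⟨_, _, rfl, fun j => Or.inl rfl, by simp⟩
  · refine ⟨_, _, rfl, fun j => by split_ifs <;> simp, ?_⟩
    have hne : (⟨i - 1, by omega⟩ : Fin n) ≠ i := fun h => by
      have := congrArg Fin.val h
      simp only at this
      omega
    rw [Finset.prod_eq_mul _ _ hne (fun j _ hj => by simp [hj.1, hj.2]) (by simp) (by simp)]
    simp

/-- The invariants of type `D_n` if `2` is invertible. -/
def pfaffEsymm (R : Type*) [CommRing R] (n k : ℕ) : MvPolynomial (Fin n) R :=
  if k + 1 < n then sqEsymm R n k else ∏ i, MvPolynomial.X i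

/-- If `2` is invertible, the product of the variables is the leading form of
`2 ^ (-n) * ∏ (x_{e_i} - x_{-e_i})`. -/
lemma hasInvariantLifts_reflD (hn : 2 ≤ n) (h2 : IsUnit (2 : R)) (F : FormalGroup R) [F.IsComm] :
    HasInvariantLifts F (reflD (n := n)) n (pfaffEsymm R n) := by
  have hc := isCoordinates (Pi.basisFun ℤ (Fin n)) F
  obtain ⟨c, hc2⟩ := h2.exists_left_inv
  obtain ⟨e, f, h⟩ := hasInvariantLifts_of_signedPerm (F := F) (r := reflD (n := n)) (fun i => by
    obtain ⟨σ, ε, h, hε, -⟩ := reflD_eq_signedPerm hn i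
    exact ⟨σ, ε, h, hε⟩) n
  set y : Fin n → FGA (Fin n → ℤ) F := fun i => x F (Pi.single i 1) - x F (-Pi.single i 1) with hy
  have hylead (i : Fin n) : IsLead (augIdeal F) (coord (Pi.basisFun ℤ (Fin n)) F) 1 (c • y i)
      (MvPolynomial.X i) := by
    have h1 := ((isLead_x (Pi.basisFun ℤ (Fin n)) F (Pi.single i 1)).sub
      (isLead_x (Pi.basisFun ℤ (Fin n)) F (-Pi.single i 1))).smul c
    rwa [linPoly_neg, sub_neg_eq_add, linPoly_single, ← two_mul, MvPolynomial.smul_eq_C_mul,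
      ← map_ofNat MvPolynomial.C, ← mul_assoc, ← map_mul, hc2, map_one, one_mul] at h1
  refine ⟨fun k => if k + 1 < n then e k else n, fun k => if k + 1 < n then f k else ∏ i, c • y i,
    fun k hk => ?_⟩
  by_cases hk' : k + 1 < n
  · simp only [pfaffEsymm, if_pos hk']
    exact h k hk
  · simp only [pfaffEsymm, if_neg hk']
    refine ⟨by omega, ?_, fun i => ?_⟩
    · have h1 := IsLead.prod hc Finset.univ fun i _ => hylead i
      simpa using h1
    · obtain ⟨σ, ε, hσ, hε, hp⟩ := reflD_eq_signedPerm hn i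
      have h1 (j : Fin n) : act F (reflD i) (c • y j) = (ε j : FGA (Fin n → ℤ) F) * c • y (σ j) := by
        rw [map_smul, hy]
        simp only
        rw [map_sub, act_x, act_x, map_neg, hσ, signedPerm_single]
        obtain h | h := hε j
        · simp [h]
        · rw [h, neg_one_zsmul, neg_neg, Int.cast_neg, Int.cast_one, neg_one_mul, ← smul_neg, neg_sub]
      rw [map_prod, Finset.prod_congr rfl fun j _ => h1 j, Finset.prod_mul_distrib,
        ← Int.cast_prod, hp, Int.cast_one, one_mul]
      exact Equiv.prod_comp σ fun j => c • y j

lemma hasInvariantLifts_reflG (F : FormalGroup R) [F.IsComm] :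
    HasInvariantLifts F reflG 2 (gPoly R) := by
  have h1 := hasInvariantLifts_sq (F := F) (r := reflG) (extVec 2) (fun i => by
    fin_cases i
    · exact ⟨Equiv.swap 1 2, fun k => Or.inl (extPerm_extVec _ k)⟩
    · exact ⟨Equiv.swap 0 1, fun k => Or.inr (congrArg (- ·) (extPerm_extVec _ k))⟩) 2
    (fun k => 2 * k + 1) (fun k => by omega)
  obtain ⟨e, f, h⟩ := h1
  refine ⟨e, f, fun k hk => ?_⟩
  convert h k hk using 3
  have h0 : extVar R 2 0 = MvPolynomial.X 0 := extVar_castSucc R 2 0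
  have h1 : extVar R 2 1 = MvPolynomial.X 1 := extVar_castSucc R 2 1
  have h2 : extVar R 2 2 = -∑ i, MvPolynomial.X i := extVar_last R 2
  simp only [linPoly_extVec]
  obtain rfl | rfl : k = 0 ∨ k = 1 := by omega
  · rw [gPoly, if_pos rfl, extEsymm_two_zero, mul_zero, zero_add, MvPolynomial.esymm_one, map_sum]
    simp only [MvPolynomial.aeval_X]
    rw [Fin.sum_univ_three, h0, h1, h2, Fin.sum_univ_two]
    ring
  · have h3 := aeval_esymm_card R fun i => -extVar R 2 i ^ 2
    rw [Fintype.card_fin] at h3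
    rw [gPoly, if_neg one_ne_zero, extEsymm_two_one]
    refine Eq.trans ?_ h3.symm
    rw [Fin.prod_univ_three, h0, h1, h2, Fin.sum_univ_two]
    ring

end Lifts

/-! ### Orthogonal coordinates of the weight lattices -/

section Realizations

variable {n : ℕ}

/-- The compatibility of `toE` with the reflections follows from that of `ofE` if the latter is
injective. -/
def Realization.ofInjective {A : Matrix (Fin n) (Fin n) ℤ} (c : ℕ)
    {r : Fin n → (Fin n → ℤ) →+ (Fin n → ℤ)} (toE ofE : (Fin n → ℤ) →+ (Fin n → ℤ))
    (diag : ∀ i, A i i = 2) (hinj : ∀ v, ofE v = 0 → v = 0) (ofE_toE : ∀ v, ofE (toE v) = c • v)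
    (ofE_reflection : ∀ i v, ofE v - ofE v i • A i = ofE (r i v)) : Realization A c r where
  toE := toE
  ofE := ofE
  diag := diag
  ofE_toE := ofE_toE
  ofE_reflection := ofE_reflection
  toE_reflection i v := by
    rw [← sub_eq_zero]
    apply hinj
    rw [map_sub, ← ofE_reflection, ofE_toE, ofE_toE, Pi.smul_apply, smul_sub, smul_assoc, sub_self]

/-- The map `v ↦ (v_1 - v_2, …, v_{n-1} - v_n, l v)`. -/
def chainMap (l : (Fin n → ℤ) →+ ℤ) : (Fin n → ℤ) →+ (Fin n → ℤ) :=
  AddMonoidHom.mk' (fun v i => if h : (i : ℕ) + 1 < n then v i - v ⟨i + 1, h⟩ else l v)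
    fun v w => by
      funext i
      simp only [Pi.add_apply, map_add]
      split_ifs <;> ring

lemma chainMap_apply (l : (Fin n → ℤ) →+ ℤ) (v : Fin n → ℤ) (i : Fin n) :
    chainMap l v i = if h : (i : ℕ) + 1 < n then v i - v ⟨i + 1, h⟩ else l v := rfl

lemma eq_zero_of_chainMap {l : (Fin n → ℤ) →+ ℤ} {k : Fin n} (hk : (k : ℕ) + 1 = n)
    (hl : ∀ v, (∀ i, v i = v k) → l v = 0 → v k = 0) {v : Fin n → ℤ} (h : chainMap l v = 0) :
    v = 0 := by
  have h1 (j : ℕ) : ∀ i : Fin n, (i : ℕ) + j + 1 = n → v i = v k := by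
    induction j with
    | zero =>
      intro i hi
      congr 1
      ext
      omega
    | succ j ih =>
      intro i hi
      have h2 := congrFun h i
      rw [chainMap_apply, dif_pos (by omega), Pi.zero_apply, sub_eq_zero] at h2
      rw [h2]
      exact ih _ (by simp only; omega)
  have h2 (i : Fin n) : v i = v k := h1 (n - 1 - i) i (by omega)
  have h3 := congrFun h k
  rw [chainMap_apply, dif_neg (by omega), Pi.zero_apply] at h3
  funext i
  rw [h2, hl v h2 h3, Pi.zero_apply]

/-- The map whose `j`-th coordinate is `c * (v_j + ⋯ + v_n) - m v`. -/
def tailMap (c : ℕ) (m : (Fin n → ℤ) →+ ℤ) : (Fin n → ℤ) →+ (Fin n → ℤ) :=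
  AddMonoidHom.mk' (fun v j => c * (∑ i, if j ≤ i then v i else 0) - m v) fun v w => by
    funext j
    have h : (∑ i, if j ≤ i then v i + w i else 0) =
        (∑ i, if j ≤ i then v i else 0) + ∑ i, if j ≤ i then w i else 0 := by
      rw [← Finset.sum_add_distrib]
      exact Finset.sum_congr rfl fun i _ => by split_ifs <;> simp
    simp only [Pi.add_apply, map_add, h]
    ring

lemma tailMap_apply (c : ℕ) (m : (Fin n → ℤ) →+ ℤ) (v : Fin n → ℤ) (j : Fin n) :
    tailMap c m v j = c * (∑ i, if j ≤ i then v i else 0) - m v := rfl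

lemma tailMap_sub (c : ℕ) (m : (Fin n → ℤ) →+ ℤ) (v : Fin n → ℤ) (j k : Fin n)
    (h : (j : ℕ) + 1 = k) : tailMap c m v j - tailMap c m v k = c * v j := by
  rw [tailMap_apply, tailMap_apply, sub_sub_sub_cancel_right, ← mul_sub, ← Finset.sum_sub_distrib]
  congr 1
  rw [Finset.sum_eq_single j]
  · have : ¬ k ≤ j := by rw [Fin.le_def]; omega
    simp [this]
  · intro i _ hi
    have : j ≤ i ↔ k ≤ i := by
      rw [Fin.le_def, Fin.le_def]
      have := Fin.val_ne_of_ne hi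
      omega
    simp [this]
  · simp

lemma tailMap_last (c : ℕ) (m : (Fin n → ℤ) →+ ℤ) (v : Fin n → ℤ) (k : Fin n)
    (hk : (k : ℕ) + 1 = n) : tailMap c m v k = c * v k - m v := by
  rw [tailMap_apply, Finset.sum_eq_single k]
  · simp
  · intro i _ hi
    have : ¬ k ≤ i := by
      rw [Fin.le_def]
      have := Fin.val_ne_of_ne hi
      omega
    simp [this]
  · simp

lemma chainMap_tailMap {l m : (Fin n → ℤ) →+ ℤ} {c : ℕ} {k : Fin n} (hk : (k : ℕ) + 1 = n)
    (h : ∀ v, l (tailMap c m v) = c * v k) (v : Fin n → ℤ) :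
    chainMap l (tailMap c m v) = c • v := by
  funext i
  rw [chainMap_apply]
  split_ifs with hi
  · rw [tailMap_sub c m v i _ rfl]
    simp
  · obtain rfl : i = k := by ext; omega
    rw [h]
    simp

/-- The `k`-th coordinate as an additive map. -/
def coordHom (k : Fin n) : (Fin n → ℤ) →+ ℤ := Pi.evalAddMonoidHom _ k

lemma exists_nat_fun (v : Fin n → ℤ) : ∃ w : ℕ → ℤ, v = fun i : Fin n => w i :=
  ⟨fun k => if h : k < n then v ⟨k, h⟩ else 0, by simp⟩

lemma reflBC_apply (w : ℕ → ℤ) (i k : Fin n) : reflBC i (fun j : Fin n => w j) k =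
    if (i : ℕ) + 1 < n then
      (if (k : ℕ) = i then w (i + 1) else if (k : ℕ) = i + 1 then w i else w k)
    else if (k : ℕ) = i then - w k else w k := by
  have h0 : (Equiv.symm (1 : Equiv.Perm (Fin n))) k = k := rfl
  rw [reflBC]
  split_ifs with h1 h2 h3 h4 <;> simp_all [signedPerm_apply, Equiv.swap_apply_def, Fin.ext_iff]

lemma reflD_apply (hn : 2 ≤ n) (w : ℕ → ℤ) (i k : Fin n) : reflD i (fun j : Fin n => w j) k =
    if (i : ℕ) + 1 < n then
      (if (k : ℕ) = i then w (i + 1) else if (k : ℕ) = i + 1 then w i else w k)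
    else if (k : ℕ) = i then - w (i - 1) else if (k : ℕ) + 1 = i then -w i else w k := by
  have := i.2
  have := k.2
  rw [reflD]
  split_ifs with h1 h2 h3 h4 h5 <;>
    simp only [signedPerm_apply, Equiv.symm_swap, Equiv.swap_apply_def, Fin.ext_iff, Pi.one_apply,
      one_mul] <;> grind

/-- Type `B_n`: `e_i = ω_i - ω_{i-1}` for `i < n` and `e_n = 2 ω_n - ω_{n-1}`. -/
def realizationB (hn : n ≠ 0) : Realization (CartanMatrix.B n) 2 (reflBC (n := n)) :=
  Realization.ofInjective 2 (tailMap 2 (coordHom ⟨n - 1, by omega⟩))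
    (chainMap (2 • coordHom ⟨n - 1, by omega⟩)) (by simp)
    (fun v h => eq_zero_of_chainMap (k := ⟨n - 1, by omega⟩) (by simp only; omega)
      (fun v _ h => by simpa [coordHom] using h) h)
    (chainMap_tailMap (k := ⟨n - 1, by omega⟩) (by simp only; omega) fun v => by
      change 2 • tailMap _ _ v _ = _
      rw [tailMap_last _ _ _ _ (by simp only; omega)]
      simp [coordHom]
      ring)
    fun i v => by
      obtain ⟨w, rfl⟩ := exists_nat_fun v
      funext k
      simp only [Pi.sub_apply, Pi.smul_apply, smul_eq_mul, chainMap_apply, reflBC_apply,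
        CartanMatrix.B, Matrix.of_apply, Fin.ext_iff, coordHom, AddMonoidHom.smul_apply,
        Pi.evalAddMonoidHom_apply]
      have := i.2
      have := k.2
      grind

/-- Type `C_n`: `e_i = ω_i - ω_{i-1}`. -/
def realizationC (hn : n ≠ 0) : Realization (CartanMatrix.C n) 1 (reflBC (n := n)) :=
  Realization.ofInjective 1 (tailMap 1 0)
    (chainMap (coordHom ⟨n - 1, by omega⟩)) (by simp)
    (fun v h => eq_zero_of_chainMap (k := ⟨n - 1, by omega⟩) (by simp only; omega)
      (fun v _ h => by simpa [coordHom] using h) h)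
    (chainMap_tailMap (k := ⟨n - 1, by omega⟩) (by simp only; omega) fun v => by
      change tailMap _ _ v _ = _
      rw [tailMap_last _ _ _ _ (by simp only; omega)]
      simp)
    fun i v => by
      obtain ⟨w, rfl⟩ := exists_nat_fun v
      funext k
      simp only [Pi.sub_apply, Pi.smul_apply, smul_eq_mul, chainMap_apply, reflBC_apply,
        CartanMatrix.C, Matrix.of_apply, Fin.ext_iff, coordHom,
        Pi.evalAddMonoidHom_apply]
      have := i.2
      have := k.2
      grind

/-- Type `D_n`: `e_i = ω_i - ω_{i-1}` for `i < n - 1`, `e_{n-1} = ω_{n-1} + ω_n - ω_{n-2}` and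
`e_n = ω_n - ω_{n-1}`. -/
def realizationD (hn : 3 ≤ n) : Realization (CartanMatrix.D n) 2 (reflD (n := n)) :=
  Realization.ofInjective 2
    (tailMap 2 (coordHom ⟨n - 1, by omega⟩ + coordHom ⟨n - 2, by omega⟩))
    (chainMap (coordHom ⟨n - 1, by omega⟩ + coordHom ⟨n - 2, by omega⟩)) (by simp)
    (fun v h => eq_zero_of_chainMap (k := ⟨n - 1, by omega⟩) (by simp only; omega)
      (fun v h1 h => by
        have h2 := h1 ⟨n - 2, by omega⟩
        simp only [coordHom, AddMonoidHom.add_apply, Pi.evalAddMonoidHom_apply] at h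
        omega) h)
    (chainMap_tailMap (k := ⟨n - 1, by omega⟩) (by simp only; omega) fun v => by
      change tailMap _ _ v _ + tailMap _ _ v _ = _
      have h1 := tailMap_sub 2 (coordHom ⟨n - 1, by omega⟩ + coordHom ⟨n - 2, by omega⟩) v
        ⟨n - 2, by omega⟩ ⟨n - 1, by omega⟩ (by simp only; omega)
      rw [sub_eq_iff_eq_add.1 h1, tailMap_last _ _ _ _ (by simp only; omega)]
      simp [coordHom]
      ring)
    fun i v => by
      obtain ⟨w, rfl⟩ := exists_nat_fun v
      funext k
      have hn' : 2 ≤ n := by omega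
      simp only [Pi.sub_apply, Pi.smul_apply, smul_eq_mul, chainMap_apply, reflD_apply hn',
        CartanMatrix.D, Matrix.of_apply, Fin.ext_iff, coordHom, AddMonoidHom.add_apply,
        Pi.evalAddMonoidHom_apply]
      have := i.2
      have := k.2
      grind (splits := 30)

lemma reflA_apply (w : ℕ → ℤ) (hw : w n = 0) (i k : Fin n) : reflA i (fun j : Fin n => w j) k =
    (if (k : ℕ) = i then w (i + 1) else if (k : ℕ) = i + 1 then w i else w k) -
      if (i : ℕ) + 1 = n then w i else 0 := by
  have h (k : Fin (n + 1)) : Fin.snoc (α := fun _ => ℤ) (fun j : Fin n => w j) 0 k = w k := by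
    refine Fin.lastCases ?_ (fun k => ?_) k <;> simp [hw]
  have := i.2
  have := k.2
  rw [reflA, extPerm_apply, h, h]
  simp only [Equiv.symm_swap, Equiv.swap_apply_def, Fin.ext_iff, Fin.val_castSucc, Fin.val_succ,
    Fin.val_last]
  grind

/-- Type `A_n`: `e_i = ω_i - ω_{i-1}`. -/
def realizationA (hn : n ≠ 0) : Realization (CartanMatrix.A n) 1 (reflA (n := n)) :=
  Realization.ofInjective 1 (tailMap 1 0)
    (chainMap (coordHom ⟨n - 1, by omega⟩)) (fun i => by simp [CartanMatrix.A])
    (fun v h => eq_zero_of_chainMap (k := ⟨n - 1, by omega⟩) (by simp only; omega)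
      (fun v _ h => by simpa [coordHom] using h) h)
    (chainMap_tailMap (k := ⟨n - 1, by omega⟩) (by simp only; omega) fun v => by
      change tailMap _ _ v _ = _
      rw [tailMap_last _ _ _ _ (by simp only; omega)]
      simp)
    fun i v => by
      obtain ⟨w, hw, rfl⟩ : ∃ w : ℕ → ℤ, w n = 0 ∧ v = fun i : Fin n => w i :=
        ⟨fun k => if h : k < n then v ⟨k, h⟩ else 0, by simp, by simp⟩
      funext k
      simp only [Pi.sub_apply, Pi.smul_apply, smul_eq_mul, chainMap_apply, reflA_apply w hw,
        CartanMatrix.A, Matrix.of_apply, Fin.ext_iff, coordHom,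
        Pi.evalAddMonoidHom_apply]
      have := i.2
      have := k.2
      grind

lemma reflG_zero (v : Fin 2 → ℤ) : reflG 0 v = ![v 0 - v 1, -v 1] := by
  have h0 : (Equiv.swap 1 2 : Equiv.Perm (Fin 3)).symm (Fin.castSucc 0) = Fin.castSucc 0 := by decide
  have h1 : (Equiv.swap 1 2 : Equiv.Perm (Fin 3)).symm (Fin.castSucc 1) = Fin.last 2 := by decide
  have h2 : (Equiv.swap 1 2 : Equiv.Perm (Fin 3)).symm (Fin.last 2) = Fin.castSucc 1 := by decide
  refine funext (Fin.forall_fin_two.2 ⟨?_, ?_⟩)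
  · change extPerm (Equiv.swap 1 2 : Equiv.Perm (Fin 3)) v 0 = v 0 - v 1
    rw [extPerm_apply, h0, h2, Fin.snoc_castSucc, Fin.snoc_castSucc]
  · change extPerm (Equiv.swap 1 2 : Equiv.Perm (Fin 3)) v 1 = -v 1
    rw [extPerm_apply, h1, h2, Fin.snoc_castSucc, Fin.snoc_last, zero_sub]

lemma reflG_one (v : Fin 2 → ℤ) : reflG 1 v = ![-v 1, -v 0] := by
  have h0 : (Equiv.swap 0 1 : Equiv.Perm (Fin 3)).symm (Fin.castSucc 0) = Fin.castSucc 1 := by decide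
  have h1 : (Equiv.swap 0 1 : Equiv.Perm (Fin 3)).symm (Fin.castSucc 1) = Fin.castSucc 0 := by decide
  have h2 : (Equiv.swap 0 1 : Equiv.Perm (Fin 3)).symm (Fin.last 2) = Fin.last 2 := by decide
  refine funext (Fin.forall_fin_two.2 ⟨?_, ?_⟩)
  · change -(extPerm (Equiv.swap 0 1 : Equiv.Perm (Fin 3)) v 0) = -v 1
    rw [extPerm_apply, h0, h2, Fin.snoc_castSucc, Fin.snoc_last, sub_zero]
  · change -(extPerm (Equiv.swap 0 1 : Equiv.Perm (Fin 3)) v 1) = -v 0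
    rw [extPerm_apply, h1, h2, Fin.snoc_castSucc, Fin.snoc_last, sub_zero]

/-- Type `G₂`: `e_1 = ω_2`, `e_2 = ω_2 - ω_1`. -/
def realizationG : Realization CartanMatrix.G₂ 1 reflG :=
  Realization.ofInjective 1
    (AddMonoidHom.mk' (fun v => ![v 0 + v 1, -v 0]) fun v w => by
      ext k; fin_cases k <;> simp <;> ring)
    (AddMonoidHom.mk' (fun v => ![-v 1, v 0 + v 1]) fun v w => by
      ext k; fin_cases k <;> simp <;> ring)
    (fun i => by fin_cases i <;> rfl)
    (fun v h => by
      have h0 := congrFun h 0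
      have h1 := congrFun h 1
      simp at h0 h1
      ext k
      fin_cases k
      · simpa [h0] using h1
      · exact h0)
    (fun v => by ext k; fin_cases k <;> simp)
    (fun i v => by
      ext k
      fin_cases i
      · simp only [Fin.zero_eta, Fin.isValue, reflG_zero]
        fin_cases k <;> simp [CartanMatrix.G₂] <;> ring
      · simp only [Fin.mk_one, Fin.isValue, reflG_one]
        fin_cases k <;> simp [CartanMatrix.G₂] <;> ring)

end Realizations

/-! ### Multiples of the exponents in the classical types and `G₂` -/

section Multiples

variable {R : Type*} [CommRing R] {n : ℕ} {F F' : FormalGroup R} [F.IsComm] [F'.IsComm]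

lemma linSubst_signedPerm_one (σ : Equiv.Perm (Fin n)) :
    linSubst (Pi.basisFun ℤ (Fin n)) R (signedPerm σ 1) = MvPolynomial.rename σ := by
  rw [linSubst_signedPerm]
  refine MvPolynomial.algHom_ext fun i => ?_
  simp

lemma isSymmetric_of_linSubst {r : Fin n → (Fin n → ℤ) →+ (Fin n → ℤ)}
    (hr : ∀ (i : Fin n) (h : (i : ℕ) + 1 < n), r i = signedPerm (Equiv.swap i ⟨i + 1, h⟩) 1)
    {q : MvPolynomial (Fin n) R} (hq : ∀ i, linSubst (Pi.basisFun ℤ (Fin n)) R (r i) q = q) :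
    q.IsSymmetric := by
  refine isSymmetric_of_swap fun i j hij => ?_
  have h : (i : ℕ) + 1 < n := hij ▸ j.2
  obtain rfl : j = ⟨i + 1, h⟩ := Fin.ext hij.symm
  rw [← linSubst_signedPerm_one, ← hr i h, hq]

lemma mem_span_sqEsymm_of_mul_mem {k : ℕ} (hk : k < n) {q : MvPolynomial (Fin n) R}
    (hq : q * sqEsymm R n k ∈ Ideal.span (sqEsymm R n '' Set.Iio k)) :
    q ∈ Ideal.span (sqEsymm R n '' Set.Iio k) :=
  mem_span_esymm_of_mul_mem R two_ne_zero hk (fun _ => rfl) hq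

lemma expand_mem_adjoin_sqEsymm {a : MvPolynomial (Fin n) R} (ha : a.IsSymmetric) :
    MvPolynomial.expand 2 a ∈ Algebra.adjoin R (sqEsymm R n '' Set.Iio n) :=
  expand_mem_adjoin ha

/-- Types `B_n` (with `c = 2`) and `C_n` (with `c = 1`). -/
lemma Realization.isExponentMultiple_reflBC {A : Matrix (Fin n) (Fin n) ℤ} {c : ℕ}
    (ρ : Realization A c (reflBC (n := n))) (hn : n ≠ 0) (h2 : ∀ r : R, 2 * r = 0 → r = 0) (d : ℕ) :
    IsExponentMultiple (Pi.basisFun ℤ (Fin n)) (weylGroup A) F F' d (c ^ d) := by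
  rw [← one_mul (c ^ d)]
  refine ρ.isExponentMultiple (1 : R) 1 (K := n) (fun k hk q hq => mem_span_sqEsymm_of_mul_mem hk hq)
    (hasInvariantLifts_of_signedPerm reflBC_eq_signedPerm n)
    (hasInvariantLifts_of_signedPerm reflBC_eq_signedPerm n) (fun m _ _ q _ hq => ⟨0, ?_⟩)
    fun q _ M h => by simpa using h
  have hs : q.IsSymmetric := isSymmetric_of_linSubst (fun i h => by rw [reflBC, dif_pos h]) hq
  have hlast := hq ⟨n - 1, by omega⟩
  rw [reflBC, dif_neg (by simp only; omega), linSubst_signedPerm] at hlast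
  obtain ⟨a, ha, rfl⟩ := mem_range_expand hs fun m hm i =>
    even_of_isSymmetric_of_neg h2 hs ⟨n - 1, by omega⟩ (by
      simpa only [Int.cast_ite, Int.cast_neg, Int.cast_one, Equiv.Perm.one_apply] using hlast) hm i
  rw [pow_zero, one_smul]
  exact expand_mem_adjoin_sqEsymm ha

lemma isSymmetric_and_parity_of_reflD (hn : 2 ≤ n) (h2 : ∀ r : R, 2 * r = 0 → r = 0)
    {q : MvPolynomial (Fin n) R}
    (hq : ∀ i, linSubst (Pi.basisFun ℤ (Fin n)) R (reflD i) q = q) :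
    q.IsSymmetric ∧ ∀ m ∈ q.support, (∀ i, Even (m i)) ∨ ∀ i, Odd (m i) := by
  have hs : q.IsSymmetric := isSymmetric_of_linSubst (fun i h => by rw [reflD, dif_pos h]) hq
  refine ⟨hs, fun m hm => ?_⟩
  have hlast := hq ⟨n - 1, by omega⟩
  rw [reflD, dif_neg (by simp only; omega), linSubst_signedPerm] at hlast
  refine parity_of_isSymmetric_of_neg h2 hs (k := ⟨n - 1 - 1, by omega⟩) (l := ⟨n - 1, by omega⟩)
    (fun h => by have := congrArg Fin.val h; simp only at this; omega) ?_ hm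
  -- undo the transposition contained in the last reflection
  refine Eq.trans ?_ (hs (Equiv.swap ⟨n - 1 - 1, by omega⟩ ⟨n - 1, by omega⟩))
  conv_rhs => rw [← hlast]
  rw [← AlgHom.comp_apply, MvPolynomial.comp_aeval]
  congr 2
  funext i
  simp

/-- In degrees less than `n` the invariants of type `D_n` are those of the group of all signed
permutations. -/
lemma isExponentMultiple_D (hn : 3 ≤ n) (h2 : ∀ r : R, 2 * r = 0 → r = 0) {d : ℕ} (hd : d < n) :
    IsExponentMultiple (Pi.basisFun ℤ (Fin n)) (weylGroup (CartanMatrix.D n)) F F' d (2 ^ d) := by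
  rw [← one_mul (2 ^ d)]
  have hr (i : Fin n) : ∃ σ ε, reflD i = signedPerm σ ε ∧ ∀ j, ε j = 1 ∨ ε j = -1 := by
    obtain ⟨σ, ε, h, hε, -⟩ := reflD_eq_signedPerm (by omega) i
    exact ⟨σ, ε, h, hε⟩
  refine (realizationD hn).isExponentMultiple (1 : R) 1 (K := n)
    (fun k hk q hq => mem_span_sqEsymm_of_mul_mem hk hq)
    (hasInvariantLifts_of_signedPerm hr n) (hasInvariantLifts_of_signedPerm hr n)
    (fun e _ he q hqe hq => ⟨0, ?_⟩) fun q _ M h => by simpa using h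
  obtain ⟨hs, hp⟩ := isSymmetric_and_parity_of_reflD (by omega) h2 hq
  obtain ⟨a, ha, rfl⟩ := mem_range_expand hs fun m hm => by
    refine (hp m hm).resolve_right fun hodd => ?_
    -- monomials with odd exponents only have degree at least `n`
    have h1 := hqe (MvPolynomial.mem_support_iff.1 hm)
    have h3 : ∑ _i : Fin n, 1 ≤ ∑ i, m i := Finset.sum_le_sum fun i _ => (hodd i).pos
    rw [Finset.sum_const, Finset.card_univ, Fintype.card_fin, smul_eq_mul, mul_one,
      ← Finsupp.degree_eq_sum, Finsupp.degree_eq_weight_one] at h3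
    change n ≤ Finsupp.weight 1 m at h3
    omega
  rw [pow_zero, one_smul]
  exact expand_mem_adjoin_sqEsymm ha

lemma sqEsymm_last (hn : n ≠ 0) : sqEsymm R n (n - 1) =
    (-1) ^ n * (∏ i, MvPolynomial.X i) ^ 2 := by
  have h := aeval_esymm_card R fun i : Fin n => -(MvPolynomial.X i : MvPolynomial (Fin n) R) ^ 2
  rw [Fintype.card_fin] at h
  rw [sqEsymm, Nat.sub_add_cancel (by omega), h, Finset.prod_neg, Finset.prod_pow,
    Finset.card_univ, Fintype.card_fin]

lemma pfaffEsymm_image {k : ℕ} (hk : k < n) :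
    pfaffEsymm R n '' Set.Iio k = sqEsymm R n '' Set.Iio k :=
  Set.image_congr fun j hj => if_pos (by have := Set.mem_Iio.1 hj; omega)

/-- The last member `∏ X_i` of the sequence divides the last member of the regular sequence of the
`sqEsymm`. -/
lemma mem_span_pfaffEsymm_of_mul_mem {k : ℕ} (hk : k < n) {q : MvPolynomial (Fin n) R}
    (hq : q * pfaffEsymm R n k ∈ Ideal.span (pfaffEsymm R n '' Set.Iio k)) :
    q ∈ Ideal.span (pfaffEsymm R n '' Set.Iio k) := by
  rw [pfaffEsymm_image hk] at hq ⊢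
  refine mem_span_sqEsymm_of_mul_mem hk ?_
  rw [pfaffEsymm] at hq
  split_ifs at hq with h
  · exact hq
  · obtain rfl : k = n - 1 := by omega
    rw [sqEsymm_last (by omega)]
    have := Ideal.mul_mem_left _ ((-1) ^ n * ∏ i, MvPolynomial.X i) hq
    convert this using 1
    ring

lemma adjoin_sqEsymm_le (hn : n ≠ 0) : Algebra.adjoin R (sqEsymm R n '' Set.Iio n) ≤
    Algebra.adjoin R (pfaffEsymm R n '' Set.Iio n) := by
  refine Algebra.adjoin_le ?_
  rintro _ ⟨k, hk, rfl⟩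
  have h1 : pfaffEsymm R n k ∈ Algebra.adjoin R (pfaffEsymm R n '' Set.Iio n) :=
    Algebra.subset_adjoin ⟨k, hk, rfl⟩
  rw [Set.mem_Iio] at hk
  rw [pfaffEsymm] at h1
  split_ifs at h1 with h
  · exact h1
  · obtain rfl : k = n - 1 := by omega
    rw [sqEsymm_last hn]
    exact mul_mem (pow_mem (neg_mem (one_mem _)) _) (pow_mem h1 _)

lemma isExponentMultiple_D_of_isUnit (hn : 3 ≤ n) (h2 : IsUnit (2 : R)) (d : ℕ) :
    IsExponentMultiple (Pi.basisFun ℤ (Fin n)) (weylGroup (CartanMatrix.D n)) F F' d (2 ^ d) := by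
  rw [← one_mul (2 ^ d)]
  refine (realizationD hn).isExponentMultiple (1 : R) 1 (K := n)
    (fun k hk q hq => mem_span_pfaffEsymm_of_mul_mem hk hq)
    (hasInvariantLifts_reflD (by omega) h2 F) (hasInvariantLifts_reflD (by omega) h2 F')
    (fun e _ he q hqe hq => ⟨0, ?_⟩) fun q _ M h => by simpa using h
  obtain ⟨hs, hp⟩ := isSymmetric_and_parity_of_reflD (by omega)
    (fun r hr => (h2.mul_right_eq_zero).1 hr) hq
  obtain ⟨a, b, ha, hb, rfl⟩ := exists_eq_expand_add (by omega) hs hp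
  rw [pow_zero, one_smul]
  have hle := adjoin_sqEsymm_le (R := R) (n := n) (by omega)
  refine add_mem (hle (expand_mem_adjoin_sqEsymm ha)) (mul_mem ?_ (hle (expand_mem_adjoin_sqEsymm hb)))
  refine Algebra.subset_adjoin ⟨n - 1, Nat.sub_lt (by omega) one_pos, ?_⟩
  rw [pfaffEsymm, if_neg (by omega)]

lemma isExponentMultiple_A (hn : n ≠ 0) (h2 : ∀ r : R, 2 * r = 0 → r = 0) (d : ℕ) :
    IsExponentMultiple (Pi.basisFun ℤ (Fin n)) (weylGroup (CartanMatrix.A n)) F F' d 1 := by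
  rw [← one_pow d, ← one_mul (1 ^ d)]
  refine (realizationA hn).isExponentMultiple (1 : R) 1 (K := n)
    (fun k hk q hq => mem_span_extEsymm_of_mul_mem R n hk hq)
    (hasInvariantLifts_reflA F) (hasInvariantLifts_reflA F')
    (fun m _ _ q _ hq => ⟨0, ?_⟩) fun q _ M h => by simpa using h
  rw [pow_zero, one_smul]
  refine mem_adjoin_extEsymm R h2 (extRename_of_swap R fun i => ?_)
  rw [← linSubst_extPerm]
  exact hq i

lemma negSubst_extVar (i : Fin (n + 1)) : negSubst R n (extVar R n i) = -extVar R n i := by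
  refine Fin.lastCases ?_ (fun i => ?_) i
  · simp [negSubst, extVar_last]
  · simp [negSubst, extVar_castSucc]

lemma negSubst_extRename (σ : Equiv.Perm (Fin (n + 1))) (q : MvPolynomial (Fin n) R) :
    negSubst R n (extRename R σ q) = extRename R σ (negSubst R n q) := by
  rw [← AlgHom.comp_apply, ← AlgHom.comp_apply]
  congr 1
  refine MvPolynomial.algHom_ext fun i => ?_
  rw [AlgHom.comp_apply, AlgHom.comp_apply, extRename, MvPolynomial.aeval_X, negSubst_extVar,
    negSubst, MvPolynomial.aeval_X, map_neg, MvPolynomial.aeval_X]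

lemma linSubst_neg (w : (Fin n → ℤ) →+ (Fin n → ℤ)) (q : MvPolynomial (Fin n) R) :
    linSubst (Pi.basisFun ℤ (Fin n)) R (-w) q =
      linSubst (Pi.basisFun ℤ (Fin n)) R w (negSubst R n q) := by
  rw [← AlgHom.comp_apply]
  congr 1
  refine MvPolynomial.algHom_ext fun i => ?_
  rw [AlgHom.comp_apply, negSubst, MvPolynomial.aeval_X, map_neg, linSubst, linSubst,
    MvPolynomial.aeval_X, MvPolynomial.aeval_X, ← linPoly_neg]
  rfl

/-- The reflections of type `G₂` generate the permutations of the three forms and `-1`. -/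
lemma isExponentMultiple_G (h2 : ∀ r : R, 2 * r = 0 → r = 0) (d : ℕ) :
    IsExponentMultiple (Pi.basisFun ℤ (Fin 2)) (weylGroup CartanMatrix.G₂) F F' d 2 := by
  suffices h : IsExponentMultiple (Pi.basisFun ℤ (Fin 2)) (weylGroup CartanMatrix.G₂) F F' d
      (2 * 1 ^ d) by rwa [one_pow, mul_one] at h
  refine realizationG.isExponentMultiple (2 : R) 2 (K := 2)
    (fun k hk q hq => mem_span_gPoly_of_mul_mem h2 hk hq)
    (hasInvariantLifts_reflG F) (hasInvariantLifts_reflG F')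
    (fun m _ _ q _ hq => ?_) fun q _ M h => two_smul_mem_span_gPoly h2 h
  have hS : extRename R (Equiv.swap 1 2) q = q := by
    rw [← linSubst_extPerm]
    exact hq 0
  have hT : extRename R (Equiv.swap 0 1) (negSubst R 2 q) = q := by
    rw [← linSubst_extPerm, ← linSubst_neg]
    exact hq 1
  have hN (q : MvPolynomial (Fin 2) R) : negSubst R 2 (negSubst R 2 q) = q := by
    rw [← AlgHom.comp_apply, negSubst, MvPolynomial.comp_aeval]
    simp
  rw [← negSubst_extRename] at hT
  replace hT : extRename R (Equiv.swap 0 1) q = negSubst R 2 q := by rw [← hN (extRename R _ q), hT]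
  have hST : extRename R (Equiv.swap 1 2 * Equiv.swap 0 1) q = negSubst R 2 q := by
    rw [extRename_mul, hT, ← negSubst_extRename, hS]
  -- the product of the two transpositions has the odd order `3`
  have hneg : negSubst R 2 q = q := by
    have h3 : (Equiv.swap 1 2 * Equiv.swap 0 1 : Equiv.Perm (Fin 3)) *
        ((Equiv.swap 1 2 * Equiv.swap 0 1) * (Equiv.swap 1 2 * Equiv.swap 0 1)) = 1 := by decide
    have h1 : extRename R (1 : Equiv.Perm (Fin 3)) q = q := by
      have : extRename R (1 : Equiv.Perm (Fin 3)) = AlgHom.id R _ :=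
        MvPolynomial.algHom_ext fun i => by
          rw [extRename, MvPolynomial.aeval_X, Equiv.Perm.one_apply, extVar_castSucc]
          rfl
      rw [this]
      rfl
    rw [← h3, extRename_mul R (_ * _), extRename_mul R (_ * _), hST, ← negSubst_extRename,
      hST, hN, hST] at h1
    exact h1
  refine exists_pow_smul_mem_adjoin_gPoly h2 (extRename_of_swap R fun i => ?_) hneg
  fin_cases i
  · exact hT.trans hneg
  · exact hS

end Multiples

/-! ### Parity of the torsion index -/

section TorsionIndex

variable {n : ℕ} {A : Matrix (Fin n) (Fin n) ℤ}

lemma map_eq_sum_single {M : Type*} [AddCommGroup M] (φ : (Fin n → ℤ) →+ M) (v : Fin n → ℤ) :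
    φ v = ∑ j, v j • φ (Pi.single j 1) := by
  conv_lhs => rw [← Finset.univ_sum_single v, map_sum]
  refine Finset.sum_congr rfl fun j _ => ?_
  rw [← map_zsmul, ← Pi.single_smul, smul_eq_mul, mul_one]

lemma linForm_add (v w : Fin n → ℤ) : linForm (v + w) = linForm v + linForm w := by
  simp [linForm, add_mul, Finset.sum_add_distrib]

lemma symAct_linForm (w : (Fin n → ℤ) ≃ₗ[ℤ] (Fin n → ℤ)) (v : Fin n → ℤ) :
    symAct w (linForm v) = linForm (w v) := by
  let φ : (Fin n → ℤ) →+ MvPolynomial (Fin n) ℤ := AddMonoidHom.mk' linForm linForm_add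
  have h : φ (w v) = ∑ j, v j • φ (w (Pi.single j 1)) :=
    map_eq_sum_single (φ.comp w.toLinearMap.toAddMonoidHom) v
  change _ = φ (w v)
  rw [h, linForm, map_sum]
  refine Finset.sum_congr rfl fun j _ => ?_
  rw [map_mul, ← MvPolynomial.algebraMap_eq, AlgHom.commutes, symAct, MvPolynomial.aeval_X,
    ← Algebra.smul_def]
  rfl

lemma symAct_mul (v w : (Fin n → ℤ) ≃ₗ[ℤ] (Fin n → ℤ)) (f : MvPolynomial (Fin n) ℤ) :
    symAct (v * w) f = symAct v (symAct w f) := by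
  rw [← AlgHom.comp_apply]
  congr 1
  refine MvPolynomial.algHom_ext fun i => ?_
  have h (u : (Fin n → ℤ) ≃ₗ[ℤ] (Fin n → ℤ)) :
      symAct u (MvPolynomial.X i) = linForm (u (Pi.single i 1)) := MvPolynomial.aeval_X _ _
  rw [AlgHom.comp_apply, h, h, symAct_linForm]
  rfl

lemma symAct_one (f : MvPolynomial (Fin n) ℤ) : symAct 1 f = f := by
  have : symAct (1 : (Fin n → ℤ) ≃ₗ[ℤ] (Fin n → ℤ)) = AlgHom.id ℤ _ :=
    MvPolynomial.algHom_ext fun i => by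
      rw [symAct, MvPolynomial.aeval_X, linForm, Finset.sum_eq_single i]
      · simp
      · intro j _ hj
        simp [hj]
      · simp
  rw [this]
  rfl

/-- If a specialization `φ` of the weights to a domain of characteristic `2` is invariant under an
involution `κ` in the Weyl group and does not vanish on the roots, then the terms of
`∑ det(w) w(f)` cancel in pairs under `φ`, while `∏ β` remains nonzero. -/
theorem even_torsionIndex {K : Type*} [CommRing K] [IsDomain K] [CharP K 2]
    (φ : (Fin n → ℤ) →+ K) {κ : (Fin n → ℤ) ≃ₗ[ℤ] (Fin n → ℤ)} (hκ : κ ∈ weylGroup A)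
    (hκ1 : κ ≠ 1) (hκ2 : κ * κ = 1) (hφ : ∀ v, φ (κ v) = φ v) (hroot : ∀ β ∈ posRoots A, φ β ≠ 0) :
    2 ∣ torsionIndex A := by
  rw [torsionIndex]
  set s := {c : ℕ | 0 < c ∧ ∃ f : MvPolynomial (Fin n) ℤ, f.IsHomogeneous (posRoots A).ncard ∧
    ∑ᶠ w : weylGroup A, (LinearMap.det (w : (Fin n → ℤ) ≃ₗ[ℤ] (Fin n → ℤ)).toLinearMap) •
        symAct w.1 f = c • ∏ᶠ β ∈ posRoots A, linForm β} with hs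
  -- `sInf ∅ = 0` is divisible by `2`
  obtain h | h := s.eq_empty_or_nonempty
  · rw [h, Nat.sInf_empty]
    exact dvd_zero 2
  obtain ⟨-, f, -, e⟩ := Nat.sInf_mem h
  let ψ : MvPolynomial (Fin n) ℤ →ₐ[ℤ] K := MvPolynomial.aeval fun j => φ (Pi.single j 1)
  have hψ (v : Fin n → ℤ) : ψ (linForm v) = φ v := by
    rw [map_eq_sum_single φ]
    simp [ψ, linForm, map_sum]
  have hψκ (p : MvPolynomial (Fin n) ℤ) : ψ (symAct κ p) = ψ p := by
    rw [← AlgHom.comp_apply]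
    congr 1
    refine MvPolynomial.algHom_ext fun i => ?_
    rw [AlgHom.comp_apply, symAct, MvPolynomial.aeval_X, hψ, hφ, MvPolynomial.aeval_X]
  have h2 : (2 : K) = 0 := CharTwo.two_eq_zero
  have hdet (w : (Fin n → ℤ) ≃ₗ[ℤ] (Fin n → ℤ)) : (LinearMap.det w.toLinearMap : ℤ) = 1 ∨
      (LinearMap.det w.toLinearMap : ℤ) = -1 := Int.isUnit_iff.1 w.isUnit_det'
  have hψdet (w : (Fin n → ℤ) ≃ₗ[ℤ] (Fin n → ℤ)) (p : MvPolynomial (Fin n) ℤ) :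
      ψ ((LinearMap.det w.toLinearMap) • p) = ψ p := by
    obtain h | h := hdet w
    · rw [h, one_smul]
    · rw [h, neg_one_smul, map_neg]
      linear_combination -(ψ p) * h2
  have hprod : ψ (∏ᶠ β ∈ posRoots A, linForm β) ≠ 0 := by
    refine finprod_mem_induction (fun p => ψ p ≠ 0) ?_ (fun p q hp hq => ?_) fun β hβ => ?_
    · rw [map_one]
      exact one_ne_zero
    · rw [map_mul]
      exact mul_ne_zero hp hq
    · rw [hψ]
      exact hroot β hβ
  have hsum : ψ (∑ᶠ w : weylGroup A,
      (LinearMap.det (w : (Fin n → ℤ) ≃ₗ[ℤ] (Fin n → ℤ)).toLinearMap) • symAct w.1 f) = 0 := by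
    -- a sum with infinite support would be zero by definition
    by_cases hfin : (Function.support fun w : weylGroup A =>
      (LinearMap.det (w : (Fin n → ℤ) ≃ₗ[ℤ] (Fin n → ℤ)).toLinearMap) • symAct w.1 f).Finite
    · rw [finsum_eq_sum _ hfin, map_sum]
      simp only [hψdet]
      refine Finset.sum_involution (fun w _ => ⟨κ, hκ⟩ * w) (fun w _ => ?_) (fun w _ _ h => ?_)
        (fun w hw => ?_) fun w _ => ?_
      · change ψ (symAct w.1 f) + ψ (symAct (κ * w.1) f) = 0
        rw [symAct_mul, hψκ]
        linear_combination (ψ (symAct w.1 f)) * h2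
      · exact hκ1 (congrArg Subtype.val (mul_eq_right.1 h))
      · rw [Set.Finite.mem_toFinset, Function.mem_support] at hw ⊢
        have hne : symAct w.1 f ≠ 0 := fun h => hw (by rw [h, smul_zero])
        have hne' : symAct (κ * w.1) f ≠ 0 := fun h => hne (by
          rw [← symAct_one (symAct w.1 f), ← hκ2, symAct_mul, ← symAct_mul κ w.1, h, map_zero])
        change (LinearMap.det (κ * w.1).toLinearMap) • symAct (κ * w.1) f ≠ 0
        obtain h | h := hdet (κ * w.1)
        · rwa [h, one_smul]
        · rwa [h, neg_one_smul, neg_ne_zero]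
      · rw [← mul_assoc]
        have : (⟨κ, hκ⟩ : weylGroup A) * ⟨κ, hκ⟩ = 1 := Subtype.ext hκ2
        rw [this, one_mul]
    · rw [finsum_of_infinite_support hfin, map_zero]
  rw [e, map_nsmul, nsmul_eq_mul] at hsum
  exact (CharP.cast_eq_zero_iff K 2 _).1 ((mul_eq_zero.1 hsum).resolve_right hprod)

/-- A set of weights stable under the simple reflections that contains the simple roots contains all
roots. -/
lemma posRoots_subset (hA : ∀ i, A i i = 2) {S : Set (Fin n → ℤ)} (h : ∀ i, A i ∈ S)
    (hS : ∀ i, ∀ v ∈ S, v - v i • A i ∈ S) : posRoots A ⊆ S := by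
  rintro _ ⟨⟨w, hw, i, rfl⟩, -⟩
  suffices hiff : ∀ v, v ∈ S ↔ w v ∈ S from (hiff _).1 (h i)
  induction hw using Subgroup.closure_induction with
  | mem s hs =>
    obtain ⟨i, hs⟩ := hs
    refine fun v => ⟨fun hv => hs v ▸ hS i v hv, fun hv => ?_⟩
    have h1 := hS i _ hv
    rwa [hs v, ← simpleReflection_apply A hA, ← simpleReflection_apply A hA,
      show simpleReflection A hA i (simpleReflection A hA i v) = v from
        LinearEquiv.apply_symm_apply (simpleReflection A hA i) v] at h1
  | one => exact fun v => Iff.rfl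
  | mul v w _ _ hv hw => exact fun u => (hw u).trans (hv (w u))
  | inv w _ hw =>
    intro v
    rw [hw (w⁻¹ v)]
    change v ∈ S ↔ w (w.symm v) ∈ S
    rw [LinearEquiv.apply_symm_apply]

/-- A weight as a linear form modulo `2`. -/
def modTwo (n : ℕ) : (Fin n → ℤ) →+ MvPolynomial (Fin n) (ZMod 2) :=
  AddMonoidHom.mk' (fun v => ∑ i, MvPolynomial.C (v i : ZMod 2) * MvPolynomial.X i) fun v w => by
    simp [add_mul, Finset.sum_add_distrib]

lemma even_of_modTwo_eq_zero {v : Fin n → ℤ} (h : modTwo n v = 0) (i : Fin n) : Even (v i) := by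
  have h1 := congrArg (MvPolynomial.coeff (Finsupp.single i 1)) h
  change MvPolynomial.coeff _ (∑ j, _) = _ at h1
  rw [MvPolynomial.coeff_sum, Finset.sum_eq_single i] at h1
  · rw [MvPolynomial.coeff_C_mul, MvPolynomial.coeff_X, if_pos rfl, mul_one,
      MvPolynomial.coeff_zero] at h1
    exact (ZMod.intCast_eq_zero_iff_even).1 h1
  · intro j _ hj
    rw [MvPolynomial.coeff_C_mul, MvPolynomial.coeff_X, if_neg (fun h => hj
      (Finsupp.single_left_injective one_ne_zero h)), mul_zero]
  · simp

/-- If `-1` is in the Weyl group, the torsion index is even, unless a simple root is divisible by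
`2`. -/
lemma even_torsionIndex_of_neg (hn : n ≠ 0) (hA : ∀ i, A i i = 2) (h : ∀ i, ∃ k, Odd (A i k))
    (hneg : LinearEquiv.neg ℤ ∈ weylGroup A) : 2 ∣ torsionIndex A := by
  refine even_torsionIndex (modTwo n) hneg (fun h => ?_) (LinearEquiv.ext fun v => ?_) (fun v => ?_)
    fun β hβ h0 => ?_
  · have h1 := congrFun (LinearEquiv.congr_fun h 1) ⟨0, Nat.pos_of_ne_zero hn⟩
    simp at h1
  · simp
  · change modTwo n (-v) = _
    rw [map_neg, CharTwo.neg_eq]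
  · obtain ⟨k, hk⟩ := posRoots_subset hA (S := {v | ∃ k, Odd (v k)}) h (fun i v hv => by
      by_contra! h1
      obtain ⟨k, hk⟩ := hv
      have h2 (k : Fin n) : Even (v k - v i * A i k) := by
        by_contra h3
        exact h1 ⟨k, by simpa using h3⟩
      have h3 := h2 i
      rw [hA, Int.even_sub] at h3
      have h4 := h2 k
      rw [Int.even_sub] at h4
      have h5 : Even (v i) := h3.2 (by simp)
      exact (Int.not_even_iff_odd.2 hk) (h4.2 (h5.mul_right _))) hβ
    exact (Int.not_even_iff_odd.2 hk) (even_of_modTwo_eq_zero h0 k)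

variable {c : ℕ} {r : Fin n → (Fin n → ℤ) →+ (Fin n → ℤ)}

/-- The self-map `g` of `ℤ^n` is induced by an element of the Weyl group. -/
def Realization.Lifts (ρ : Realization A c r) (g : (Fin n → ℤ) → (Fin n → ℤ)) : Prop :=
  ∃ w ∈ weylGroup A, ∀ v, w (ρ.ofE v) = ρ.ofE (g v)

variable (ρ : Realization A c r)

lemma Realization.lifts_reflection (i : Fin n) : ρ.Lifts (r i) :=
  ⟨_, simpleReflection_mem A ρ.diag i, fun v => by
    rw [simpleReflection_apply, ρ.ofE_reflection]⟩

variable {ρ}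

lemma Realization.Lifts.comp {g g' : (Fin n → ℤ) → (Fin n → ℤ)} (h : ρ.Lifts g)
    (h' : ρ.Lifts g') : ρ.Lifts (g ∘ g') := by
  obtain ⟨w, hw, e⟩ := h
  obtain ⟨w', hw', e'⟩ := h'
  exact ⟨w * w', mul_mem hw hw', fun v => by
    rw [LinearEquiv.mul_apply, e', e, Function.comp_apply]⟩

variable (ρ) in
/-- The sign vectors `ε` whose diagonal matrices are induced by elements of the Weyl group. -/
def Realization.signs : Submonoid (Fin n → ℤ) where
  carrier := {ε | ρ.Lifts fun v j => ε j * v j}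
  one_mem' := ⟨1, one_mem _, fun v => by simp⟩
  mul_mem' {ε ε'} h h' := by
    have h1 := Realization.Lifts.comp h h'
    have h2 : ((fun (v : Fin n → ℤ) j => ε j * v j) ∘ fun (v : Fin n → ℤ) j => ε' j * v j) =
        fun (v : Fin n → ℤ) j => (ε * ε') j * v j := by
      funext v j
      simp [mul_assoc]
    rw [h2] at h1
    exact h1

lemma Realization.comp_swap_mem_signs {i i' : Fin n} (hr : r i = signedPerm (Equiv.swap i i') 1)
    {ε : Fin n → ℤ} (h : ε ∈ ρ.signs) : ε ∘ Equiv.swap i i' ∈ ρ.signs := by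
  have h1 := ((ρ.lifts_reflection i).comp h).comp (ρ.lifts_reflection i)
  have h2 : ((r i) ∘ fun v j => ε j * v j) ∘ (r i) =
      fun (v : Fin n → ℤ) j => (ε ∘ Equiv.swap i i') j * v j := by
    funext v j
    simp [hr, signedPerm_apply]
  rwa [h2] at h1

lemma even_torsionIndex_B (hn : 3 ≤ n) : 2 ∣ torsionIndex (CartanMatrix.B n) := by
  set ρ := realizationB (n := n) (by omega)
  refine even_torsionIndex_of_neg (by omega) ρ.diag (fun i => ?_) ?_
  · by_cases h : (i : ℕ) = 0
    · refine ⟨⟨1, by omega⟩, ?_⟩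
      have h1 : ¬ (i = ⟨1, by omega⟩) := fun h' => by simp [h'] at h
      have h2 : (CartanMatrix.B n) i ⟨1, by omega⟩ = -1 := by
        simp [CartanMatrix.B, h, h1]
        omega
      rw [h2]
      decide
    · refine ⟨⟨i - 1, by omega⟩, ?_⟩
      have h1 : ¬ (i = ⟨i - 1, by omega⟩) := fun h' => by
        have := congrArg Fin.val h'
        simp only at this
        omega
      have h2 : (CartanMatrix.B n) i ⟨i - 1, by omega⟩ = -1 := by
        simp [CartanMatrix.B, h1]
        omega
      rw [h2]
      decide
  have key (m : ℕ) : ∀ i : Fin n, (i : ℕ) + m + 1 = n →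
      (fun j => if j = i then -1 else 1 : Fin n → ℤ) ∈ ρ.signs := by
    induction m with
    | zero =>
      intro i hi
      have h1 := ρ.lifts_reflection i
      have h2 : ⇑(reflBC i) = fun (v : Fin n → ℤ) j => (if j = i then -1 else 1) * v j := by
        funext v j
        rw [reflBC, dif_neg (by omega)]
        rfl
      rwa [h2] at h1
    | succ m ih =>
      intro i hi
      have h1 := Realization.comp_swap_mem_signs (i := i) (i' := ⟨i + 1, by omega⟩)
        (by rw [reflBC, dif_pos]) (ih ⟨i + 1, by omega⟩ (by simp only; omega))
      convert h1 using 1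
      funext j
      simp [Equiv.swap_apply_eq_iff]
  have hneg : (-1 : Fin n → ℤ) ∈ ρ.signs := by
    have h1 := Submonoid.prod_mem ρ.signs (t := Finset.univ) fun (i : Fin n) _ =>
      key (n - 1 - i) i (by omega)
    convert h1 using 1
    funext j
    simp [Finset.prod_apply]
  obtain ⟨w, hw, e⟩ := hneg
  convert hw
  refine LinearEquiv.ext fun v => ?_
  have h1 := e (ρ.toE v)
  have h2 : (fun j => (-1 : Fin n → ℤ) j * ρ.toE v j) = -ρ.toE v := by
    funext j
    simp
  simp only [h2, map_neg, ρ.ofE_toE, map_nsmul] at h1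
  rw [← smul_neg] at h1
  exact (nsmul_right_injective two_ne_zero h1).symm

lemma even_torsionIndex_G : 2 ∣ torsionIndex CartanMatrix.G₂ := by
  refine even_torsionIndex_of_neg two_ne_zero realizationG.diag (fun i => ?_) ?_
  · fin_cases i
    · exact ⟨1, by decide⟩
    · exact ⟨0, by decide⟩
  have h1 := (realizationG.lifts_reflection 0).comp (realizationG.lifts_reflection 1)
  obtain ⟨w, hw, e⟩ := (h1.comp h1).comp h1
  convert hw
  refine LinearEquiv.ext fun v => ?_
  have h2 := e (realizationG.toE v)
  have h3 : (((reflG 0 ∘ reflG 1) ∘ (reflG 0 ∘ reflG 1)) ∘ (reflG 0 ∘ reflG 1))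
      (realizationG.toE v) = -realizationG.toE v := by
    simp only [Function.comp_apply, reflG_zero, reflG_one]
    funext j
    fin_cases j <;> simp
  rw [h3, map_neg, realizationG.ofE_toE, one_smul] at h2
  exact h2.symm

end TorsionIndex

/-! ### Parity of the torsion index in type `D` -/

section TorsionIndexD

variable {n : ℕ}

/-- The weights of type `D_n` modulo `2` and modulo the vector `e_n = ω_n - ω_{n-1}`. -/
def modTwoD (hn : 2 ≤ n) : (Fin n → ℤ) →+ MvPolynomial (Fin n) (ZMod 2) :=
  (modTwo n).comp (AddMonoidHom.mk' (fun v j => if (j : ℕ) + 2 = n then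
    v ⟨n - 2, by omega⟩ + v ⟨n - 1, by omega⟩ else if (j : ℕ) + 1 = n then 0 else v j)
      fun v w => by
        funext j
        simp only [Pi.add_apply]
        split_ifs <;> ring)

lemma even_of_modTwoD_eq_zero {hn : 2 ≤ n} {v : Fin n → ℤ} (h : modTwoD hn v = 0) (i : Fin n)
    (hi : (i : ℕ) + 2 < n) : Even (v i) := by
  have h1 := even_of_modTwo_eq_zero h i
  simp only [AddMonoidHom.mk'_apply] at h1
  rwa [if_neg (by omega), if_neg (by omega)] at h1

lemma modTwoD_eq_zero {hn : 2 ≤ n} {v : Fin n → ℤ} (h : ∀ i : Fin n, (i : ℕ) + 2 < n → v i = 0)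
    (h' : v ⟨n - 2, by omega⟩ + v ⟨n - 1, by omega⟩ = 0) : modTwoD hn v = 0 := by
  rw [modTwoD, AddMonoidHom.comp_apply, AddMonoidHom.mk'_apply, ← map_zero (modTwo n)]
  congr 1
  funext j
  rw [Pi.zero_apply]
  split_ifs with h1 h2
  · exact h'
  · rfl
  · exact h j (by omega)

lemma realizationD_ofE_apply (hn : 3 ≤ n) (v : Fin n → ℤ) (i : Fin n) :
    (realizationD hn).ofE v i = if h : (i : ℕ) + 1 < n then v i - v ⟨i + 1, h⟩ else
      v ⟨n - 1, by omega⟩ + v ⟨n - 2, by omega⟩ := rfl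

/-- The element of the Weyl group of type `D_n` that changes the signs of `e_1, …, e_{n-1}`, and that of
`e_n` if `n` is even. -/
lemma exists_mem_weylGroup_D (hn : 3 ≤ n) : ∃ w ∈ weylGroup (CartanMatrix.D n),
    ∀ v, w ((realizationD hn).ofE v) = (realizationD hn).ofE fun j =>
      (if (j : ℕ) + 1 = n then (-1) ^ (n - 1) else -1) * v j := by
  set ρ := realizationD hn
  set l : Fin n := ⟨n - 1, by omega⟩ with hl
  have key (m : ℕ) : ∀ i : Fin n, (i : ℕ) + m + 2 = n →
      (fun j => if j = i ∨ j = l then -1 else 1 : Fin n → ℤ) ∈ ρ.signs := by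
    induction m with
    | zero =>
      intro i hi
      have h1 := (ρ.lifts_reflection i).comp (ρ.lifts_reflection l)
      have h2 : ⇑(reflD i) ∘ ⇑(reflD l) =
          fun (v : Fin n → ℤ) j => (if j = i ∨ j = l then -1 else 1) * v j := by
        funext v j
        have h3 : (⟨i + 1, by omega⟩ : Fin n) = l := by ext; simp only [hl]; omega
        have h4 : (⟨l - 1, by omega⟩ : Fin n) = i := by ext; simp only [hl]; omega
        rw [Function.comp_apply, reflD, dif_pos (by omega), reflD,
          dif_neg (by simp only [hl]; omega)]
        simp only [h3, h4]
        simp [signedPerm_apply]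
      rwa [h2] at h1
    | succ m ih =>
      intro i hi
      have h1 := Realization.comp_swap_mem_signs (i := i) (i' := ⟨i + 1, by omega⟩)
        (by rw [reflD, dif_pos]) (ih ⟨i + 1, by omega⟩ (by simp only; omega))
      convert h1 using 1
      funext j
      have h2 : Equiv.swap i ⟨i + 1, by omega⟩ j = l ↔ j = l := by
        rw [Equiv.swap_apply_eq_iff, Equiv.swap_apply_of_ne_of_ne]
        · exact fun h => by have := congrArg Fin.val h; simp only [hl] at this; omega
        · exact fun h => by have := congrArg Fin.val h; simp only [hl] at this; omega
      simp only [Function.comp_apply, h2]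
      simp [Equiv.swap_apply_eq_iff]
  have h1 := Submonoid.prod_mem ρ.signs (t := Finset.univ.erase l) fun (i : Fin n) hi =>
    key (n - 2 - i) i (by
      have := Fin.val_ne_of_ne (Finset.ne_of_mem_erase hi)
      simp only [hl] at this
      omega)
  have h2 : (∏ i ∈ Finset.univ.erase l, fun j => if j = i ∨ j = l then -1 else 1 : Fin n → ℤ) =
      fun j : Fin n => if (j : ℕ) + 1 = n then (-1) ^ (n - 1) else -1 := by
    funext j
    rw [Finset.prod_apply]
    split_ifs with h
    · have : j = l := by ext; simp only [hl]; omega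
      simp [this]
    · have hj : j ≠ l := fun h' => h (by rw [h', hl]; simp only; omega)
      simp [hj]
  rw [h2] at h1
  exact h1

/-- The simple roots of type `D_n`, in orthogonal coordinates. -/
lemma realizationD_row (hn : 3 ≤ n) (i : Fin n) :
    ∃ x : Fin n → ℤ, (realizationD hn).ofE x = CartanMatrix.D n i ∧
      (Finset.univ.filter fun j => Odd (x j)).card = 2 := by
  have h1 := (realizationD hn).ofE_reflection i (Pi.single i 1)
  have h2 : (realizationD hn).ofE (Pi.single i 1) i = 1 := by
    rw [realizationD_ofE_apply]
    split_ifs with h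
    · simp [Fin.ext_iff]
    · have h3 : (⟨n - 1, by omega⟩ : Fin n) = i := by ext; simp only; omega
      have h4 : (⟨n - 2, by omega⟩ : Fin n) ≠ i := fun h => by
        have := congrArg Fin.val h
        simp only at this
        omega
      simp [h3, h4]
  obtain ⟨j, hj, h3⟩ : ∃ j, j ≠ i ∧ (reflD i (Pi.single i 1) = Pi.single j 1 ∨
      reflD i (Pi.single i 1) = -Pi.single j 1) := by
    rw [reflD]
    split_ifs with h
    · refine ⟨⟨i + 1, h⟩, fun h => ?_, Or.inl ?_⟩
      · have := congrArg Fin.val h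
        simp at this
      · simp [signedPerm_single]
    · refine ⟨⟨i - 1, by omega⟩, fun h => ?_, Or.inr ?_⟩
      · have := congrArg Fin.val h
        simp only at this
        omega
      · simp [signedPerm_single]
  refine ⟨Pi.single i 1 - reflD i (Pi.single i 1), ?_, ?_⟩
  · rw [map_sub, ← h1, h2, one_smul, sub_sub_cancel]
  · rw [← Finset.card_pair hj.symm]
    congr 1
    ext k
    rw [Finset.mem_filter, Finset.mem_insert, Finset.mem_singleton, Pi.sub_apply]
    by_cases hki : k = i
    · subst hki
      obtain h3 | h3 := h3 <;> simp [h3, hj.symm]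
    · by_cases hkj : k = j
      · subst hkj
        obtain h3 | h3 := h3 <;> simp [h3, hj]
      · obtain h3 | h3 := h3 <;> simp [h3, hki, hkj]

lemma card_odd_reflD (hn : 2 ≤ n) (i : Fin n) (x : Fin n → ℤ) :
    (Finset.univ.filter fun j => Odd (reflD i x j)).card =
      (Finset.univ.filter fun j => Odd (x j)).card := by
  obtain ⟨σ, ε, h, hε, -⟩ := reflD_eq_signedPerm hn i
  have h1 (j : Fin n) : Odd (reflD i x j) ↔ Odd (x (σ.symm j)) := by
    rw [h, signedPerm_apply]
    obtain h2 | h2 := hε (σ.symm j) <;> simp [h2]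
  simp only [h1]
  refine Finset.card_bij (fun j _ => σ.symm j) (fun j hj => ?_) (fun _ _ _ _ h => σ.symm.injective h)
    fun j hj => ⟨σ j, ?_, σ.symm_apply_apply j⟩
  · simpa using hj
  · simpa using hj

lemma even_torsionIndex_D (hn : 4 ≤ n) : 2 ∣ torsionIndex (CartanMatrix.D n) := by
  have hn3 : 3 ≤ n := by omega
  obtain ⟨κ, hκ, e⟩ := exists_mem_weylGroup_D hn3
  set ρ := realizationD hn3
  set g : (Fin n → ℤ) → (Fin n → ℤ) := fun v j =>
    (if (j : ℕ) + 1 = n then (-1) ^ (n - 1) else -1) * v j with hg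
  have h2κ (v : Fin n → ℤ) : 2 • κ v = ρ.ofE (g (ρ.toE v)) := by
    rw [← map_nsmul, ← ρ.ofE_toE, e]
  have hgg (v : Fin n → ℤ) : g (g v) = v := by
    funext j
    simp only [hg]
    split_ifs
    · rw [← mul_assoc, ← mul_pow]
      simp
    · ring
  -- `κ v + v` is a multiple of `e_n`
  have hadd (v : Fin n → ℤ) (i : Fin n) : 2 * (κ v i + v i) =
      ρ.ofE (g (ρ.toE v) + ρ.toE v) i := by
    have h1 := congrFun (h2κ v) i
    have h2 := congrFun (ρ.ofE_toE v) i
    rw [map_add, Pi.add_apply, ← h1, h2]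
    simp [mul_add]
  have hzero (v : Fin n → ℤ) (j : Fin n) (hj : (j : ℕ) + 1 ≠ n) :
      (g (ρ.toE v) + ρ.toE v) j = 0 := by
    simp [hg, hj]
  have hsmall (v : Fin n → ℤ) (i : Fin n) (hi : (i : ℕ) + 2 < n) : (κ v + v) i = 0 := by
    have h1 := hadd v i
    rw [realizationD_ofE_apply, dif_pos (by omega), hzero _ _ (by omega),
      hzero _ _ (by simp only; omega)] at h1
    rw [Pi.add_apply]
    omega
  refine even_torsionIndex (modTwoD (by omega : 2 ≤ n)) hκ (fun h => ?_)
    (LinearEquiv.ext fun v => ?_) (fun v => ?_) fun β hβ h0 => ?_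
  · have h1 := hsmall 1 ⟨0, by omega⟩ (by simp only; omega)
    rw [h] at h1
    simp at h1
  · have h1 : 2 • κ (κ v) = 2 • v := by
      rw [← map_nsmul, h2κ, e]
      change ρ.ofE (g (g (ρ.toE v))) = _
      rw [hgg, ρ.ofE_toE]
    exact nsmul_right_injective two_ne_zero h1
  · have h1 : modTwoD (by omega : 2 ≤ n) (κ v + v) = 0 := by
      refine modTwoD_eq_zero (hsmall v) ?_
      have h1 := hadd v ⟨n - 2, by omega⟩
      have h2 := hadd v ⟨n - 1, by omega⟩
      rw [realizationD_ofE_apply, dif_pos (by simp only; omega),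
        hzero _ ⟨n - 2, _⟩ (by simp only; omega)] at h1
      rw [realizationD_ofE_apply, dif_neg (by simp only; omega),
        hzero _ ⟨n - 2, _⟩ (by simp only; omega)] at h2
      have h3 : (⟨n - 2 + 1, by omega⟩ : Fin n) = ⟨n - 1, by omega⟩ := by ext; simp only; omega
      simp only [h3] at h1
      rw [Pi.add_apply, Pi.add_apply]
      omega
    rw [map_add] at h1
    rw [eq_neg_of_add_eq_zero_left h1, CharTwo.neg_eq]
  · obtain ⟨x, rfl, hx⟩ := posRoots_subset ρ.diag
      (S := {v | ∃ x, ρ.ofE x = v ∧ (Finset.univ.filter fun j => Odd (x j)).card = 2})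
      (realizationD_row hn3) (by
        rintro i _ ⟨x, rfl, hx⟩
        exact ⟨reflD i x, (ρ.ofE_reflection i x).symm, by rw [card_odd_reflD (by omega), hx]⟩) hβ
    -- the first `n - 1` coordinates of `x` have the same parity
    have h1 (m : ℕ) (hm : m + 1 < n) : Odd (x ⟨m, by omega⟩) ↔ Odd (x ⟨0, by omega⟩) := by
      induction m with
      | zero => rfl
      | succ m ih =>
        rw [← ih (by omega)]
        have h2 := even_of_modTwoD_eq_zero h0 ⟨m, by omega⟩ (by simp only; omega)
        rw [realizationD_ofE_apply, dif_pos (by simp only; omega), Int.even_sub] at h2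
        rw [← Int.not_even_iff_odd, ← Int.not_even_iff_odd, h2]
    by_cases h2 : Odd (x ⟨0, by omega⟩)
    · have h3 : ({⟨0, by omega⟩, ⟨1, by omega⟩, ⟨2, by omega⟩} : Finset (Fin n)) ⊆
          Finset.univ.filter fun j => Odd (x j) := by
        intro j hj
        rw [Finset.mem_filter]
        refine ⟨Finset.mem_univ j, ?_⟩
        simp only [Finset.mem_insert, Finset.mem_singleton] at hj
        obtain rfl | rfl | rfl := hj
        · exact h2
        · exact (h1 1 (by omega)).2 h2
        · exact (h1 2 (by omega)).2 h2
      have h4 := Finset.card_le_card h3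
      rw [hx, Finset.card_eq_three.2 ⟨_, _, _, by simp, by simp, by simp, rfl⟩] at h4
      omega
    · have h3 : (Finset.univ.filter fun j => Odd (x j)) ⊆ {⟨n - 1, by omega⟩} := by
        intro j hj
        rw [Finset.mem_filter] at hj
        rw [Finset.mem_singleton]
        by_contra h4
        have h5 := Fin.val_ne_of_ne h4
        simp only at h5
        exact h2 ((h1 j (by omega)).1 hj.2)
      have h4 := Finset.card_le_card h3
      rw [hx, Finset.card_singleton] at h4
      omega

end TorsionIndexD

end FGExp

end

/-- Exponents between commutative one-dimensional formal group laws `F` and `F'` over a commutative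
ring `R` in which `2` is not a zero divisor, for the action of the Weyl group on the weight lattice
in the types `B_n`, `D_n` and `G_2`, and in the types `A_n`, `B_n`, `C_n`, `D_n` and `G_2` if the
torsion index is invertible in `R`. -/
theorem theorem7p11 {R : Type*} [CommRing R] (h2 : ∀ r : R, 2 * r = 0 → r = 0)
    (F F' : FormalGroup R) [F.IsComm] [F'.IsComm] :
    (∀ n d : ℕ, 3 ≤ n → 1 ≤ d →
      FGExp.HasRootExponent (CartanMatrix.B n) F F' d ∧
        FGExp.rootExponent (CartanMatrix.B n) F F' d ∣ 2 ^ d) ∧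
    (∀ n d : ℕ, 4 ≤ n → 1 ≤ d → d < n →
      FGExp.HasRootExponent (CartanMatrix.D n) F F' d ∧
        FGExp.rootExponent (CartanMatrix.D n) F F' d ∣ 2 ^ d) ∧
    (∀ d : ℕ, 1 ≤ d → Even d →
      FGExp.HasRootExponent CartanMatrix.G₂ F F' d ∧
        FGExp.rootExponent CartanMatrix.G₂ F F' d ∣ 2 ^ FGExp.zeta d) ∧
    (∀ (n : ℕ) (A : Matrix (Fin n) (Fin n) ℤ), FGExp.IsTypeABCDG A →
      IsUnit (FGExp.torsionIndex A : R) → ∀ d : ℕ, 1 ≤ d →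
        FGExp.HasRootExponent A F F' d ∧ FGExp.rootExponent A F F' d = 1) := by
  have hcop (k : ℕ) (h0 : ringChar R ≠ 0) : (2 ^ k).Coprime (ringChar R) :=
    FGExp.coprime_two_pow_ringChar h2 k h0
  have hunit {t : ℕ} (ht : 2 ∣ t) (hu : IsUnit (t : R)) : IsUnit (2 : R) := by
    have h := isUnit_of_dvd_unit (Nat.cast_dvd_cast (α := R) ht) hu
    rwa [Nat.cast_ofNat] at h
  refine ⟨fun n d hn _ => ?_, fun n d hn _ hd => ?_, fun d hd hev => ?_, fun n A hA hu d _ => ?_⟩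
  · exact FGExp.exponent_dvd (by positivity) (hcop d)
      ((FGExp.realizationB (by omega)).isExponentMultiple_reflBC (by omega) h2 d)
  · exact FGExp.exponent_dvd (by positivity) (hcop d)
      (FGExp.isExponentMultiple_D (by omega) h2 hd)
  · have hz : 1 ≤ FGExp.zeta d := by
      rw [FGExp.zeta]
      by_cases h : d / 6 = 0
      · have : 1 ≤ d % 6 / 2 := by grind
        omega
      · have : 2 ≤ 3 * (d / 6) * (d / 6 + 1) := by nlinarith [Nat.pos_of_ne_zero h]
        omega
    obtain ⟨h1, h3⟩ := FGExp.exponent_dvd (N := 2) two_pos (by simpa using hcop 1)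
      (FGExp.isExponentMultiple_G (F := F) (F' := F') h2 d)
    exact ⟨h1, h3.trans (dvd_pow_self 2 (by omega))⟩
  · cases hA with
    | A _ hn =>
      exact FGExp.exponent_eq_one (by simp) (FGExp.isExponentMultiple_A (by omega) h2 d)
    | B _ hn =>
      have h := hunit (FGExp.even_torsionIndex_B hn) hu
      exact FGExp.exponent_eq_one (by rw [Nat.cast_pow, Nat.cast_ofNat]; exact h.pow d)
        ((FGExp.realizationB (by omega)).isExponentMultiple_reflBC (by omega) h2 d)
    | C _ hn =>
      exact FGExp.exponent_eq_one (by simp)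
        ((FGExp.realizationC (by omega)).isExponentMultiple_reflBC (by omega) h2 d)
    | D _ hn =>
      have h := hunit (FGExp.even_torsionIndex_D hn) hu
      exact FGExp.exponent_eq_one (by rw [Nat.cast_pow, Nat.cast_ofNat]; exact h.pow d)
        (FGExp.isExponentMultiple_D_of_isUnit (by omega) h d)
    | G₂ =>
      have h := hunit FGExp.even_torsionIndex_G hu
      exact FGExp.exponent_eq_one (by rwa [Nat.cast_ofNat])
        (FGExp.isExponentMultiple_G h2 d)
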